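/- Fix $\theta<1$ and let $q_+=\frac{1+\sqrt{1-\theta}}{6}$. For $\lambda>0$ and $Q=(q_1,q_2,q_3)\in H^1(-1,1)^3$ let $$E_\lambda(Q)=\int_{-1}^1\Big(\frac{3(q_1')^2+(q_2')^2+(q_3')^2}{\lambda^2}+f(Q)\Big)\,dx,$$ $$f(Q)=\frac{\theta}{3}(3q_1^2+q_2^2+q_3^2)+4q_1(q_1^2-q_2^2-q_3^2)+\frac12(3q_1^2+q_2^2+q_3^2)^2+c(\theta),$$ where the constant $c(\theta)$ is such that $\min f=0$. Let $\mathcal H$ be the affine space of all $Q\in H^1(-1,1)^3$ with $q_1(\pm1)=q_+$, $q_2(\pm1)=\mp3q_+$, $q_3(\pm1)=0$, and let $\mathcal H^{ee}=\{Q\in\mathcal H:\ q_3\equiv0\}$. A critical point of $E_\lambda$ is a $Q\in\mathcal H$ at which the derivative of $E_\lambda$ vanishes in all directions of $H^1_0(-1,1)^3$; an eigenvalue exchange solution (for $\lambda$) is a critical point of $E_\lambda$ that belongs to $\mathcal H^{ee}$. For such a solution $\chi$ define $$\nu(\lambda,\chi)=\inf_{0\ne(h_1,h_2)\in H^1_0(-1,1)^2}\frac{D^2E_\lambda(\chi)[(h_1,h_2,0)]}{\int_{-1}^1(h_1^2+h_2^2)\,dx},\qquad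 \mu(\lambda,\chi)=\inf_{0\ne h\in H^1_0(-1,1)}\frac{D^2E_\lambda(\chi)[(0,0,h)]}{\int_{-1}^1h^2\,dx},$$ where $D^2E_\lambda(\chi)[h]=\frac{d^2}{dt^2}E_\lambda(\chi+th)\big|_{t=0}$. Then there are $\lambda_0>0$, $\lambda_*\in[\lambda_0,+\infty]$ and a smooth ($C^\infty$) map $(0,\lambda_*)\to\mathcal H^{ee}$, $\lambda\mapsto\chi_\lambda$ (for the $H^1$ topology), such that $\chi_\lambda$ is an eigenvalue exchange solution for every $\lambda\in(0,\lambda_*)$ and the following holds, with $\nu(\lambda)=\nu(\lambda,\chi_\lambda)$ and $\mu(\lambda)=\mu(\lambda,\chi_\lambda)$. 1. For every $\lambda\in(0,\lambda_0)$, $\chi_\lambda$ is the unique critical point of $E_\lambda$. 2. Every smooth map from $(0,\lambda_*)$ to $\mathcal H^{ee}$ whose value at each $\lambda$ is an eigenvalue exchange solution for $\lambda$ coincides with $\lambda\mapsto\chi_\lambda$. 3. $\nu(\lambda)>0$ for all $\lambda\in(0,\lambda_*)$, and either $\lambda_*=+\infty$ or $\nu(\lambda_*)=0$, where $\nu(\lambda_*)$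 denotes $\lim_{\lambda\uparrow\lambda_*}\nu(\lambda)$. This property determines $\lambda_*$: if $\lambda'\in(0,+\infty]$ and a smooth map of eigenvalue exchange solutions on $(0,\lambda')$ have the same property, then $\lambda'=\lambda_*$. 4. If $\lambda_*<\infty$, then every sequence $\lambda_n\to\lambda_*$ in $(0,\lambda_*)$ has a subsequence along which $\chi_{\lambda_n}$ converges in $H^1$ to an eigenvalue exchange solution $\chi$ for $\lambda_*$ with $\nu(\lambda_*,\chi)=0$. 5. The function $\lambda\mapsto\mu(\lambda)$ is smooth on $(0,\lambda_*)$. -/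

import Mathlib

open MeasureTheory Set Filter Topology
open scoped ContDiff

noncomputable section

namespace NematicCell

/-- Lebesgue measure on the open interval `(-1, 1)`. -/
abbrev cellMeasure : Measure ℝ := volume.restrict (Ioo (-1 : ℝ) 1)

/-- The real Hilbert space `L²(-1, 1)`. -/
abbrev L2 : Type := Lp ℝ 2 cellMeasure

/-- Smooth functions with compact support contained in `(-1, 1)`. -/
def IsTest (φ : ℝ → ℝ) : Prop :=
  ContDiff ℝ ∞ φ ∧ HasCompactSupport φ ∧ tsupport φ ⊆ Ioo (-1 : ℝ) 1

/-- `v` is the weak derivative of `u` on `(-1, 1)`. -/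
def IsWeakDeriv (u v : L2) : Prop :=
  ∀ φ : ℝ → ℝ, IsTest φ →
    ∫ x, u x * deriv φ x ∂cellMeasure = - ∫ x, v x * φ x ∂cellMeasure

lemma integrable_mul_test (u : L2) {φ : ℝ → ℝ} (hc : Continuous φ)
    (hs : HasCompactSupport φ) : Integrable (fun x => u x * φ x) cellMeasure := by
  have hu : Integrable (fun x => u x) cellMeasure := (Lp.memLp u).integrable (by norm_num)
  obtain ⟨C, hC⟩ := hs.exists_bound_of_continuous hc
  exact hu.mul_bdd (c := C) hc.aestronglyMeasurable (Filter.Eventually.of_forall hC)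

lemma IsWeakDeriv.add {u v u' v' : L2} (h : IsWeakDeriv u v) (h' : IsWeakDeriv u' v') :
    IsWeakDeriv (u + u') (v + v') := by
  intro φ hφ
  have hφ' : Continuous (deriv φ) := hφ.1.continuous_deriv (by simp)
  have e1 : ∫ x, (u + u') x * deriv φ x ∂cellMeasure
      = ∫ x, (u x * deriv φ x + u' x * deriv φ x) ∂cellMeasure := by
    apply integral_congr_ae
    filter_upwards [Lp.coeFn_add u u'] with x hx
    rw [hx, Pi.add_apply, add_mul]
  have e2 : ∫ x, (v + v') x * φ x ∂cellMeasure
      = ∫ x, (v x * φ x + v' x * φ x) ∂cellMeasure := by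
    apply integral_congr_ae
    filter_upwards [Lp.coeFn_add v v'] with x hx
    rw [hx, Pi.add_apply, add_mul]
  rw [e1, e2,
    integral_add (integrable_mul_test u hφ' hφ.2.1.deriv) (integrable_mul_test u' hφ' hφ.2.1.deriv),
    integral_add (integrable_mul_test v hφ.1.continuous hφ.2.1)
      (integrable_mul_test v' hφ.1.continuous hφ.2.1), h φ hφ, h' φ hφ]
  ring

lemma IsWeakDeriv.smul {u v : L2} (c : ℝ) (h : IsWeakDeriv u v) :
    IsWeakDeriv (c • u) (c • v) := by
  intro φ hφ
  have e1 : ∫ x, (c • u) x * deriv φ x ∂cellMeasure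
      = ∫ x, c * (u x * deriv φ x) ∂cellMeasure := by
    apply integral_congr_ae
    filter_upwards [Lp.coeFn_smul c u] with x hx
    rw [hx, Pi.smul_apply, smul_eq_mul, mul_assoc]
  have e2 : ∫ x, (c • v) x * φ x ∂cellMeasure
      = ∫ x, c * (v x * φ x) ∂cellMeasure := by
    apply integral_congr_ae
    filter_upwards [Lp.coeFn_smul c v] with x hx
    rw [hx, Pi.smul_apply, smul_eq_mul, mul_assoc]
  rw [e1, e2, integral_const_mul, integral_const_mul, h φ hφ, mul_neg]

lemma IsWeakDeriv.zero : IsWeakDeriv 0 0 := by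
  have h0 : (fun x => (0 : L2) x) =ᵐ[cellMeasure] 0 := Lp.coeFn_zero ℝ 2 cellMeasure
  intro φ _
  have e1 : ∫ x, (0 : L2) x * deriv φ x ∂cellMeasure = 0 := by
    apply integral_eq_zero_of_ae
    filter_upwards [h0] with x hx
    simp only [hx, Pi.zero_apply, zero_mul]
  have e2 : ∫ x, (0 : L2) x * φ x ∂cellMeasure = 0 := by
    apply integral_eq_zero_of_ae
    filter_upwards [h0] with x hx
    simp only [hx, Pi.zero_apply, zero_mul]
  rw [e1, e2, neg_zero]

/-- The Sobolev space `H¹(-1, 1)`, as the space of pairs `(u, u')` in `L² × L²` such that `u'` is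
the weak derivative of `u`, with the Hilbert norm `(‖u‖² + ‖u'‖²)^(1/2)`. -/
def H1 : Submodule ℝ (WithLp 2 (L2 × L2)) where
  carrier := {p | IsWeakDeriv p.fst p.snd}
  add_mem' h h' := IsWeakDeriv.add h h'
  zero_mem' := IsWeakDeriv.zero
  smul_mem' c _ h := IsWeakDeriv.smul c h

/-- The function underlying an element of `H¹(-1, 1)`, defined up to null sets. -/
def fn (u : H1) : ℝ → ℝ := (u : WithLp 2 (L2 × L2)).fst

/-- The weak derivative of an element of `H¹(-1, 1)`, defined up to null sets. -/
def dfn (u : H1) : ℝ → ℝ := (u : WithLp 2 (L2 × L2)).snd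

/-- `u(-1) = a` and `u(1) = b`, for the continuous representative of `u`. -/
def HasBoundaryValues (u : H1) (a b : ℝ) : Prop :=
  ∃ g : ℝ → ℝ, Continuous g ∧ fn u =ᵐ[cellMeasure] g ∧ g (-1) = a ∧ g 1 = b

/-- Membership in `H¹₀(-1, 1)`. -/
def IsH10 (u : H1) : Prop := HasBoundaryValues u 0 0

/-- Triples `Q = (q₁, q₂, q₃)` in `H¹(-1, 1)³`; the triple stands for the tensor field with rows
`(-2q₁, 0, 0)`, `(0, q₁ - q₂, q₃)`, `(0, q₃, q₁ + q₂)`. -/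
abbrev Config : Type := H1 × H1 × H1

/-- `6 q₊ = 1 + √(1 - θ)`. -/
def qPlus (θ : ℝ) : ℝ := (1 + √(1 - θ)) / 6

/-- The bulk energy density without its additive constant. -/
def bulk₀ (θ q₁ q₂ q₃ : ℝ) : ℝ :=
  θ / 3 * (3 * q₁ ^ 2 + q₂ ^ 2 + q₃ ^ 2) + 4 * q₁ * (q₁ ^ 2 - q₂ ^ 2 - q₃ ^ 2)
    + 1 / 2 * (3 * q₁ ^ 2 + q₂ ^ 2 + q₃ ^ 2) ^ 2

/-- The bulk energy density `f`, normalized so that its minimum is zero. -/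
def bulk (θ q₁ q₂ q₃ : ℝ) : ℝ :=
  bulk₀ θ q₁ q₂ q₃ - ⨅ p : ℝ × ℝ × ℝ, bulk₀ θ p.1 p.2.1 p.2.2

/-- The free energy `E_λ(Q)`; for the tensor field `Q` of `(q₁, q₂, q₃)` one has
`|Q'|² / (2λ²) = (3 q₁'² + q₂'² + q₃'²) / λ²`. -/
def energy (θ lam : ℝ) (Q : Config) : ℝ :=
  ∫ x, ((3 * dfn Q.1 x ^ 2 + dfn Q.2.1 x ^ 2 + dfn Q.2.2 x ^ 2) / lam ^ 2
    + bulk θ (fn Q.1 x) (fn Q.2.1 x) (fn Q.2.2 x)) ∂cellMeasure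

/-- The space of admissible configurations: `q₁(±1) = q₊`, `q₂(±1) = ∓3q₊`, `q₃(±1) = 0`. -/
def IsAdmissible (θ : ℝ) (Q : Config) : Prop :=
  HasBoundaryValues Q.1 (qPlus θ) (qPlus θ) ∧
  HasBoundaryValues Q.2.1 (3 * qPlus θ) (-(3 * qPlus θ)) ∧
  HasBoundaryValues Q.2.2 0 0

/-- `Q` is a critical point of `E_λ` among admissible configurations. -/
def IsCriticalPoint (θ lam : ℝ) (Q : Config) : Prop :=
  IsAdmissible θ Q ∧
  ∀ h : Config, IsH10 h.1 → IsH10 h.2.1 → IsH10 h.2.2 →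
    HasDerivAt (fun t : ℝ => energy θ lam (Q + t • h)) 0 0

/-- `Q` is an eigenvalue exchange solution: a critical point of `E_λ` with `q₃ = 0`. -/
def IsEESolution (θ lam : ℝ) (Q : Config) : Prop :=
  IsCriticalPoint θ lam Q ∧ Q.2.2 = 0

/-- The second variation `D²E_λ(Q)[h]`. -/
def secondVariation (θ lam : ℝ) (Q h : Config) : ℝ :=
  iteratedDeriv 2 (fun t : ℝ => energy θ lam (Q + t • h)) 0

/-- The first eigenvalue `ν` of `D²E_λ(Q)` restricted to symmetry-preserving perturbations
`(h₁, h₂, 0)`. -/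
def nu (θ lam : ℝ) (Q : Config) : ℝ :=
  sInf {r : ℝ | ∃ h₁ h₂ : H1, IsH10 h₁ ∧ IsH10 h₂ ∧ (h₁ ≠ 0 ∨ h₂ ≠ 0) ∧
    r = secondVariation θ lam Q (h₁, h₂, 0) /
      ∫ x, (fn h₁ x ^ 2 + fn h₂ x ^ 2) ∂cellMeasure}

/-- The first eigenvalue `μ` of `D²E_λ(Q)` restricted to symmetry-breaking perturbations
`(0, 0, h)`. -/
def mu (θ lam : ℝ) (Q : Config) : ℝ :=
  sInf {r : ℝ | ∃ h : H1, IsH10 h ∧ h ≠ 0 ∧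
    r = secondVariation θ lam Q (0, 0, h) / ∫ x, fn h x ^ 2 ∂cellMeasure}

/-- The interval `(0, Λ)` of real numbers, where `Λ` may be `+∞`. -/
def interval (Λ : EReal) : Set ℝ := {lam : ℝ | 0 < lam ∧ (lam : EReal) < Λ}

/-- `χ` restricts to a smooth map from `(0, Λ)` to `H¹(-1, 1)³` whose values are eigenvalue
exchange solutions. -/
def IsSmoothEEBranch (θ : ℝ) (Λ : EReal) (χ : ℝ → Config) : Prop :=
  ContDiffOn ℝ ∞ χ (interval Λ) ∧ ∀ lam ∈ interval Λ, IsEESolution θ lam (χ lam)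

/-- `ν > 0` on `(0, Λ)`, and either `Λ = +∞` or `ν` vanishes at `Λ`. The branch lives on the open
interval, so the value of `ν` at `Λ` is its limit from the left. -/
def IsStabilityEndpoint (θ : ℝ) (Λ : EReal) (χ : ℝ → Config) : Prop :=
  (∀ lam ∈ interval Λ, 0 < nu θ lam (χ lam)) ∧
  (Λ = ⊤ ∨ ∃ l : ℝ, Λ = (l : EReal) ∧
    Tendsto (fun lam => nu θ lam (χ lam)) (𝓝[<] l) (𝓝 0))

end NematicCell

end

/-!
A function in `H¹₀(-1, 1)` is determined by its derivative, an arbitrary element of the Hilbert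
space `MeanZero` of square integrable functions of mean zero. So admissible configurations are
parametrized by triples of elements `v` of `MeanZero`, and the Euler–Lagrange equations become
`v + λ² G(v) = 0` (`fullEq`, and `planarEq` for configurations with `q₃ = 0`). The nonlinearity `G`
is smooth and depends on `v` only through its primitive (`prim`), so that it is compact by the
theorem of Arzelà and Ascoli (`isCompactOperator_prim`).

Testing the equations with `v` and using the quartic growth of the bulk energy gives the bound
`‖v‖² ≤ C λ²` (`exists_norm_sq_le`). It has two consequences. Solutions are precompact as long as
`λ` stays bounded (`exists_tendsto_of_planarEq`). For small `λ` all solutions are close to `v = 0`,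
where the implicit function theorem applies; hence for small `λ` there is exactly one critical point
(`exists_unique_fullEq`), it has `q₃ = 0`, and it is stable (`exists_continuationData`).

If `ν > 0` at an eigenvalue exchange solution, then the linearized planar equations have trivial
kernel (`eq_zero_of_fderiv_planarEq_eq_zero`) and are a compact perturbation of the identity, so the
solution can be continued uniquely and smoothly in `λ`. A stable branch therefore extends until `ν`
vanishes (`ContinuationData.exists_maximal_branch`). Two branches that agree for small `λ` agree for
as long as one of them is stable (`ContinuationData.eqOn`), which determines both the branch and its
end point (`ContinuationData.le_of_isDegenerateEnd`).

The function `μ` is, up to the factor `2 / λ²`, the first Dirichlet eigenvalue `m` of a Schrödinger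
operator `-h'' + p h` whose potential `p` depends smoothly on `λ` (`mu_planarConf`). The eigenvalue
is simple, by uniqueness for the initial value problem. Adding the projection along an eigenfunction
makes the operator invertible, and the eigenvalue is the zero of a smooth scalar function of
`(p, m)` with nonvanishing derivative in `m` (`charFn`, `hasDerivAt_charFn`). By the implicit
function theorem it is smooth in `p` (`contDiff_scalarEig`).
-/

noncomputable section

namespace NematicCell

/-! ### Continuation of nondegenerate solution branches -/

lemma isOpen_interval (Λ : EReal) : IsOpen (interval Λ) :=
  (isOpen_lt continuous_const continuous_id).inter
    (isOpen_lt continuous_coe_real_ereal continuous_const)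

lemma interval_mono {Λ Λ' : EReal} (h : Λ ≤ Λ') : interval Λ ⊆ interval Λ' :=
  fun _ ht => ⟨ht.1, ht.2.trans_le h⟩

lemma interval_coe (L : ℝ) : interval (L : EReal) = Ioo 0 L := by
  ext t; simp [interval]

lemma isPreconnected_interval (Λ : EReal) : IsPreconnected (interval Λ) := by
  refine Set.OrdConnected.isPreconnected ⟨fun a ha b hb c hc => ⟨ha.1.trans_le hc.1, ?_⟩⟩
  exact lt_of_le_of_lt (EReal.coe_le_coe_iff.2 hc.2) hb.2

section Continuation

variable {P X Y : Type*} [NormedAddCommGroup P] [NormedSpace ℝ P] [CompleteSpace P]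
  [NormedAddCommGroup X] [NormedSpace ℝ X] [CompleteSpace X]
  [NormedAddCommGroup Y] [NormedSpace ℝ Y] [CompleteSpace Y]

/-- The implicit function theorem, together with the local uniqueness of the solution. -/
lemma exists_local_branch {F : P × X → Y} {u : P × X} (hF : ContDiffAt ℝ ∞ F u) (h0 : F u = 0)
    (hinv : (fderiv ℝ F u ∘L .inr ℝ P X).IsInvertible) :
    ∃ ψ : P → X, ψ u.1 = u.2 ∧ ContDiffAt ℝ ∞ ψ u.1 ∧ ∀ᶠ v in 𝓝 u, F v = 0 ↔ ψ v.1 = v.2 := by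
  refine ⟨hF.implicitFunction (by simp) hinv, hF.implicitFunction_apply_self _ _,
    hF.contDiffAt_implicitFunction _ _, ?_⟩
  simpa only [h0] using hF.eventually_apply_eq_iff_implicitFunction (by simp) hinv

/-- Near a nondegenerate solution, a branch of solutions coincides with the implicit function. -/
lemma eventuallyEq_of_local_branch {P X Y : Type*} [TopologicalSpace P] [TopologicalSpace X]
    [Zero Y] {F : P × X → Y} {ψ χ : P → X} {t : P}
    (hψ : ∀ᶠ v in 𝓝 (t, χ t), F v = 0 ↔ ψ v.1 = v.2) (hχ : ContinuousAt χ t)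
    (hs : ∀ᶠ r in 𝓝 t, F (r, χ r) = 0) : χ =ᶠ[𝓝 t] ψ := by
  have hc : Tendsto (fun r => (r, χ r)) (𝓝 t) (𝓝 (t, χ t)) :=
    (continuousAt_id.prodMk hχ)
  filter_upwards [hc.eventually hψ, hs] with r h1 h2
  exact (h1.1 h2).symm

/-- Two branches of solutions over a connected parameter set, one of them nondegenerate, coincide
as soon as they meet. -/
lemma eqOn_of_branches {F : P × X → Y} (hF : ContDiff ℝ ∞ F) {s : Set P} (hs : IsOpen s)
    (hs' : IsPreconnected s) {χ ψ : P → X} (hχ : ContinuousOn χ s) (hψ : ContinuousOn ψ s)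
    (hχ0 : ∀ t ∈ s, F (t, χ t) = 0) (hψ0 : ∀ t ∈ s, F (t, ψ t) = 0)
    (hinv : ∀ t ∈ s, (fderiv ℝ F (t, χ t) ∘L .inr ℝ P X).IsInvertible)
    {t₀ : P} (ht₀ : t₀ ∈ s) (heq : χ t₀ = ψ t₀) : EqOn χ ψ s := by
  set u : Set P := {t | t ∈ s ∧ χ t = ψ t} with hu
  have key : s ⊆ u := by
    refine hs'.subset_of_closure_inter_subset ?_ ⟨t₀, ht₀, ht₀, heq⟩ ?_
    · rw [isOpen_iff_mem_nhds]
      rintro t ⟨hts, hte⟩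
      obtain ⟨φ, -, -, hφ⟩ := exists_local_branch hF.contDiffAt (hχ0 t hts) (hinv t hts)
      have h1 := eventuallyEq_of_local_branch hφ (hχ.continuousAt (hs.mem_nhds hts))
        (by filter_upwards [hs.mem_nhds hts] with r hr using hχ0 r hr)
      rw [hte] at hφ
      have h2 := eventuallyEq_of_local_branch hφ (hψ.continuousAt (hs.mem_nhds hts))
        (by filter_upwards [hs.mem_nhds hts] with r hr using hψ0 r hr)
      filter_upwards [h1, h2, hs.mem_nhds hts] with r h1 h2 h3
      exact ⟨h3, h1.trans h2.symm⟩
    · rintro t ⟨htc, hts⟩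
      refine ⟨hts, ?_⟩
      by_contra hne
      have h1 : ∀ᶠ r in 𝓝 t, χ r ≠ ψ r :=
        ((hχ.continuousAt (hs.mem_nhds hts)).ne_iff_eventually_ne
          (hψ.continuousAt (hs.mem_nhds hts))).1 hne
      obtain ⟨r, hr1, hr2⟩ := ((mem_closure_iff_frequently.1 htc).and_eventually h1).exists
      exact hr2 hr1.2
  exact fun t ht => (key ht).2

/-- A continuous branch of zeros of `F` on `(0, Λ)` along which the stability functional `ν` is
positive. -/
def IsStableBranch (F : ℝ × X → Y) (ν : ℝ → X → ℝ) (Λ : EReal) (χ : ℝ → X) : Prop :=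
  ContinuousOn χ (interval Λ) ∧ ∀ t ∈ interval Λ, F (t, χ t) = 0 ∧ 0 < ν t (χ t)

/-- `Λ` is infinite, or `ν` tends to zero along the branch at `Λ`. -/
def IsDegenerateEnd (ν : ℝ → X → ℝ) (Λ : EReal) (χ : ℝ → X) : Prop :=
  Λ = ⊤ ∨ ∃ l : ℝ, Λ = (l : EReal) ∧ Tendsto (fun t => ν t (χ t)) (𝓝[<] l) (𝓝 0)

/-- The hypotheses of the continuation argument for the equation `F (t, v) = 0`, `t > 0`: positivity
of `ν` implies nondegeneracy, solutions are precompact for bounded `t`, and solutions are unique for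
`t < t₀`. -/
structure ContinuationData (F : ℝ × X → Y) (ν : ℝ → X → ℝ) (t₀ : ℝ) : Prop where
  smooth : ContDiff ℝ ∞ F
  continuousAt : ∀ t v, 0 < t → ContinuousAt (fun z : ℝ × X => ν z.1 z.2) (t, v)
  isInvertible : ∀ t v, 0 < t → F (t, v) = 0 → 0 < ν t v →
    (fderiv ℝ F (t, v) ∘L .inr ℝ ℝ X).IsInvertible
  compact : ∀ (u : ℕ → ℝ) (v : ℕ → X) (l : ℝ), (∀ n, 0 < u n) → Tendsto u atTop (𝓝 l) →
    (∀ n, F (u n, v n) = 0) → ∃ (s : ℕ → ℕ) (w : X), StrictMono s ∧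
      Tendsto (fun n => v (s n)) atTop (𝓝 w)
  pos : 0 < t₀
  unique : ∀ t ∈ Ioo 0 t₀, ∀ v w, F (t, v) = 0 → F (t, w) = 0 → v = w

namespace ContinuationData

variable {F : ℝ × X → Y} {ν : ℝ → X → ℝ} {t₀ : ℝ} (D : ContinuationData F ν t₀)
include D

/-- A stable branch is the only branch of solutions on its interval. -/
lemma eqOn {Λ : EReal} {χ χ' : ℝ → X} (h : IsStableBranch F ν Λ χ)
    (hc : ContinuousOn χ' (interval Λ)) (h0 : ∀ t ∈ interval Λ, F (t, χ' t) = 0) :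
    EqOn χ' χ (interval Λ) := by
  rcases (interval Λ).eq_empty_or_nonempty with he | ⟨t, ht⟩
  · simp [he]
  obtain ⟨r, hr⟩ : ∃ r, r = min (t / 2) (t₀ / 2) := ⟨_, rfl⟩
  have hr0 : 0 < r := by rw [hr]; exact lt_min (half_pos ht.1) (half_pos D.pos)
  have hrt : r < t := by rw [hr]; exact (min_le_left _ _).trans_lt (half_lt_self ht.1)
  have hrt₀ : r < t₀ := by rw [hr]; exact (min_le_right _ _).trans_lt (half_lt_self D.pos)
  have hrm : r ∈ interval Λ := ⟨hr0, (EReal.coe_lt_coe_iff.2 hrt).trans ht.2⟩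
  exact (eqOn_of_branches D.smooth (isOpen_interval Λ) (isPreconnected_interval Λ) h.1 hc
    (fun t ht => (h.2 t ht).1) h0
    (fun t ht => D.isInvertible t _ ht.1 (h.2 t ht).1 (h.2 t ht).2) hrm
    (D.unique r ⟨hr0, hrt₀⟩ _ _ (h.2 r hrm).1 (h0 r hrm))).symm

lemma contDiffOn {Λ : EReal} {χ : ℝ → X} (h : IsStableBranch F ν Λ χ) :
    ContDiffOn ℝ ∞ χ (interval Λ) := by
  intro t ht
  have hm := (isOpen_interval Λ).mem_nhds ht
  obtain ⟨ψ, -, hψ, hψ'⟩ := exists_local_branch D.smooth.contDiffAt (h.2 t ht).1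
    (D.isInvertible t _ ht.1 (h.2 t ht).1 (h.2 t ht).2)
  exact (hψ.congr_of_eventuallyEq (eventuallyEq_of_local_branch hψ' (h.1.continuousAt hm)
    (by filter_upwards [hm] with r hr using (h.2 r hr).1))).contDiffWithinAt

/-- A stable branch which accumulates, at its right end, at a solution with `ν > 0` can be
continued. -/
lemma exists_extension {l : ℝ} {χ : ℝ → X} (h : IsStableBranch F ν l χ) {u : ℕ → ℝ}
    (hu : ∀ n, u n ∈ interval l) (hul : Tendsto u atTop (𝓝 l)) {w : X}
    (hw : Tendsto (fun n => χ (u n)) atTop (𝓝 w)) (hw0 : F (l, w) = 0) (hνw : 0 < ν l w) :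
    ∃ (L : ℝ) (χ' : ℝ → X), l < L ∧ IsStableBranch F ν L χ' := by
  have hl : 0 < l := by
    have := hu 0
    rw [interval_coe] at this
    exact this.1.trans this.2
  obtain ⟨ψ, hψl, hψ, hψ'⟩ := exists_local_branch D.smooth.contDiffAt hw0
    (D.isInvertible l w hl hw0 hνw)
  simp only at hψl hψ
  have hψc : ContinuousAt ψ l := hψ.continuousAt
  have hpair : Tendsto (fun r => (r, ψ r)) (𝓝 l) (𝓝 (l, w)) := by
    have := continuousAt_id.prodMk hψc
    simpa only [ContinuousAt, hψl, id] using this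
  have e1 : ∀ᶠ r in 𝓝 l, F (r, ψ r) = 0 := by
    filter_upwards [hpair.eventually hψ'] with r hr
    exact hr.2 rfl
  have e2 : ∀ᶠ r in 𝓝 l, 0 < ν r (ψ r) :=
    hpair.eventually ((D.continuousAt l w hl).eventually (lt_mem_nhds hνw))
  have e3 : ∀ᶠ r in 𝓝 l, ContinuousAt ψ r := by
    have : ∀ᶠ r in 𝓝 l, ContDiffAt ℝ 1 ψ r :=
      (hψ.of_le (by exact_mod_cast le_top)).eventually (by simp)
    filter_upwards [this] with r hr using hr.continuousAt
  obtain ⟨δ, hδ, hball⟩ := Metric.eventually_nhds_iff_ball.1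
    ((e1.and (e2.and e3)).and (lt_mem_nhds hl))
  rw [Real.ball_eq_Ioo] at hball
  have e4 : ∀ᶠ n in atTop, ψ (u n) = χ (u n) := by
    filter_upwards [(hul.prodMk_nhds hw).eventually hψ'] with n hn
    exact hn.1 (h.2 _ (hu n)).1
  obtain ⟨n, hn, hnδ⟩ := (e4.and (hul.eventually (lt_mem_nhds (sub_lt_self l hδ)))).exists
  have hsub : Ioo (l - δ) l ⊆ interval l := by
    intro t ht
    rw [interval_coe]
    exact ⟨(hball t ⟨ht.1, ht.2.trans (lt_add_of_pos_right l hδ)⟩).2, ht.2⟩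
  have hun := hu n
  rw [interval_coe] at hun
  have heq : EqOn χ ψ (Ioo (l - δ) l) := by
    refine eqOn_of_branches D.smooth isOpen_Ioo isPreconnected_Ioo (h.1.mono hsub) ?_
      (fun t ht => (h.2 t (hsub ht)).1) ?_
      (fun t ht => D.isInvertible t _ (hsub ht).1 (h.2 t (hsub ht)).1 (h.2 t (hsub ht)).2)
      (t₀ := u n) ⟨hnδ, hun.2⟩ hn.symm
    · intro t ht
      exact (hball t ⟨ht.1, by linarith [ht.2]⟩).1.2.2.continuousWithinAt
    · intro t ht
      exact (hball t ⟨ht.1, by linarith [ht.2]⟩).1.1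
  classical
  refine ⟨l + δ, fun t => if t < l then χ t else ψ t, by linarith, ?_, ?_⟩
  · rw [interval_coe]
    intro t ht
    apply ContinuousAt.continuousWithinAt
    by_cases htl : t < l
    · have : χ =ᶠ[𝓝 t] fun t => if t < l then χ t else ψ t := by
        filter_upwards [gt_mem_nhds htl] with r hr
        rw [if_pos hr]
      refine ContinuousAt.congr ?_ this
      have : t ∈ interval l := by rw [interval_coe]; exact ⟨ht.1, htl⟩
      exact h.1.continuousAt ((isOpen_interval _).mem_nhds this)
    · have htm : t ∈ Ioo (l - δ) (l + δ) := ⟨by linarith [not_lt.1 htl], ht.2⟩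
      have : ψ =ᶠ[𝓝 t] fun t => if t < l then χ t else ψ t := by
        filter_upwards [isOpen_Ioo.mem_nhds htm] with r hr
        split_ifs with hrl
        · exact (heq ⟨hr.1, hrl⟩).symm
        · rfl
      exact ContinuousAt.congr (hball t htm).1.2.2 this
  · rw [interval_coe]
    intro t ht
    dsimp only
    split_ifs with htl
    · exact h.2 t (by rw [interval_coe]; exact ⟨ht.1, htl⟩)
    · have := hball t ⟨by linarith [not_lt.1 htl], ht.2⟩
      exact ⟨this.1.1, this.1.2.1⟩

/-- No stable branch extends beyond an interval at whose end another stable branch degenerates: the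
branches agree on this interval, while `ν` would be continuous and positive at its end. -/
lemma le_of_isDegenerateEnd {Λ Λ' : EReal} {χ χ' : ℝ → X} (hΛ : 0 < Λ)
    (h : IsStableBranch F ν Λ χ) (hend : IsDegenerateEnd ν Λ χ)
    (h' : IsStableBranch F ν Λ' χ') : Λ' ≤ Λ := by
  by_contra! hlt
  rcases hend with rfl | ⟨l, rfl, hl⟩
  · exact not_top_lt hlt
  have hl0 : 0 < l := by exact_mod_cast hΛ
  have heq : EqOn χ' χ (interval l) := D.eqOn h (h'.1.mono (interval_mono hlt.le))
    fun t ht => (h'.2 t (interval_mono hlt.le ht)).1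
  have hm : l ∈ interval Λ' := ⟨hl0, hlt⟩
  have hc : Tendsto (fun t => ν t (χ' t)) (𝓝 l) (𝓝 (ν l (χ' l))) :=
    (D.continuousAt l (χ' l) hl0).tendsto.comp (f := fun t => (t, χ' t))
      (continuousAt_id.prodMk (h'.1.continuousAt ((isOpen_interval _).mem_nhds hm)))
  have hc' : Tendsto (fun t => ν t (χ' t)) (𝓝[<] l) (𝓝 0) := by
    refine hl.congr' ?_
    filter_upwards [Ioo_mem_nhdsLT hl0] with t ht
    rw [heq (by rwa [interval_coe])]
  have := tendsto_nhds_unique hc' (hc.mono_left nhdsWithin_le_nhds)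
  exact (h'.2 l hm).2.ne this

/-- The maximal stable branch: it is smooth and unique, and at a finite right end it accumulates
only at solutions with `ν = 0`. -/
theorem exists_maximal_branch (hex : ∃ χ, IsStableBranch F ν t₀ χ) :
    ∃ (Λ : EReal) (χ : ℝ → X), (t₀ : EReal) ≤ Λ ∧ IsStableBranch F ν Λ χ ∧
      IsDegenerateEnd ν Λ χ ∧
      ∀ l : ℝ, Λ = (l : EReal) → ∀ u : ℕ → ℝ, (∀ n, u n ∈ interval Λ) → Tendsto u atTop (𝓝 l) →
        ∃ (s : ℕ → ℕ) (w : X), StrictMono s ∧ Tendsto (fun n => χ (u (s n))) atTop (𝓝 w) ∧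
          F (l, w) = 0 ∧ ν l w = 0 := by
  classical
  set S : Set EReal := {Λ | ∃ L : ℝ, Λ = L ∧ ∃ χ, IsStableBranch F ν L χ} with hS
  set Λ : EReal := sSup S with hΛ
  have hsel : ∀ t : ℝ, t ∈ interval Λ → ∃ (L : ℝ) (χ : ℝ → X), t < L ∧ IsStableBranch F ν L χ := by
    rintro t ⟨-, ht⟩
    obtain ⟨_, ⟨L, rfl, χ, hχ⟩, hL⟩ := lt_sSup_iff.1 ht
    exact ⟨L, χ, by exact_mod_cast hL, hχ⟩
  choose! L X₀ hL hX₀ using hsel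
  -- The branches on shorter intervals agree with each other, so that they can be glued.
  set χ : ℝ → X := fun t => X₀ t t with hχ
  have hagree : ∀ r ∈ interval Λ, EqOn χ (X₀ r) (Ioo 0 (L r)) := by
    intro r hr t ht
    have htΛ : t ∈ interval Λ := by
      refine ⟨ht.1, lt_of_lt_of_le (EReal.coe_lt_coe_iff.2 ht.2) (le_sSup ⟨L r, rfl, _, hX₀ r hr⟩)⟩
    have hmin : ((min (L t) (L r) : ℝ) : EReal) ≤ L t ∧
        ((min (L t) (L r) : ℝ) : EReal) ≤ L r := by
      constructor <;> exact_mod_cast (by simp)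
    have h1 : IsStableBranch F ν (min (L t) (L r) : ℝ) (X₀ r) :=
      ⟨(hX₀ r hr).1.mono (interval_mono hmin.2),
        fun x hx => (hX₀ r hr).2 x (interval_mono hmin.2 hx)⟩
    have h2 := D.eqOn h1 ((hX₀ t htΛ).1.mono (interval_mono hmin.1))
      fun x hx => ((hX₀ t htΛ).2 x (interval_mono hmin.1 hx)).1
    exact h2 (by rw [interval_coe]; exact ⟨ht.1, lt_min (hL t htΛ) ht.2⟩)
  have hbr : IsStableBranch F ν Λ χ := by
    constructor
    · intro t ht
      have hm : Ioo 0 (L t) ∈ 𝓝 t := Ioo_mem_nhds ht.1 (hL t ht)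
      have h1 := (hX₀ t ht).1
      rw [interval_coe] at h1
      exact ((h1.continuousAt hm).congr
        ((hagree t ht).symm.eventuallyEq_of_mem hm)).continuousWithinAt
    · intro t ht
      exact (hX₀ t ht).2 t (by rw [interval_coe]; exact ⟨ht.1, hL t ht⟩)
  have hlimit : ∀ l : ℝ, Λ = (l : EReal) → ∀ u : ℕ → ℝ, (∀ n, u n ∈ interval Λ) →
      Tendsto u atTop (𝓝 l) → ∃ (s : ℕ → ℕ) (w : X), StrictMono s ∧
        Tendsto (fun n => χ (u (s n))) atTop (𝓝 w) ∧ F (l, w) = 0 ∧ ν l w = 0 := by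
    intro l hl u hu hul
    have hl0 : 0 < l := by
      have := hu 0
      rw [hl, interval_coe] at this
      exact this.1.trans this.2
    obtain ⟨s, w, hs, hw⟩ := D.compact u (fun n => χ (u n)) l (fun n => (hu n).1) hul
      (fun n => (hbr.2 _ (hu n)).1)
    have hus : Tendsto (fun n => u (s n)) atTop (𝓝 l) := hul.comp hs.tendsto_atTop
    have hpair := hus.prodMk_nhds hw
    have hw0 : F (l, w) = 0 := by
      refine tendsto_nhds_unique ((D.smooth.continuous.tendsto (l, w)).comp hpair) ?_
      refine tendsto_const_nhds.congr fun n => ?_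
      exact (hbr.2 _ (hu (s n))).1.symm
    have hν0 : 0 ≤ ν l w := by
      refine ge_of_tendsto' ((D.continuousAt l w hl0).tendsto.comp hpair) fun n => ?_
      exact (hbr.2 _ (hu (s n))).2.le
    refine ⟨s, w, hs, hw, hw0, ?_⟩
    by_contra hne
    rw [hl] at hbr hu
    obtain ⟨L', χ', hL', hχ'⟩ := D.exists_extension hbr (fun n => hu (s n)) hus hw hw0
      (lt_of_le_of_ne hν0 (Ne.symm hne))
    have : (L' : EReal) ≤ Λ := le_sSup ⟨L', rfl, χ', hχ'⟩
    rw [hl] at this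
    exact absurd (by exact_mod_cast this) (not_le.2 hL')
  have hle : (t₀ : EReal) ≤ Λ := le_sSup ⟨t₀, rfl, hex⟩
  refine ⟨Λ, χ, hle, hbr, ?_, hlimit⟩
  by_cases htop : Λ = ⊤
  · exact Or.inl htop
  have hbot : Λ ≠ ⊥ := fun h => by simp [h] at hle
  lift Λ to ℝ using ⟨htop, hbot⟩ with l hl
  have hl0 : 0 < l := D.pos.trans_le (by exact_mod_cast hle)
  refine Or.inr ⟨l, rfl, ?_⟩
  refine tendsto_of_subseq_tendsto fun u hu => ?_
  -- The sequence may be assumed to lie in the interval, after discarding finitely many terms.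
  obtain ⟨N, hN⟩ := eventually_atTop.1 (hu.eventually (Ioo_mem_nhdsLT hl0))
  have hu' : Tendsto (fun n => u (n + N)) atTop (𝓝 l) :=
    (tendsto_add_atTop_iff_nat N).2 (hu.mono_right nhdsWithin_le_nhds)
  obtain ⟨s, w, hs, hw, -, hν⟩ := hlimit l rfl (fun n => u (n + N))
    (fun n => by rw [interval_coe]; exact hN _ (Nat.le_add_left _ _)) hu'
  refine ⟨fun n => s n + N, ?_⟩
  have := (D.continuousAt l w hl0).tendsto.comp ((hu'.comp hs.tendsto_atTop).prodMk_nhds hw)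
  rwa [hν] at this

end ContinuationData

end Continuation

/-! ### Primitives of square integrable functions -/

open scoped BoundedContinuousFunction

/-- Bounded continuous functions on the line. A function on the cell is extended to the line by its
boundary values. -/
abbrev Cb : Type := ℝ →ᵇ ℝ

/-- The restriction of a bounded continuous function to the cell, as an element of `L²`. -/
def toL2 : Cb →L[ℝ] L2 := BoundedContinuousFunction.toLp 2 cellMeasure ℝ

lemma coeFn_toL2 (a : Cb) : toL2 a =ᵐ[cellMeasure] a :=
  BoundedContinuousFunction.coeFn_toLp 2 cellMeasure ℝ a

lemma L2.integrable (v : L2) : Integrable v cellMeasure := (Lp.memLp v).integrable (by norm_num)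

lemma Cb.integrable (a : Cb) : Integrable a cellMeasure :=
  BoundedContinuousFunction.integrable _ a

lemma Cb.integrable_mul (a b : Cb) : Integrable (fun x => a x * b x) cellMeasure :=
  Cb.integrable (a * b)

lemma measureReal_cell_univ : cellMeasure.real univ = 2 := by
  simp [Measure.real]; norm_num

lemma measureReal_cell_uIoc_le (x y : ℝ) : cellMeasure.real (uIoc x y) ≤ |y - x| := by
  have h : cellMeasure (uIoc x y) ≤ ENNReal.ofReal |y - x| := by
    refine (Measure.restrict_apply_le _ _).trans ?_
    simp
  exact ENNReal.toReal_le_of_le_ofReal (abs_nonneg _) h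

/-- The Cauchy–Schwarz inequality. -/
lemma abs_setIntegral_le (v : L2) {s : Set ℝ} (hs : MeasurableSet s) :
    |∫ x in s, v x ∂cellMeasure| ≤ √(cellMeasure.real s) * ‖v‖ := by
  rw [← L2.inner_indicatorConstLp_one (𝕜 := ℝ) hs (measure_ne_top _ s) v]
  refine (abs_real_inner_le_norm _ _).trans (le_of_eq ?_)
  rw [norm_indicatorConstLp (by norm_num) (by norm_num)]
  simp [Real.sqrt_eq_rpow]

lemma abs_intervalIntegral_le (v : L2) (x y : ℝ) :
    |∫ t in x..y, v t ∂cellMeasure| ≤ √|y - x| * ‖v‖ := by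
  rw [← Real.norm_eq_abs, intervalIntegral.norm_intervalIntegral_eq, Real.norm_eq_abs]
  refine (abs_setIntegral_le v measurableSet_uIoc).trans ?_
  gcongr
  exact measureReal_cell_uIoc_le x y

lemma abs_intervalIntegral_le_two (v : L2) (x y : ℝ) :
    |∫ t in x..y, v t ∂cellMeasure| ≤ 2 * ‖v‖ := by
  rw [← Real.norm_eq_abs, intervalIntegral.norm_intervalIntegral_eq, Real.norm_eq_abs]
  refine (abs_setIntegral_le v measurableSet_uIoc).trans ?_
  gcongr
  refine Real.sqrt_le_iff.2 ⟨by norm_num, ?_⟩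
  have : cellMeasure.real (uIoc x y) ≤ cellMeasure.real univ := measureReal_mono (subset_univ _)
  rw [measureReal_cell_univ] at this
  linarith

/-- The primitive `x ↦ ∫_{-1}^x v`, as a bounded continuous function. -/
def prim : L2 →L[ℝ] Cb :=
  LinearMap.mkContinuous
    { toFun := fun v => BoundedContinuousFunction.ofNormedAddCommGroup
        (fun x => ∫ t in (-1)..x, v t ∂cellMeasure) ((L2.integrable v).continuous_primitive (-1))
        (2 * ‖v‖) (fun x => abs_intervalIntegral_le_two v (-1) x)
      map_add' := fun v w => by
        ext x
        simp only [BoundedContinuousFunction.coe_ofNormedAddCommGroup,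
          BoundedContinuousFunction.coe_add, Pi.add_apply]
        rw [← intervalIntegral.integral_add (L2.integrable v).intervalIntegrable
          (L2.integrable w).intervalIntegrable]
        refine intervalIntegral.integral_congr_ae' ?_ ?_ <;>
        filter_upwards [Lp.coeFn_add v w] with t ht _ using by rw [ht, Pi.add_apply]
      map_smul' := fun c v => by
        ext x
        simp only [BoundedContinuousFunction.coe_ofNormedAddCommGroup,
          BoundedContinuousFunction.coe_smul, RingHom.id_apply]
        rw [← intervalIntegral.integral_smul]
        refine intervalIntegral.integral_congr_ae' ?_ ?_ <;>
        filter_upwards [Lp.coeFn_smul c v] with t ht _ using by rw [ht, Pi.smul_apply] }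
    2 fun v => (BoundedContinuousFunction.norm_le (by positivity)).2
      fun x => abs_intervalIntegral_le_two v (-1) x

lemma prim_apply (v : L2) (x : ℝ) : prim v x = ∫ t in (-1)..x, v t ∂cellMeasure := rfl

lemma norm_prim_le (v : L2) : ‖prim v‖ ≤ 2 * ‖v‖ :=
  (BoundedContinuousFunction.norm_le (by positivity)).2
      fun x => abs_intervalIntegral_le_two v (-1) x

@[simp] lemma prim_neg_one (v : L2) : prim v (-1) = 0 := by simp [prim_apply]

lemma prim_sub (v : L2) (x y : ℝ) :
    prim v y - prim v x = ∫ t in x..y, v t ∂cellMeasure := by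
  rw [prim_apply, prim_apply, intervalIntegral.integral_interval_sub_left]
  all_goals exact (L2.integrable v).intervalIntegrable

lemma prim_one (v : L2) : prim v 1 = ∫ t, v t ∂cellMeasure := by
  rw [prim_apply, intervalIntegral.integral_of_le (by norm_num), Measure.restrict_restrict
    measurableSet_Ioc, inter_eq_self_of_subset_right Ioo_subset_Ioc_self]

lemma prim_congr {v : L2} {f : ℝ → ℝ} (h : v =ᵐ[cellMeasure] f) {x : ℝ} (hx : x ∈ Icc (-1 : ℝ) 1) :
    prim v x = ∫ t in (-1)..x, f t := by
  have e : Ioc (-1) x =ᵐ[volume] Ioo (-1) x := Ioo_ae_eq_Ioc.symm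
  rw [prim_apply, intervalIntegral.integral_of_le hx.1, intervalIntegral.integral_of_le hx.1,
    integral_congr_ae (ae_restrict_of_ae h), Measure.restrict_restrict measurableSet_Ioc]
  refine setIntegral_congr_set ?_
  have : (Ioc (-1) x ∩ Ioo (-1) 1 : Set ℝ) =ᵐ[volume] (Ioc (-1) x ∩ Ioc (-1) 1 : Set ℝ) :=
    ae_eq_set_inter (ae_eq_refl _) Ioo_ae_eq_Ioc
  rwa [inter_eq_self_of_subset_left (Ioc_subset_Ioc_right hx.2)] at this

/-- Outside the cell, a primitive is extended by its boundary values. -/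
lemma prim_projIcc (v : L2) (x : ℝ) :
    prim v (projIcc (-1) 1 (by norm_num) x : Icc (-1 : ℝ) 1) = prim v x := by
  rw [← sub_eq_zero, prim_sub]
  rw [← norm_eq_zero, intervalIntegral.norm_intervalIntegral_eq, norm_eq_zero]
  rw [Measure.restrict_restrict measurableSet_uIoc]
  have : uIoc x (projIcc (-1) 1 (by norm_num) x : Icc (-1 : ℝ) 1) ∩ Ioo (-1) 1 = ∅ := by
    ext t
    simp only [mem_inter_iff, mem_Ioo, mem_empty_iff_false, iff_false, coe_projIcc, mem_uIoc]
    rcases le_total x (-1) with h | h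
    · rw [min_eq_right (by linarith), max_eq_left h]
      grind
    rcases le_total x 1 with h' | h'
    · rw [min_eq_right h', max_eq_right h]
      grind
    · rw [min_eq_left h', max_eq_right (by norm_num)]
      grind
  rw [this]
  simp

/-- The compact embedding of `H¹` into the continuous functions. -/
lemma isCompactOperator_prim : IsCompactOperator prim := by
  set ρ : C(ℝ, Icc (-1 : ℝ) 1) := ⟨projIcc (-1) 1 (by norm_num), continuous_projIcc⟩ with hρ
  set σ : C(Icc (-1 : ℝ) 1, ℝ) := ⟨Subtype.val, continuous_subtype_val⟩ with hσ
  set K : Set (Icc (-1 : ℝ) 1 →ᵇ ℝ) :=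
    (fun v : L2 => (prim v).compContinuous σ) '' Metric.closedBall 0 1 with hK
  have hcK : IsCompact (closure K) := by
    refine BoundedContinuousFunction.arzela_ascoli (Icc (-2) 2) isCompact_Icc K ?_ ?_
    · rintro _ x ⟨v, hv, rfl⟩
      have h1 := (prim v).norm_coe_le_norm x
      have h2 := norm_prim_le v
      rw [mem_closedBall_zero_iff] at hv
      rw [Real.norm_eq_abs] at h1
      exact abs_le.1 (by linarith : |prim v x| ≤ 2)
    · intro x
      rw [Metric.equicontinuousAt_iff]
      intro ε hε
      refine ⟨ε ^ 2, by positivity, ?_⟩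
      rintro y hy ⟨_, v, hv, rfl⟩
      rw [mem_closedBall_zero_iff] at hv
      change dist (prim v x) (prim v y) < ε
      rw [dist_comm, Real.dist_eq, prim_sub]
      refine (abs_intervalIntegral_le v x y).trans_lt ?_
      have h1 : √|(y : ℝ) - x| < ε := by
        rw [Real.sqrt_lt' hε, ← Real.dist_eq]
        exact hy
      calc _ ≤ √|(y : ℝ) - x| * 1 := by gcongr
        _ < ε := by rwa [mul_one]
  have hcont : Continuous fun f : Icc (-1 : ℝ) 1 →ᵇ ℝ => f.compContinuous ρ :=
    BoundedContinuousFunction.continuous_compContinuous ρ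
  refine ⟨_, hcK.image hcont, ?_⟩
  refine Filter.mem_of_superset (Metric.closedBall_mem_nhds 0 one_pos) fun v hv => ?_
  refine ⟨(prim v).compContinuous σ, subset_closure ⟨v, hv, rfl⟩, ?_⟩
  ext x
  exact prim_projIcc v x

lemma integral_mul_eq_inner (k : L2) (a : Cb) :
    ∫ x, a x * k x ∂cellMeasure = inner ℝ (toL2 a) k := by
  rw [L2.inner_def]
  refine integral_congr_ae ?_
  filter_upwards [coeFn_toL2 a] with x hx
  simp [hx, mul_comm]

lemma inner_toL2_toL2 (a b : Cb) :
    inner ℝ (toL2 a) (toL2 b) = ∫ x, a x * b x ∂cellMeasure := by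
  rw [← integral_mul_eq_inner]
  refine integral_congr_ae ?_
  filter_upwards [coeFn_toL2 b] with x hx
  rw [hx]

lemma cell_integral_eq (f : ℝ → ℝ) : ∫ x, f x ∂cellMeasure = ∫ x in (-1)..1, f x := by
  rw [intervalIntegral.integral_of_le (by norm_num), integral_Ioc_eq_integral_Ioo]

/-- Integration by parts, for products of primitives. -/
lemma inner_prim_add_inner_prim (h k : L2) :
    inner ℝ (toL2 (prim h)) k + inner ℝ (toL2 (prim k)) h = prim h 1 * prim k 1 := by
  have hd : DenseRange toL2 := BoundedContinuousFunction.toLp_denseRange ℝ _ ℝ (by norm_num)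
  have hc : Continuous fun v : L2 => prim v 1 :=
    (BoundedContinuousFunction.evalCLM ℝ (1 : ℝ)).continuous.comp prim.continuous
  refine hd.induction_on₂ (p := fun h k => inner ℝ (toL2 (prim h)) k + inner ℝ (toL2 (prim k)) h
    = prim h 1 * prim k 1) ?_ ?_ h k
  · refine isClosed_eq ?_ ?_
    · fun_prop
    · exact (hc.comp continuous_fst).mul (hc.comp continuous_snd)
  · intro a b
    have hder : ∀ (a : Cb), ∀ x ∈ uIcc (-1 : ℝ) 1,
        HasDerivAt (fun x => ∫ t in (-1)..x, a t) (a x) x := fun a x _ =>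
      intervalIntegral.integral_hasDerivAt_right (a.continuous.intervalIntegrable _ _)
        (a.continuous.stronglyMeasurableAtFilter _ _) a.continuous.continuousAt
    have key := intervalIntegral.integral_deriv_mul_eq_sub (hder a) (hder b)
      (a.continuous.intervalIntegrable _ _) (b.continuous.intervalIntegrable _ _)
    rw [inner_toL2_toL2, inner_toL2_toL2, ← integral_add
      (Cb.integrable_mul (prim (toL2 a)) b)
      (Cb.integrable_mul (prim (toL2 b)) a), cell_integral_eq,
      prim_congr (coeFn_toL2 a) (by simp), prim_congr (coeFn_toL2 b) (by simp)]
    simp only [intervalIntegral.integral_same, zero_mul, sub_zero] at key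
    rw [← key]
    refine intervalIntegral.integral_congr fun x hx => ?_
    rw [uIcc_of_le (by norm_num)] at hx
    rw [prim_congr (coeFn_toL2 a) hx, prim_congr (coeFn_toL2 b) hx]
    ring

/-- Continuous functions that agree almost everywhere in the cell agree up to the boundary. -/
lemma eqOn_of_ae_eq {f g : ℝ → ℝ} (hf : Continuous f) (hg : Continuous g)
    (h : f =ᵐ[cellMeasure] g) : EqOn f g (Icc (-1) 1) :=
  Measure.eqOn_Icc_of_ae_eq volume (by norm_num)
    (by rwa [cellMeasure, Measure.restrict_congr_set Ioo_ae_eq_Icc] at h) hf.continuousOn hg.continuousOn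

/-! ### Continuous representatives in the Sobolev space -/

/-- The function `α + ∫_{-1}^x v`, the continuous representative of a Sobolev function. -/
def rep (α : ℝ) (v : L2) : Cb := BoundedContinuousFunction.const ℝ α + prim v

lemma rep_apply (α : ℝ) (v : L2) (x : ℝ) : rep α v x = α + prim v x := rfl

lemma rep_zero (v : L2) : rep 0 v = prim v := by ext x; simp [rep_apply]

lemma inner_toL2_const (α : ℝ) (v : L2) :
    inner ℝ (toL2 (BoundedContinuousFunction.const ℝ α)) v = α * prim v 1 := by
  rw [← integral_mul_eq_inner, prim_one, ← integral_const_mul]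
  rfl

lemma IsTest.prim_deriv {φ : ℝ → ℝ} (hφ : IsTest φ) :
    ∃ p : Cb, ⇑p = deriv φ ∧ ∀ x ∈ Icc (-1 : ℝ) 1, prim (toL2 p) x = φ x := by
  have hc : Continuous (deriv φ) := hφ.1.continuous_deriv (by simp)
  obtain ⟨C, hC⟩ := hφ.2.1.deriv.exists_bound_of_continuous hc
  refine ⟨BoundedContinuousFunction.ofNormedAddCommGroup _ hc C hC, rfl, fun x hx => ?_⟩
  have h1 : φ (-1) = 0 := image_eq_zero_of_notMem_tsupport fun h => by
    simpa using hφ.2.2 h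
  rw [prim_congr (coeFn_toL2 _) hx, BoundedContinuousFunction.coe_ofNormedAddCommGroup,
    intervalIntegral.integral_deriv_eq_sub
      (fun y _ => hφ.1.differentiable (by simp) y) (hc.intervalIntegrable _ _), h1, sub_zero]

/-- Primitives are weak antiderivatives, by integration by parts against the test function. -/
lemma isWeakDeriv_rep (α : ℝ) (v : L2) : IsWeakDeriv (toL2 (rep α v)) v := by
  intro φ hφ
  obtain ⟨p, hp, hpφ⟩ := hφ.prim_deriv
  have h1 : prim (toL2 p) 1 = 0 := by
    rw [hpφ 1 (by simp)]
    exact image_eq_zero_of_notMem_tsupport fun h => by simpa using hφ.2.2 h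
  have e1 : ∫ x, (toL2 (rep α v)) x * deriv φ x ∂cellMeasure
      = inner ℝ (toL2 (rep α v)) (toL2 p) := by
    rw [inner_toL2_toL2, hp]
    refine integral_congr_ae ?_
    filter_upwards [coeFn_toL2 (rep α v)] with x hx
    rw [hx]
  have e2 : ∫ x, v x * φ x ∂cellMeasure = inner ℝ (toL2 (prim (toL2 p))) v := by
    rw [← integral_mul_eq_inner]
    refine integral_congr_ae ?_
    filter_upwards [ae_restrict_mem measurableSet_Ioo] with x hx
    rw [hpφ x (Ioo_subset_Icc_self hx), mul_comm]
  have key := inner_prim_add_inner_prim v (toL2 p)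
  rw [h1, mul_zero] at key
  rw [e1, e2, rep, map_add, inner_add_left, inner_toL2_const, h1]
  linarith

lemma IsTest.integral_cell {φ : ℝ → ℝ} (hφ : IsTest φ) (f : ℝ → ℝ) :
    ∫ x, f x * φ x = ∫ x, f x * φ x ∂cellMeasure := by
  refine (setIntegral_eq_integral_of_forall_compl_eq_zero fun x hx => ?_).symm
  rw [image_eq_zero_of_notMem_tsupport fun h => hx (hφ.2.2 h), mul_zero]

/-- A test function of integral zero is the derivative of a test function. -/
lemma IsTest.exists_primitive {ζ : ℝ → ℝ} (hζ : IsTest ζ) (h0 : ∫ x, ζ x ∂cellMeasure = 0) :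
    ∃ φ, IsTest φ ∧ deriv φ = ζ := by
  obtain ⟨r, hr1, hr⟩ : ∃ r < 1, ∀ x, r < |x| → ζ x = 0 := by
    obtain ⟨y, hy, hmax⟩ := (hζ.2.1.isCompact.insert 0).exists_isMaxOn (insert_nonempty _ _)
      continuous_abs.continuousOn
    refine ⟨|y|, ?_, fun x hx => ?_⟩
    · rcases hy with rfl | hy
      · simp
      · exact abs_lt.2 (hζ.2.2 hy)
    · refine image_eq_zero_of_notMem_tsupport fun h => ?_
      exact absurd (hmax (mem_insert_of_mem _ h)) (not_le.2 hx)
  have hc := hζ.1.continuous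
  have hd : ∀ x, HasDerivAt (fun x => ∫ t in (-1)..x, ζ t) (ζ x) x := fun x =>
    intervalIntegral.integral_hasDerivAt_right (hc.intervalIntegrable _ _)
      (hc.stronglyMeasurableAtFilter _ _) hc.continuousAt
  have hderiv : deriv (fun x => ∫ t in (-1)..x, ζ t) = ζ := funext fun x => (hd x).deriv
  have hzero : ∀ x, x ∉ Icc (-r) r → ∫ t in (-1)..x, ζ t = 0 := by
    intro x hx
    rw [mem_Icc, not_and_or, not_le, not_le] at hx
    rcases hx with hx | hx
    · refine intervalIntegral.integral_zero_ae (Eventually.of_forall fun t ht => hr t ?_)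
      rw [mem_uIoc] at ht
      rw [lt_abs]
      right
      rcases ht with ht | ht <;> linarith [ht.1, ht.2]
    · rw [← intervalIntegral.integral_add_adjacent_intervals (b := 1)
        (hc.intervalIntegrable _ _) (hc.intervalIntegrable _ _), ← cell_integral_eq, h0, zero_add]
      refine intervalIntegral.integral_zero_ae (Eventually.of_forall fun t ht => hr t ?_)
      rw [mem_uIoc] at ht
      rw [lt_abs]
      left
      rcases ht with ht | ht <;> linarith [ht.1, ht.2]
  have hsupp : tsupport (fun x => ∫ t in (-1)..x, ζ t) ⊆ Icc (-r) r := by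
    refine closure_minimal (fun x hx => ?_) isClosed_Icc
    by_contra h
    exact hx (hzero x h)
  refine ⟨_, ⟨?_, ?_, hsupp.trans ?_⟩, hderiv⟩
  · rw [contDiff_infty_iff_deriv, hderiv]
    exact ⟨fun x => (hd x).differentiableAt, hζ.1⟩
  · exact isCompact_Icc.of_isClosed_subset (isClosed_tsupport _) hsupp
  · exact fun x hx => ⟨by linarith [hx.1], by linarith [hx.2]⟩

/-- The fundamental lemma of the calculus of variations. -/
lemma eq_zero_of_forall_isTest {w : L2}
    (h : ∀ ψ, IsTest ψ → ∫ x, w x * ψ x ∂cellMeasure = 0) : w = 0 := by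
  have hae : ∀ᵐ x ∂volume, x ∈ Ioo (-1 : ℝ) 1 → w x = 0 := by
    refine isOpen_Ioo.ae_eq_zero_of_integral_contDiff_smul_eq_zero ?_ fun g hg hgc hgs => ?_
    · exact IntegrableOn.locallyIntegrableOn (L2.integrable w)
    · have hgt : IsTest g := ⟨hg, hgc, hgs⟩
      rw [← h g hgt, ← hgt.integral_cell]
      simp only [smul_eq_mul, mul_comm]
  refine Lp.ext ?_
  filter_upwards [(ae_restrict_iff' measurableSet_Ioo).2 hae,
    Lp.coeFn_zero ℝ 2 cellMeasure] with x hx hx'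
  rw [hx', hx, Pi.zero_apply]

/-- The lemma of du Bois-Reymond: a function with vanishing weak derivative is constant. -/
lemma IsWeakDeriv.eq_const {w : L2} (hw : IsWeakDeriv w 0) :
    ∃ α : ℝ, w = toL2 (BoundedContinuousFunction.const ℝ α) := by
  let b : ContDiffBump (0 : ℝ) := ⟨1 / 4, 1 / 2, by norm_num, by norm_num⟩
  set η : ℝ → ℝ := b.normed volume with hη
  have hηt : IsTest η := by
    refine ⟨b.contDiff_normed, b.hasCompactSupport_normed, ?_⟩
    rw [hη, b.tsupport_normed_eq, Real.closedBall_eq_Icc]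
    intro x hx
    simp only [b] at hx
    constructor <;> [linarith [hx.1]; linarith [hx.2]]
  have hη1 : ∫ x, η x ∂cellMeasure = 1 := by
    have := hηt.integral_cell 1
    simp only [Pi.one_apply, one_mul] at this
    rw [← this]
    exact b.integral_normed
  refine ⟨∫ x, w x * η x ∂cellMeasure, ?_⟩
  set α := ∫ x, w x * η x ∂cellMeasure with hα
  have hint : ∀ ψ, IsTest ψ → Integrable ψ cellMeasure := fun ψ h =>
    (h.1.continuous.integrable_of_hasCompactSupport h.2.1).restrict
  have key : ∀ ψ, IsTest ψ →
      ∫ x, (w - toL2 (BoundedContinuousFunction.const ℝ α)) x * ψ x ∂cellMeasure = 0 := by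
    intro ψ hψ
    set c := ∫ x, ψ x ∂cellMeasure with hc
    have hζ : IsTest (fun x => ψ x - c * η x) := by
      refine ⟨hψ.1.sub (contDiff_const.mul hηt.1), hψ.2.1.sub (hηt.2.1.mul_left), ?_⟩
      refine (tsupport_sub ψ (fun x => c * η x)).trans (union_subset hψ.2.2 ?_)
      exact (closure_mono (Function.support_mul_subset_right _ _)).trans hηt.2.2
    obtain ⟨φ, hφ, hφd⟩ := hζ.exists_primitive (by
      rw [integral_sub (hint ψ hψ) ((hint η hηt).const_mul c), integral_const_mul, hη1]
      simp [hc])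
    have h1 := hw φ hφ
    have h2 : ∫ x, (0 : L2) x * φ x ∂cellMeasure = 0 := by
      refine integral_eq_zero_of_ae ?_
      filter_upwards [Lp.coeFn_zero ℝ 2 cellMeasure] with x hx
      rw [hx, Pi.zero_apply, zero_mul]
    rw [h2, hφd, neg_zero] at h1
    have i1 := integrable_mul_test w hψ.1.continuous hψ.2.1
    have i2 := integrable_mul_test w hηt.1.continuous hηt.2.1
    have h3 : ∫ x, w x * (ψ x - c * η x) ∂cellMeasure
        = ∫ x, w x * ψ x ∂cellMeasure - c * α := by
      rw [hα, ← integral_const_mul, ← integral_sub i1 (i2.const_mul c)]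
      congr 1 with x
      ring
    have h4 : ∫ x, (w - toL2 (BoundedContinuousFunction.const ℝ α)) x * ψ x ∂cellMeasure
        = ∫ x, (w x * ψ x - α * ψ x) ∂cellMeasure := by
      refine integral_congr_ae ?_
      filter_upwards [Lp.coeFn_sub w (toL2 (BoundedContinuousFunction.const ℝ α)),
        coeFn_toL2 (BoundedContinuousFunction.const ℝ α)] with x hx hx'
      rw [hx, Pi.sub_apply, hx', BoundedContinuousFunction.const_apply, sub_mul]
    rw [h4]
    rw [integral_sub i1 ((hint ψ hψ).const_mul α), integral_const_mul]
    linarith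
  exact sub_eq_zero.1 (eq_zero_of_forall_isTest key)

lemma IsWeakDeriv.eq_rep {u v : L2} (h : IsWeakDeriv u v) : ∃ α : ℝ, u = toL2 (rep α v) := by
  have h1 := h.add ((isWeakDeriv_rep 0 v).smul (-1))
  rw [neg_one_smul ℝ v, add_neg_cancel] at h1
  obtain ⟨α, hα⟩ := h1.eq_const
  refine ⟨α, ?_⟩
  rw [rep_zero, neg_one_smul, ← sub_eq_add_neg, sub_eq_iff_eq_add] at hα
  rw [hα, rep, map_add]

/-- The Sobolev function with value `α` at `-1` and derivative `v`. -/
def H1.mk (α : ℝ) (v : L2) : H1 := ⟨WithLp.toLp 2 (toL2 (rep α v), v), isWeakDeriv_rep α v⟩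

lemma H1.coe_mk (α : ℝ) (v : L2) :
    (H1.mk α v : WithLp 2 (L2 × L2)) = WithLp.toLp 2 (toL2 (rep α v), v) := rfl

lemma H1.exists_eq_mk (u : H1) : ∃ α v, u = H1.mk α v := by
  obtain ⟨u, hu⟩ := u
  obtain ⟨α, hα⟩ := IsWeakDeriv.eq_rep hu
  refine ⟨α, u.snd, Subtype.ext ?_⟩
  rw [H1.coe_mk, ← hα]
  rfl

lemma fn_mk (α : ℝ) (v : L2) : fn (H1.mk α v) =ᵐ[cellMeasure] rep α v := coeFn_toL2 _

lemma dfn_mk (α : ℝ) (v : L2) : dfn (H1.mk α v) = v := rfl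

lemma rep_add_smul (α β t : ℝ) (v w : L2) : rep (α + t * β) (v + t • w) = rep α v + t • rep β w := by
  ext x
  simp [rep_apply]
  ring

lemma H1.mk_add_smul (α β t : ℝ) (v w : L2) :
    H1.mk α v + t • H1.mk β w = H1.mk (α + t * β) (v + t • w) := by
  refine Subtype.ext ?_
  simp only [H1.mk, rep_add_smul, map_add, map_smul]
  rfl

/-- The Sobolev function vanishing at `-1` with a given derivative, as a bounded linear map. -/
def H1.ofDeriv : L2 →L[ℝ] H1 :=
  ((WithLp.prodContinuousLinearEquiv 2 ℝ L2 L2).symm.toContinuousLinearMap ∘L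
    (toL2 ∘L prim).prod (ContinuousLinearMap.id ℝ L2)).codRestrict H1 fun v => by
      have := isWeakDeriv_rep 0 v
      rwa [rep_zero] at this

lemma H1.mk_eq_add_ofDeriv (α : ℝ) (v : L2) : H1.mk α v = H1.mk α 0 + H1.ofDeriv v := by
  refine Subtype.ext ?_
  have h1 : rep α v = rep α 0 + prim v := by ext x; simp [rep_apply]
  have h2 : (H1.mk α v : WithLp 2 (L2 × L2)) = WithLp.toLp 2 (toL2 (rep α 0) + toL2 (prim v), 0 + v) := by
    rw [H1.coe_mk, h1, map_add, zero_add]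
  rw [h2]
  rfl

/-- The weak derivative, as a bounded linear map. -/
def H1.derivL : H1 →L[ℝ] L2 :=
  ContinuousLinearMap.snd ℝ L2 L2 ∘L
    (WithLp.prodContinuousLinearEquiv 2 ℝ L2 L2).toContinuousLinearMap ∘L H1.subtypeL

lemma H1.derivL_mk (α : ℝ) (v : L2) : H1.derivL (H1.mk α v) = v := rfl

lemma hasBoundaryValues_mk {α a b : ℝ} {v : L2} :
    HasBoundaryValues (H1.mk α v) a b ↔ α = a ∧ a + prim v 1 = b := by
  constructor
  · rintro ⟨g, hg, hae, rfl, rfl⟩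
    have h := eqOn_of_ae_eq hg (rep α v).continuous (hae.symm.trans (fn_mk α v))
    rw [h (by simp), h (by simp)]
    simp [rep_apply]
  · rintro ⟨rfl, rfl⟩
    exact ⟨rep α v, (rep α v).continuous, fn_mk α v, by simp [rep_apply], rfl⟩

/-- The square integrable functions of mean zero: the derivatives of the functions in `H¹₀`. -/
def MeanZero : Submodule ℝ L2 := (ℝ ∙ toL2 (BoundedContinuousFunction.const ℝ 1))ᗮ

instance : CompleteSpace MeanZero := by unfold MeanZero; infer_instance

lemma mem_meanZero {v : L2} : v ∈ MeanZero ↔ prim v 1 = 0 := by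
  rw [MeanZero, Submodule.mem_orthogonal_singleton_iff_inner_right, inner_toL2_const, one_mul]

@[simp] lemma MeanZero.prim_one (v : MeanZero) : prim (v : L2) 1 = 0 := mem_meanZero.1 v.2

lemma isH10_iff {u : H1} : IsH10 u ↔ ∃ v : MeanZero, u = H1.mk 0 v := by
  obtain ⟨α, v, rfl⟩ := H1.exists_eq_mk u
  rw [IsH10, hasBoundaryValues_mk]
  constructor
  · rintro ⟨rfl, h⟩
    rw [zero_add] at h
    exact ⟨⟨v, mem_meanZero.2 h⟩, rfl⟩
  · rintro ⟨w, hw⟩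
    have hv : v = w := congrArg H1.derivL hw
    subst hv
    have h1 : HasBoundaryValues (H1.mk 0 w) 0 0 := hasBoundaryValues_mk.2 ⟨rfl, by simp⟩
    rw [← hw, hasBoundaryValues_mk] at h1
    exact h1

/-- A primitive vanishes only if the function does. -/
lemma eq_zero_of_toL2_prim_eq_zero {v : L2} (h : toL2 (prim v) = 0) : v = 0 := by
  have h0 := isWeakDeriv_rep 0 v
  rw [rep_zero, h] at h0
  refine eq_zero_of_forall_isTest fun ψ hψ => ?_
  have h2 : ∫ x, (0 : L2) x * deriv ψ x ∂cellMeasure = 0 := by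
    refine integral_eq_zero_of_ae ?_
    filter_upwards [Lp.coeFn_zero ℝ 2 cellMeasure] with x hx
    rw [hx, Pi.zero_apply, zero_mul]
  have h3 := h0 ψ hψ
  rw [h2] at h3
  linarith

lemma mk_zero_ne_zero {v : L2} : H1.mk 0 v ≠ 0 ↔ v ≠ 0 := by
  refine not_congr ⟨fun h => ?_, ?_⟩
  · simpa [H1.derivL_mk] using congrArg H1.derivL h
  · rintro rfl
    refine Subtype.ext ?_
    rw [H1.coe_mk, rep_zero, map_zero, map_zero]
    rfl

/-! ### The energy along lines -/

/-- Integration over the cell. -/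
def cellInt : Cb →L[ℝ] ℝ := innerSL ℝ (toL2 (BoundedContinuousFunction.const ℝ 1)) ∘L toL2

lemma cellInt_apply (a : Cb) : cellInt a = ∫ x, a x ∂cellMeasure := by
  simp [cellInt, inner_toL2_toL2]

lemma inner_toL2_eq_cellInt (a b : Cb) : inner ℝ (toL2 a) (toL2 b) = cellInt (a * b) := by
  rw [inner_toL2_toL2, cellInt_apply]
  rfl

lemma cellInt_nonneg {a : Cb} (h : ∀ x, 0 ≤ a x) : 0 ≤ cellInt a := by
  rw [cellInt_apply]
  exact integral_nonneg h

lemma cellInt_mono {a b : Cb} (h : ∀ x, a x ≤ b x) : cellInt a ≤ cellInt b := by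
  rw [← sub_nonneg, ← map_sub]
  exact cellInt_nonneg fun x => sub_nonneg.2 (h x)

/-- The partial derivative `∂f/∂q₁` of the bulk energy density. -/
def bulkDeriv₁ (θ : ℝ) (a b c : Cb) : Cb :=
  (2 * θ) • a + (12 : ℝ) • a ^ 2 - (4 : ℝ) • b ^ 2 - (4 : ℝ) • c ^ 2
    + (6 : ℝ) • (a * ((3 : ℝ) • a ^ 2 + b ^ 2 + c ^ 2))

/-- The partial derivative `∂f/∂q₂` of the bulk energy density. -/
def bulkDeriv₂ (θ : ℝ) (a b c : Cb) : Cb :=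
  (2 * θ / 3) • b - (8 : ℝ) • (a * b) + (2 : ℝ) • (b * ((3 : ℝ) • a ^ 2 + b ^ 2 + c ^ 2))

/-- The partial derivative `∂f/∂q₃` of the bulk energy density. -/
def bulkDeriv₃ (θ : ℝ) (a b c : Cb) : Cb :=
  (2 * θ / 3) • c - (8 : ℝ) • (a * c) + (2 : ℝ) • (c * ((3 : ℝ) • a ^ 2 + b ^ 2 + c ^ 2))

/-- The second derivative of the bulk energy density at `(a, b, c)` in the direction `(k, l, m)`. -/
def bulkHess (θ : ℝ) (a b c k l m : Cb) : Cb :=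
  (2 * θ / 3) • ((3 : ℝ) • k ^ 2 + l ^ 2 + m ^ 2)
    + (8 : ℝ) • ((3 : ℝ) • (a * k ^ 2) - a * (l ^ 2 + m ^ 2) - (2 : ℝ) • (k * (b * l + c * m)))
    + (2 : ℝ) • (((3 : ℝ) • a ^ 2 + b ^ 2 + c ^ 2) * ((3 : ℝ) • k ^ 2 + l ^ 2 + m ^ 2))
    + (4 : ℝ) • ((3 : ℝ) • (a * k) + b * l + c * m) ^ 2

/-- The bulk energy density is a polynomial of degree four along lines. -/
lemma bulk_line (θ : ℝ) (a b c k l m : Cb) : ∃ B₀ B₃ B₄ : Cb, ∀ t x : ℝ,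
    bulk θ ((a + t • k) x) ((b + t • l) x) ((c + t • m) x) =
      (B₀ + t • (bulkDeriv₁ θ a b c * k + bulkDeriv₂ θ a b c * l + bulkDeriv₃ θ a b c * m)
        + (t ^ 2 / 2) • bulkHess θ a b c k l m + t ^ 3 • B₃ + t ^ 4 • B₄) x := by
  refine ⟨(θ / 3) • ((3 : ℝ) • a ^ 2 + b ^ 2 + c ^ 2) + (4 : ℝ) • (a * (a ^ 2 - b ^ 2 - c ^ 2))
      + (1 / 2 : ℝ) • ((3 : ℝ) • a ^ 2 + b ^ 2 + c ^ 2) ^ 2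
      - BoundedContinuousFunction.const ℝ (⨅ p : ℝ × ℝ × ℝ, bulk₀ θ p.1 p.2.1 p.2.2),
    (4 : ℝ) • (k * (k ^ 2 - l ^ 2 - m ^ 2))
      + (2 : ℝ) • (((3 : ℝ) • (a * k) + b * l + c * m) * ((3 : ℝ) • k ^ 2 + l ^ 2 + m ^ 2)),
    (1 / 2 : ℝ) • ((3 : ℝ) • k ^ 2 + l ^ 2 + m ^ 2) ^ 2, fun t x => ?_⟩
  simp only [bulk, bulk₀, bulkDeriv₁, bulkDeriv₂, bulkDeriv₃, bulkHess,
    BoundedContinuousFunction.coe_add, BoundedContinuousFunction.coe_sub,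
    BoundedContinuousFunction.coe_mul, BoundedContinuousFunction.coe_smul,
    BoundedContinuousFunction.coe_pow, Pi.add_apply, Pi.sub_apply, Pi.mul_apply,
    Pi.pow_apply, smul_eq_mul, BoundedContinuousFunction.const_apply]
  ring

lemma norm_sq_eq_integral (v : L2) : ‖v‖ ^ 2 = ∫ x, v x ^ 2 ∂cellMeasure := by
  rw [← real_inner_self_eq_norm_sq, L2.inner_def]
  simp

lemma energy_eq {θ lam : ℝ} (α₁ α₂ α₃ : ℝ) (v₁ v₂ v₃ : L2) (B : Cb)
    (hB : ∀ x, B x = bulk θ (rep α₁ v₁ x) (rep α₂ v₂ x) (rep α₃ v₃ x)) :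
    energy θ lam (H1.mk α₁ v₁, H1.mk α₂ v₂, H1.mk α₃ v₃) =
      (3 * ‖v₁‖ ^ 2 + ‖v₂‖ ^ 2 + ‖v₃‖ ^ 2) / lam ^ 2 + cellInt B := by
  have i : ∀ v : L2, Integrable (fun x => v x ^ 2) cellMeasure := fun v =>
    (Lp.memLp v).integrable_sq
  have e : energy θ lam (H1.mk α₁ v₁, H1.mk α₂ v₂, H1.mk α₃ v₃) =
      ∫ x, ((3 * v₁ x ^ 2 + v₂ x ^ 2 + v₃ x ^ 2) / lam ^ 2 + B x) ∂cellMeasure := by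
    refine integral_congr_ae ?_
    filter_upwards [fn_mk α₁ v₁, fn_mk α₂ v₂, fn_mk α₃ v₃] with x h1 h2 h3
    simp only [dfn_mk, h1, h2, h3, hB]
  rw [e, integral_add _ (Cb.integrable B), integral_div, integral_add _ (i v₃),
    integral_add ((i v₁).const_mul 3) (i v₂), integral_const_mul, cellInt_apply]
  · simp only [norm_sq_eq_integral]
  · exact ((i v₁).const_mul 3).add (i v₂)
  · exact ((((i v₁).const_mul 3).add (i v₂)).add (i v₃)).div_const _

lemma norm_add_smul_sq (v w : L2) (t : ℝ) :
    ‖v + t • w‖ ^ 2 = ‖v‖ ^ 2 + 2 * t * inner ℝ v w + t ^ 2 * ‖w‖ ^ 2 := by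
  rw [norm_add_sq_real, inner_smul_right, norm_smul, mul_pow, Real.norm_eq_abs, sq_abs]
  ring

/-- The first variation of the energy. -/
def firstVar (θ lam : ℝ) (v₁ v₂ v₃ w₁ w₂ w₃ : L2) (a b c k l m : Cb) : ℝ :=
  2 / lam ^ 2 * (3 * inner ℝ v₁ w₁ + inner ℝ v₂ w₂ + inner ℝ v₃ w₃)
    + cellInt (bulkDeriv₁ θ a b c * k + bulkDeriv₂ θ a b c * l + bulkDeriv₃ θ a b c * m)

/-- The second variation of the energy. -/
def secondVar (θ lam : ℝ) (w₁ w₂ w₃ : L2) (a b c k l m : Cb) : ℝ :=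
  2 / lam ^ 2 * (3 * ‖w₁‖ ^ 2 + ‖w₂‖ ^ 2 + ‖w₃‖ ^ 2) + cellInt (bulkHess θ a b c k l m)

/-- The energy is a polynomial of degree four along lines. -/
lemma energy_line (θ lam : ℝ) (α₁ α₂ α₃ β₁ β₂ β₃ : ℝ) (v₁ v₂ v₃ w₁ w₂ w₃ : L2) :
    ∃ c₀ c₃ c₄ : ℝ, (fun t : ℝ => energy θ lam ((H1.mk α₁ v₁, H1.mk α₂ v₂, H1.mk α₃ v₃)
        + t • (H1.mk β₁ w₁, H1.mk β₂ w₂, H1.mk β₃ w₃))) = fun t =>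
      c₀ + firstVar θ lam v₁ v₂ v₃ w₁ w₂ w₃ (rep α₁ v₁) (rep α₂ v₂) (rep α₃ v₃) (rep β₁ w₁)
        (rep β₂ w₂) (rep β₃ w₃) * t
      + secondVar θ lam w₁ w₂ w₃ (rep α₁ v₁) (rep α₂ v₂) (rep α₃ v₃) (rep β₁ w₁)
        (rep β₂ w₂) (rep β₃ w₃) / 2 * t ^ 2 + c₃ * t ^ 3 + c₄ * t ^ 4 := by
  obtain ⟨B₀, B₃, B₄, hB⟩ := bulk_line θ (rep α₁ v₁) (rep α₂ v₂) (rep α₃ v₃) (rep β₁ w₁)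
    (rep β₂ w₂) (rep β₃ w₃)
  refine ⟨(3 * ‖v₁‖ ^ 2 + ‖v₂‖ ^ 2 + ‖v₃‖ ^ 2) / lam ^ 2 + cellInt B₀, cellInt B₃, cellInt B₄,
    funext fun t => ?_⟩
  have e : (H1.mk α₁ v₁, H1.mk α₂ v₂, H1.mk α₃ v₃) + t • (H1.mk β₁ w₁, H1.mk β₂ w₂, H1.mk β₃ w₃)
      = (H1.mk (α₁ + t * β₁) (v₁ + t • w₁), H1.mk (α₂ + t * β₂) (v₂ + t • w₂),
        H1.mk (α₃ + t * β₃) (v₃ + t • w₃)) := by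
    simp only [Prod.smul_mk, Prod.mk_add_mk, H1.mk_add_smul]
  rw [e, energy_eq _ _ _ _ _ _ _ (fun x => by
    rw [rep_add_smul, rep_add_smul, rep_add_smul]; exact (hB t x).symm)]
  simp only [map_add, map_smul, smul_eq_mul, norm_add_smul_sq, firstVar, secondVar]
  ring

lemma hasDerivAt_energy (θ lam : ℝ) (α₁ α₂ α₃ β₁ β₂ β₃ : ℝ) (v₁ v₂ v₃ w₁ w₂ w₃ : L2) :
    HasDerivAt (fun t : ℝ => energy θ lam ((H1.mk α₁ v₁, H1.mk α₂ v₂, H1.mk α₃ v₃)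
        + t • (H1.mk β₁ w₁, H1.mk β₂ w₂, H1.mk β₃ w₃)))
      (firstVar θ lam v₁ v₂ v₃ w₁ w₂ w₃ (rep α₁ v₁) (rep α₂ v₂) (rep α₃ v₃) (rep β₁ w₁)
        (rep β₂ w₂) (rep β₃ w₃)) 0 := by
  obtain ⟨c₀, c₃, c₄, h⟩ := energy_line θ lam α₁ α₂ α₃ β₁ β₂ β₃ v₁ v₂ v₃ w₁ w₂ w₃
  rw [h]
  generalize firstVar _ _ _ _ _ _ _ _ _ _ _ _ _ _ = c₁
  generalize secondVar _ _ _ _ _ _ _ _ _ _ _ = c₂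
  have hid := hasDerivAt_id (0 : ℝ)
  refine (((((hasDerivAt_const (0 : ℝ) c₀).add (hid.const_mul c₁)).add
    ((hid.pow 2).const_mul (c₂ / 2))).add ((hid.pow 3).const_mul c₃)).add
    ((hid.pow 4).const_mul c₄)).congr_deriv ?_
  simp

lemma secondVariation_mk (θ lam : ℝ) (α₁ α₂ α₃ β₁ β₂ β₃ : ℝ) (v₁ v₂ v₃ w₁ w₂ w₃ : L2) :
    secondVariation θ lam (H1.mk α₁ v₁, H1.mk α₂ v₂, H1.mk α₃ v₃)
        (H1.mk β₁ w₁, H1.mk β₂ w₂, H1.mk β₃ w₃) =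
      secondVar θ lam w₁ w₂ w₃ (rep α₁ v₁) (rep α₂ v₂) (rep α₃ v₃) (rep β₁ w₁)
        (rep β₂ w₂) (rep β₃ w₃) := by
  obtain ⟨c₀, c₃, c₄, h⟩ := energy_line θ lam α₁ α₂ α₃ β₁ β₂ β₃ v₁ v₂ v₃ w₁ w₂ w₃
  rw [secondVariation, h]
  generalize firstVar _ _ _ _ _ _ _ _ _ _ _ _ _ _ = c₁
  generalize secondVar _ _ _ _ _ _ _ _ _ _ _ = c₂
  have hid := fun t : ℝ => hasDerivAt_id t
  have h1 : deriv (fun t : ℝ => c₀ + c₁ * t + c₂ / 2 * t ^ 2 + c₃ * t ^ 3 + c₄ * t ^ 4) =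
      fun t => c₁ + c₂ * t + 3 * c₃ * t ^ 2 + 4 * c₄ * t ^ 3 := by
    funext t
    refine HasDerivAt.deriv ((((((hasDerivAt_const t c₀).add ((hid t).const_mul c₁)).add
      (((hid t).pow 2).const_mul (c₂ / 2))).add (((hid t).pow 3).const_mul c₃)).add
      (((hid t).pow 4).const_mul c₄)).congr_deriv ?_)
    simp
    ring
  rw [iteratedDeriv_succ, iteratedDeriv_one, h1]
  refine HasDerivAt.deriv (((((hasDerivAt_const (0 : ℝ) c₁).add ((hid 0).const_mul c₂)).add
    (((hid 0).pow 2).const_mul (3 * c₃))).add (((hid 0).pow 3).const_mul (4 * c₄))).congr_deriv ?_)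
  simp

/-! ### The Euler–Lagrange equations as a compact perturbation of the identity -/

/-- The `H¹₀` function with a given derivative, as a bounded continuous function. -/
def primZ : MeanZero →L[ℝ] Cb := prim ∘L MeanZero.subtypeL

lemma primZ_apply (v : MeanZero) : primZ v = prim v := rfl

lemma isCompactOperator_primZ : IsCompactOperator primZ :=
  isCompactOperator_prim.comp_clm MeanZero.subtypeL

/-- The derivative of the solution `u` of the Dirichlet problem `-u'' = a`. -/
def riesz : Cb →L[ℝ] MeanZero :=
  -(MeanZero.orthogonalProjectionOnto ∘L toL2 ∘L prim ∘L toL2)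

lemma inner_riesz (a : Cb) (h : MeanZero) : inner ℝ (riesz a) h = cellInt (a * primZ h) := by
  have key := inner_prim_add_inner_prim (toL2 a) h
  rw [MeanZero.prim_one, mul_zero, inner_toL2_eq_cellInt, mul_comm] at key
  have h1 : inner ℝ (riesz a) h = -inner ℝ (toL2 (prim (toL2 a))) (h : L2) := by
    simp only [riesz, _root_.neg_apply, inner_neg_left,
      ContinuousLinearMap.comp_apply, Submodule.inner_orthogonalProjectionOnto_eq_of_mem_right]
  rw [h1, primZ_apply]
  linarith

lemma inner_smul_riesz (c : ℝ) (a : Cb) (h : MeanZero) :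
    inner ℝ (c • riesz a) h = c * cellInt (a * primZ h) := by
  rw [← inner_riesz]
  exact real_inner_smul_left (riesz a) h c

/-- The slope of the affine function joining the boundary values of `q₂`. -/
def slope (θ : ℝ) : L2 := toL2 (BoundedContinuousFunction.const ℝ (-(3 * qPlus θ)))

lemma inner_slope (θ : ℝ) (v : MeanZero) : inner ℝ (slope θ) (v : L2) = 0 := by
  rw [slope, inner_toL2_const, MeanZero.prim_one, mul_zero]

lemma prim_slope_one (θ : ℝ) : prim (slope θ) 1 = -(6 * qPlus θ) := by
  rw [slope, prim_congr (coeFn_toL2 _) (by simp)]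
  simp
  ring

/-- The component `q₁` of the configuration with parameter `v`. -/
def field₁ (θ : ℝ) (v : MeanZero) : Cb := rep (qPlus θ) 0 + primZ v

/-- The component `q₂` of the configuration with parameter `v`. -/
def field₂ (θ : ℝ) (v : MeanZero) : Cb := rep (3 * qPlus θ) (slope θ) + primZ v

lemma rep_eq_field₁ (θ : ℝ) (v : MeanZero) : rep (qPlus θ) v = field₁ θ v := by
  ext x; simp [rep_apply, field₁, primZ_apply]

lemma rep_eq_field₂ (θ : ℝ) (v : MeanZero) : rep (3 * qPlus θ) (slope θ + v) = field₂ θ v := by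
  ext x; simp [rep_apply, field₂, primZ_apply]; ring

/-- The admissible configurations are parametrized by triples of mean zero functions. -/
def conf (θ : ℝ) (v : MeanZero × MeanZero × MeanZero) : Config :=
  (H1.mk (qPlus θ) v.1, H1.mk (3 * qPlus θ) (slope θ + v.2.1), H1.mk 0 v.2.2)

/-- Every `H¹` configuration is given by initial values and derivatives; admissibility fixes the
initial values and the means of the derivatives. -/
lemma isAdmissible_iff {θ : ℝ} {Q : Config} : IsAdmissible θ Q ↔ ∃ v, Q = conf θ v := by
  obtain ⟨Q₁, Q₂, Q₃⟩ := Q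
  obtain ⟨α₁, v₁, rfl⟩ := H1.exists_eq_mk Q₁
  obtain ⟨α₂, v₂, rfl⟩ := H1.exists_eq_mk Q₂
  obtain ⟨α₃, v₃, rfl⟩ := H1.exists_eq_mk Q₃
  simp only [IsAdmissible, hasBoundaryValues_mk]
  constructor
  · rintro ⟨⟨rfl, h1⟩, ⟨rfl, h2⟩, rfl, h3⟩
    have m2 : v₂ - slope θ ∈ MeanZero := by
      rw [mem_meanZero, map_sub, BoundedContinuousFunction.sub_apply, prim_slope_one]
      linarith
    refine ⟨(⟨v₁, mem_meanZero.2 (by linarith)⟩, ⟨v₂ - slope θ, m2⟩,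
      ⟨v₃, mem_meanZero.2 (by linarith)⟩), ?_⟩
    simp [conf]
  · rintro ⟨v, hv⟩
    have h1 := congrArg (fun Q : Config => Q.1) hv
    have h2 := congrArg (fun Q : Config => Q.2.1) hv
    have h3 := congrArg (fun Q : Config => Q.2.2) hv
    simp only [conf] at h1 h2 h3
    rw [← hasBoundaryValues_mk, ← hasBoundaryValues_mk, ← hasBoundaryValues_mk, h1, h2, h3,
      hasBoundaryValues_mk, hasBoundaryValues_mk, hasBoundaryValues_mk]
    refine ⟨⟨rfl, by simp⟩, ⟨rfl, ?_⟩, rfl, by simp⟩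
    rw [map_add, BoundedContinuousFunction.add_apply, prim_slope_one, MeanZero.prim_one]
    ring

/-- The left-hand side `v + λ² G(v)` of the Euler–Lagrange equations, in terms of the derivatives
`v` of the differences with the affine configuration. The factors `1 / 6` and `1 / 2` come
from the derivatives `6 q₁'`, `2 q₂'` and `2 q₃'` of the gradient term `3 q₁'² + q₂'² + q₃'²`. -/
def fullEq (θ : ℝ) (z : ℝ × MeanZero × MeanZero × MeanZero) : MeanZero × MeanZero × MeanZero :=
  (z.2.1 + (z.1 ^ 2 / 6) •
      riesz (bulkDeriv₁ θ (field₁ θ z.2.1) (field₂ θ z.2.2.1) (primZ z.2.2.2)),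
    z.2.2.1 + (z.1 ^ 2 / 2) •
      riesz (bulkDeriv₂ θ (field₁ θ z.2.1) (field₂ θ z.2.2.1) (primZ z.2.2.2)),
    z.2.2.2 + (z.1 ^ 2 / 2) •
      riesz (bulkDeriv₃ θ (field₁ θ z.2.1) (field₂ θ z.2.2.1) (primZ z.2.2.2)))

/-- The Euler–Lagrange equations of configurations with `q₃ = 0`. -/
def planarEq (θ : ℝ) (z : ℝ × MeanZero × MeanZero) : MeanZero × MeanZero :=
  (z.2.1 + (z.1 ^ 2 / 6) • riesz (bulkDeriv₁ θ (field₁ θ z.2.1) (field₂ θ z.2.2) 0),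
    z.2.2 + (z.1 ^ 2 / 2) • riesz (bulkDeriv₂ θ (field₁ θ z.2.1) (field₂ θ z.2.2) 0))

lemma fullEq_planar (θ lam : ℝ) (v : MeanZero × MeanZero) :
    fullEq θ (lam, v.1, v.2, 0) = ((planarEq θ (lam, v)).1, (planarEq θ (lam, v)).2, 0) := by
  have h3 : ∀ a b : Cb, bulkDeriv₃ θ a b 0 = 0 := by simp [bulkDeriv₃]
  simp [fullEq, planarEq, h3]

lemma contDiff_bulkDeriv₁ (θ : ℝ) :
    ContDiff ℝ ∞ fun p : Cb × Cb × Cb => bulkDeriv₁ θ p.1 p.2.1 p.2.2 := by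
  unfold bulkDeriv₁; fun_prop

lemma contDiff_bulkDeriv₂ (θ : ℝ) :
    ContDiff ℝ ∞ fun p : Cb × Cb × Cb => bulkDeriv₂ θ p.1 p.2.1 p.2.2 := by
  unfold bulkDeriv₂; fun_prop

lemma contDiff_bulkDeriv₃ (θ : ℝ) :
    ContDiff ℝ ∞ fun p : Cb × Cb × Cb => bulkDeriv₃ θ p.1 p.2.1 p.2.2 := by
  unfold bulkDeriv₃; fun_prop

lemma contDiff_field₁ (θ : ℝ) : ContDiff ℝ ∞ (field₁ θ) := by
  unfold field₁; fun_prop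

lemma contDiff_field₂ (θ : ℝ) : ContDiff ℝ ∞ (field₂ θ) := by
  unfold field₂; fun_prop

lemma contDiff_fullEq (θ : ℝ) : ContDiff ℝ ∞ (fullEq θ) := by
  have hq : ContDiff ℝ ∞ fun z : ℝ × MeanZero × MeanZero × MeanZero =>
      (field₁ θ z.2.1, field₂ θ z.2.2.1, primZ z.2.2.2) :=
    ((contDiff_field₁ θ).comp contDiff_snd.fst).prodMk
      (((contDiff_field₂ θ).comp contDiff_snd.snd.fst).prodMk
        (primZ.contDiff.comp contDiff_snd.snd.snd))
  have hc : ∀ c : ℝ, ContDiff ℝ ∞ fun z : ℝ × MeanZero × MeanZero × MeanZero => z.1 ^ 2 / c :=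
    fun c => (contDiff_fst.pow 2).div_const c
  exact (contDiff_snd.fst.add ((hc 6).smul (riesz.contDiff.comp
      ((contDiff_bulkDeriv₁ θ).comp hq)))).prodMk
    ((contDiff_snd.snd.fst.add ((hc 2).smul (riesz.contDiff.comp
      ((contDiff_bulkDeriv₂ θ).comp hq)))).prodMk
    (contDiff_snd.snd.snd.add ((hc 2).smul (riesz.contDiff.comp
      ((contDiff_bulkDeriv₃ θ).comp hq)))))

lemma planarEq_eq (θ : ℝ) (z : ℝ × MeanZero × MeanZero) :
    planarEq θ z = ((fullEq θ (z.1, z.2.1, z.2.2, 0)).1, (fullEq θ (z.1, z.2.1, z.2.2, 0)).2.1) := by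
  have := fullEq_planar θ z.1 z.2
  rw [this]

lemma contDiff_planarEq (θ : ℝ) : ContDiff ℝ ∞ (planarEq θ) := by
  have h := (contDiff_fullEq θ).comp (by fun_prop :
    ContDiff ℝ ∞ fun z : ℝ × MeanZero × MeanZero => (z.1, z.2.1, z.2.2, (0 : MeanZero)))
  rw [funext (planarEq_eq θ)]
  exact h.fst.prodMk h.snd.fst

/-- The first variation is represented, up to a weight, by the vector `fullEq`. -/
lemma firstVar_eq {θ lam : ℝ} (hlam : lam ≠ 0) (v w : MeanZero × MeanZero × MeanZero) :
    firstVar θ lam v.1 (slope θ + v.2.1) v.2.2 w.1 w.2.1 w.2.2 (field₁ θ v.1) (field₂ θ v.2.1)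
      (primZ v.2.2) (primZ w.1) (primZ w.2.1) (primZ w.2.2) =
    2 / lam ^ 2 * (3 * inner ℝ (fullEq θ (lam, v)).1 w.1 + inner ℝ (fullEq θ (lam, v)).2.1 w.2.1
      + inner ℝ (fullEq θ (lam, v)).2.2 w.2.2) := by
  simp only [fullEq, firstVar, inner_add_left, inner_slope, inner_smul_riesz, map_add,
    ← Submodule.coe_inner]
  field_simp
  ring

/-- The critical points are the zeros of `fullEq`. -/
lemma isCriticalPoint_iff {θ lam : ℝ} (hlam : lam ≠ 0) {Q : Config} :
    IsCriticalPoint θ lam Q ↔ ∃ v, Q = conf θ v ∧ fullEq θ (lam, v) = 0 := by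
  rw [IsCriticalPoint, isAdmissible_iff]
  have hv : ∀ v w : MeanZero × MeanZero × MeanZero,
      HasDerivAt (fun t : ℝ => energy θ lam (conf θ v + t • (H1.mk 0 w.1, H1.mk 0 w.2.1, H1.mk 0 w.2.2)))
        (2 / lam ^ 2 * (3 * inner ℝ (fullEq θ (lam, v)).1 w.1
          + inner ℝ (fullEq θ (lam, v)).2.1 w.2.1 + inner ℝ (fullEq θ (lam, v)).2.2 w.2.2)) 0 := by
    intro v w
    have h := hasDerivAt_energy θ lam (qPlus θ) (3 * qPlus θ) 0 0 0 0 v.1 (slope θ + v.2.1) v.2.2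
      w.1 w.2.1 w.2.2
    rwa [rep_eq_field₁, rep_eq_field₂, rep_zero, rep_zero, rep_zero, rep_zero, ← primZ_apply,
      ← primZ_apply, ← primZ_apply, ← primZ_apply, firstVar_eq hlam] at h
  constructor
  · rintro ⟨⟨v, rfl⟩, h⟩
    refine ⟨v, rfl, ?_⟩
    set r := fullEq θ (lam, v) with hr
    have h1 := (h (H1.mk 0 r.1, H1.mk 0 r.2.1, H1.mk 0 r.2.2) (isH10_iff.2 ⟨_, rfl⟩)
      (isH10_iff.2 ⟨_, rfl⟩) (isH10_iff.2 ⟨_, rfl⟩)).unique (hv v r)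
    rw [← hr, real_inner_self_eq_norm_sq, real_inner_self_eq_norm_sq,
      real_inner_self_eq_norm_sq] at h1
    have h2 : 0 < 2 / lam ^ 2 := by positivity
    have h3 : 3 * ‖r.1‖ ^ 2 + ‖r.2.1‖ ^ 2 + ‖r.2.2‖ ^ 2 = 0 :=
      (mul_eq_zero.1 h1.symm).resolve_left h2.ne'
    have p1 := sq_nonneg ‖r.1‖
    have p2 := sq_nonneg ‖r.2.1‖
    have p3 := sq_nonneg ‖r.2.2‖
    have e1 : r.1 = 0 := by rw [← norm_eq_zero, ← sq_eq_zero_iff]; linarith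
    have e2 : r.2.1 = 0 := by rw [← norm_eq_zero, ← sq_eq_zero_iff]; linarith
    have e3 : r.2.2 = 0 := by rw [← norm_eq_zero, ← sq_eq_zero_iff]; linarith
    exact Prod.ext e1 (Prod.ext e2 e3)
  · rintro ⟨v, rfl, h0⟩
    refine ⟨⟨v, rfl⟩, ?_⟩
    rintro ⟨h₁, h₂, h₃⟩ hh₁ hh₂ hh₃
    obtain ⟨w₁, rfl⟩ := isH10_iff.1 hh₁
    obtain ⟨w₂, rfl⟩ := isH10_iff.1 hh₂
    obtain ⟨w₃, rfl⟩ := isH10_iff.1 hh₃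
    have := hv v (w₁, w₂, w₃)
    rw [h0] at this
    simpa using this

/-- The configuration with `q₃ = 0` and parameter `v`. -/
def planarConf (θ : ℝ) (v : MeanZero × MeanZero) : Config := conf θ (v.1, v.2, 0)

lemma H1.mk_zero_zero : H1.mk 0 0 = 0 := by
  by_contra h
  exact mk_zero_ne_zero.1 h rfl

/-- The eigenvalue exchange solutions are the zeros of `planarEq`. -/
lemma isEESolution_iff {θ lam : ℝ} (hlam : lam ≠ 0) {Q : Config} :
    IsEESolution θ lam Q ↔ ∃ v, Q = planarConf θ v ∧ planarEq θ (lam, v) = 0 := by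
  rw [IsEESolution, isCriticalPoint_iff hlam]
  constructor
  · rintro ⟨⟨⟨v₁, v₂, v₃⟩, rfl, h0⟩, h3⟩
    have : v₃ = 0 := by
      have := congrArg H1.derivL h3
      simpa [conf, H1.derivL_mk] using this
    subst this
    refine ⟨(v₁, v₂), rfl, ?_⟩
    rw [planarEq_eq, h0]
    rfl
  · rintro ⟨v, rfl, h0⟩
    refine ⟨⟨(v.1, v.2, 0), rfl, ?_⟩, ?_⟩
    · rw [fullEq_planar, h0]
      rfl
    · simp [planarConf, conf, H1.mk_zero_zero]

/-- The parameter of a configuration with `q₃ = 0`, as a bounded linear map. The slope of the affine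
configuration is orthogonal to the functions of mean zero. -/
def planarParam : Config →L[ℝ] MeanZero × MeanZero :=
  (MeanZero.orthogonalProjectionOnto ∘L H1.derivL ∘L ContinuousLinearMap.fst ℝ H1 (H1 × H1)).prod
    (MeanZero.orthogonalProjectionOnto ∘L H1.derivL ∘L ContinuousLinearMap.fst ℝ H1 H1 ∘L
      ContinuousLinearMap.snd ℝ H1 (H1 × H1))

lemma planarParam_planarConf (θ : ℝ) (v : MeanZero × MeanZero) :
    planarParam (planarConf θ v) = v := by
  have h1 : MeanZero.orthogonalProjectionOnto (slope θ) = 0 := by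
    rw [Submodule.orthogonalProjectionOnto_eq_zero_iff, Submodule.mem_orthogonal']
    exact fun u hu => inner_slope θ ⟨u, hu⟩
  refine Prod.ext ?_ ?_
  · change MeanZero.orthogonalProjectionOnto (v.1 : L2) = v.1
    simp
  · change MeanZero.orthogonalProjectionOnto (slope θ + (v.2 : L2)) = v.2
    rw [map_add, h1]
    simp

lemma contDiff_planarConf (θ : ℝ) : ContDiff ℝ ∞ (planarConf θ) := by
  have : planarConf θ = fun v : MeanZero × MeanZero =>
      (H1.mk (qPlus θ) 0 + H1.ofDeriv v.1, H1.mk (3 * qPlus θ) (slope θ) + H1.ofDeriv v.2,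
        (0 : H1)) := by
    funext v
    simp only [planarConf, conf]
    refine Prod.ext (H1.mk_eq_add_ofDeriv _ _) (Prod.ext ?_ H1.mk_zero_zero)
    change H1.mk (3 * qPlus θ) (slope θ + v.2) = H1.mk (3 * qPlus θ) (slope θ) + H1.ofDeriv v.2
    rw [H1.mk_eq_add_ofDeriv, H1.mk_eq_add_ofDeriv _ (slope θ), map_add, add_assoc]
  rw [this]
  have hs : ContDiff ℝ ∞ fun v : MeanZero => (v : L2) := MeanZero.subtypeL.contDiff
  fun_prop

/-! ### A priori bounds, compactness and uniqueness for small `λ` -/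

/-- A quartic dominates lower order terms, up to a constant. -/
lemma exists_quartic_lower_bound (K : ℝ) (hK0 : 0 ≤ K) : ∃ C : ℝ, 0 ≤ C ∧ ∀ r : ℝ, 0 ≤ r →
    -C ≤ 2 * r ^ 4 - K * (r ^ 3 + r ^ 2 + r) := by
  refine ⟨3 * K + 3 * K * (3 * K / 2) ^ 3, by positivity, fun r hr0 => ?_⟩
  have hK3 : 0 ≤ 3 * K * (3 * K / 2) ^ 3 := by positivity
  have hr3 : 0 ≤ r ^ 3 := by positivity
  have hr4 : 0 ≤ r ^ 4 := by positivity
  rcases le_total r 1 with h1 | h1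
  · have h2 : r ^ 3 + r ^ 2 + r ≤ 3 := by
      have := pow_le_one₀ hr0 h1 (n := 3)
      have := pow_le_one₀ hr0 h1 (n := 2)
      linarith
    have := mul_le_mul_of_nonneg_left h2 hK0
    linarith
  · have h3 : r ^ 3 + r ^ 2 + r ≤ 3 * r ^ 3 := by
      have : r ^ 2 ≤ r ^ 3 := pow_le_pow_right₀ h1 (by norm_num)
      have : r ≤ r ^ 3 := le_self_pow₀ h1 (by norm_num)
      linarith
    have h4 := mul_le_mul_of_nonneg_left h3 hK0
    rcases le_total (3 * K / 2) r with h5 | h5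
    · have h6 : 0 ≤ r ^ 3 * (2 * r - 3 * K) := mul_nonneg hr3 (by linarith)
      have h7 : r ^ 3 * (2 * r - 3 * K) = 2 * r ^ 4 - K * (3 * r ^ 3) := by ring
      linarith
    · have h6 : r ^ 3 ≤ (3 * K / 2) ^ 3 := pow_le_pow_left₀ hr0 h5 3
      have h7 := mul_le_mul_of_nonneg_left h6 (by positivity : 0 ≤ 3 * K)
      linarith

/-- The quartic growth of the bulk energy makes its derivative in the direction of the distance from
a bounded reference configuration bounded below. -/
lemma exists_bulkDeriv_lower_bound (θ B : ℝ) (hB : 0 ≤ B) : ∃ C : ℝ, 0 ≤ C ∧ ∀ a₀ b₀ a b c : ℝ,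
    |a₀| ≤ B → |b₀| ≤ B →
    -C ≤ (2 * θ * a + 12 * a ^ 2 - 4 * b ^ 2 - 4 * c ^ 2 + 6 * (a * (3 * a ^ 2 + b ^ 2 + c ^ 2)))
          * (a - a₀)
        + (2 * θ / 3 * b - 8 * (a * b) + 2 * (b * (3 * a ^ 2 + b ^ 2 + c ^ 2))) * (b - b₀)
        + (2 * θ / 3 * c - 8 * (a * c) + 2 * (c * (3 * a ^ 2 + b ^ 2 + c ^ 2))) * c := by
  have hθ := abs_nonneg θ
  have hBθ : 0 ≤ |θ| * B := mul_nonneg hθ hB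
  obtain ⟨C, hC, hCr⟩ := exists_quartic_lower_bound (12 + 12 * B + |θ| + 3 * (|θ| * B))
    (by linarith)
  refine ⟨C, hC, fun a₀ b₀ a b c ha₀ hb₀ => ?_⟩
  obtain ⟨s, hs⟩ : ∃ s, s = 3 * a ^ 2 + b ^ 2 + c ^ 2 := ⟨_, rfl⟩
  have hsa := sq_nonneg a
  have hsb := sq_nonneg b
  have hsc := sq_nonneg c
  have hs0 : 0 ≤ s := by linarith
  -- All terms are estimated by powers of `r = √s`.
  obtain ⟨r, hr0, hrs⟩ : ∃ r, 0 ≤ r ∧ r ^ 2 = s := ⟨√s, Real.sqrt_nonneg s, Real.sq_sqrt hs0⟩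
  have ha : |a| ≤ r := abs_le_of_sq_le_sq (by linarith) hr0
  have hb : |b| ≤ r := abs_le_of_sq_le_sq (by linarith) hr0
  obtain ⟨f₁, hf₁⟩ : ∃ f₁, f₁ = 2 * θ * a + 12 * a ^ 2 - 4 * b ^ 2 - 4 * c ^ 2 + 6 * (a * s) :=
    ⟨_, rfl⟩
  obtain ⟨f₂, hf₂⟩ : ∃ f₂, f₂ = 2 * θ / 3 * b - 8 * (a * b) + 2 * (b * s) := ⟨_, rfl⟩
  have hθa : |θ * a| ≤ |θ| * r := by rw [abs_mul]; gcongr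
  have hθb : |θ * b| ≤ |θ| * r := by rw [abs_mul]; gcongr
  have has : |a * s| ≤ r ^ 3 := by
    rw [abs_mul, abs_of_nonneg hs0, ← hrs, pow_succ' r 2]; gcongr
  have hbs : |b * s| ≤ r ^ 3 := by
    rw [abs_mul, abs_of_nonneg hs0, ← hrs, pow_succ' r 2]; gcongr
  have hab : |a * b| ≤ r ^ 2 := by rw [abs_mul, sq]; gcongr
  have haq : |a * (a ^ 2 - b ^ 2 - c ^ 2)| ≤ r ^ 3 := by
    have hq : |a ^ 2 - b ^ 2 - c ^ 2| ≤ r ^ 2 := abs_le.2 ⟨by linarith, by linarith⟩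
    rw [abs_mul, pow_succ' r 2]; gcongr
  have e₁ : |f₁| ≤ 2 * (|θ| * r) + 4 * r ^ 2 + 6 * r ^ 3 := by
    rw [abs_le] at hθa has
    exact abs_le.2 ⟨by linarith [hθa.1, has.1], by linarith [hθa.2, has.2]⟩
  have hθr := mul_nonneg hθ hr0
  have e₂ : |f₂| ≤ |θ| * r + 8 * r ^ 2 + 2 * r ^ 3 := by
    rw [abs_le] at hθb hbs hab
    exact abs_le.2 ⟨by linarith [hθb.1, hbs.1, hab.2], by linarith [hθb.2, hbs.2, hab.1]⟩
  have e₁' : f₁ * a₀ ≤ (2 * (|θ| * r) + 4 * r ^ 2 + 6 * r ^ 3) * B := by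
    refine (le_abs_self _).trans ?_
    rw [abs_mul]; gcongr
  have e₂' : f₂ * b₀ ≤ (|θ| * r + 8 * r ^ 2 + 2 * r ^ 3) * B := by
    refine (le_abs_self _).trans ?_
    rw [abs_mul]; gcongr
  have hθs : -(|θ| * r ^ 2) ≤ θ * s := by
    rw [hrs, neg_le_iff_add_nonneg, ← add_mul]
    exact mul_nonneg (by linarith [neg_abs_le θ]) hs0
  have hs2 : s ^ 2 = r ^ 4 := by rw [← hrs]; ring
  have hr2 : 0 ≤ r ^ 2 := by positivity
  have hr3 : 0 ≤ r ^ 3 := by positivity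
  have main : 2 * r ^ 4 - (12 + 12 * B + |θ| + 3 * (|θ| * B)) * (r ^ 3 + r ^ 2 + r) ≤
      2 * θ / 3 * s + 12 * (a * (a ^ 2 - b ^ 2 - c ^ 2)) + 2 * s ^ 2 - f₁ * a₀ - f₂ * b₀ := by
    rw [hs2]
    have q2 : 0 ≤ B * r ^ 2 := by positivity
    have q3 : 0 ≤ B * r ^ 3 := by positivity
    have q4 : 0 ≤ |θ| * r ^ 2 := by positivity
    have q5 : 0 ≤ |θ| * r ^ 3 := by positivity
    have q6 : 0 ≤ |θ| * B * r ^ 2 := by positivity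
    have q7 : 0 ≤ |θ| * B * r ^ 3 := by positivity
    have q8 : 0 ≤ B * r := by positivity
    have h1 := (abs_le.1 haq).1
    linarith
  refine (hCr r hr0).trans (main.trans (le_of_eq ?_))
  rw [hf₁, hf₂, hs]
  ring

lemma cellInt_const (c : ℝ) : cellInt (BoundedContinuousFunction.const ℝ c) = 2 * c := by
  rw [cellInt_apply]
  simp only [BoundedContinuousFunction.const_apply, integral_const, measureReal_cell_univ,
    smul_eq_mul]

/-- The a priori bound, obtained by testing the equations with the solution. -/
lemma exists_norm_sq_le (θ : ℝ) : ∃ C : ℝ, 0 ≤ C ∧ ∀ (lam : ℝ)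
    (v : MeanZero × MeanZero × MeanZero), lam ≠ 0 → fullEq θ (lam, v) = 0 →
      ‖v‖ ^ 2 ≤ lam ^ 2 * C := by
  set a₀ : Cb := rep (qPlus θ) 0 with ha₀
  set b₀ : Cb := rep (3 * qPlus θ) (slope θ) with hb₀
  obtain ⟨C, hC, hbd⟩ := exists_bulkDeriv_lower_bound θ (max ‖a₀‖ ‖b₀‖)
    ((norm_nonneg _).trans (le_max_left _ _))
  refine ⟨C, hC, fun lam v hlam h0 => ?_⟩
  have key := firstVar_eq hlam v v (θ := θ)
  rw [h0] at key
  simp only [Prod.fst_zero, Prod.snd_zero, inner_zero_left, mul_zero, add_zero, firstVar,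
    inner_add_left, inner_slope, zero_add, ← Submodule.coe_inner] at key
  rw [real_inner_self_eq_norm_sq, real_inner_self_eq_norm_sq, real_inner_self_eq_norm_sq] at key
  have hlow : -(2 * C) ≤ cellInt (bulkDeriv₁ θ (field₁ θ v.1) (field₂ θ v.2.1) (primZ v.2.2)
      * primZ v.1 + bulkDeriv₂ θ (field₁ θ v.1) (field₂ θ v.2.1) (primZ v.2.2) * primZ v.2.1
      + bulkDeriv₃ θ (field₁ θ v.1) (field₂ θ v.2.1) (primZ v.2.2) * primZ v.2.2) := by
    have : -(2 * C) = cellInt (BoundedContinuousFunction.const ℝ (-C)) := by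
      rw [cellInt_const]; ring
    rw [this]
    refine cellInt_mono fun x => ?_
    have h1 := hbd (a₀ x) (b₀ x) (field₁ θ v.1 x) (field₂ θ v.2.1 x) (primZ v.2.2 x)
      ((a₀.norm_coe_le_norm x).trans (le_max_left _ _))
      ((b₀.norm_coe_le_norm x).trans (le_max_right _ _))
    have h2 : field₁ θ v.1 x - a₀ x = primZ v.1 x := by simp [field₁, ha₀]
    have h3 : field₂ θ v.2.1 x - b₀ x = primZ v.2.1 x := by simp [field₂, hb₀]
    rw [h2, h3] at h1
    simpa only [bulkDeriv₁, bulkDeriv₂, bulkDeriv₃, BoundedContinuousFunction.const_apply,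
      BoundedContinuousFunction.coe_add, BoundedContinuousFunction.coe_sub,
      BoundedContinuousFunction.coe_mul, BoundedContinuousFunction.coe_smul,
      BoundedContinuousFunction.coe_pow, Pi.add_apply, Pi.sub_apply, Pi.mul_apply,
      Pi.pow_apply, smul_eq_mul] using h1
  have hsum : 3 * ‖v.1‖ ^ 2 + ‖v.2.1‖ ^ 2 + ‖v.2.2‖ ^ 2 ≤ lam ^ 2 * C := by
    have h1 : 2 / lam ^ 2 * (3 * ‖v.1‖ ^ 2 + ‖v.2.1‖ ^ 2 + ‖v.2.2‖ ^ 2) ≤ 2 * C := by linarith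
    have h2 : 0 < lam ^ 2 := by positivity
    rw [div_mul_eq_mul_div, div_le_iff₀ h2] at h1
    linarith
  have p1 := sq_nonneg ‖v.1‖
  have p2 := sq_nonneg ‖v.2.1‖
  have p3 := sq_nonneg ‖v.2.2‖
  have hx : 0 ≤ lam ^ 2 * C := by positivity
  have h1 : ‖v‖ ≤ √(lam ^ 2 * C) := by
    refine norm_prod_le_iff.2 ⟨Real.le_sqrt_of_sq_le (by linarith), norm_prod_le_iff.2
      ⟨Real.le_sqrt_of_sq_le (by linarith), Real.le_sqrt_of_sq_le (by linarith)⟩⟩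
  calc ‖v‖ ^ 2 ≤ √(lam ^ 2 * C) ^ 2 := by gcongr
    _ = lam ^ 2 * C := Real.sq_sqrt hx

/-- A compact perturbation of the identity with trivial kernel is invertible. -/
lemma isInvertible_id_add {X : Type*} [NormedAddCommGroup X] [NormedSpace ℝ X] [CompleteSpace X]
    {K : X →L[ℝ] X} (hK : IsCompactOperator K) (hinj : ∀ w, w + K w = 0 → w = 0) :
    (ContinuousLinearMap.id ℝ X + K).IsInvertible := by
  have hK' : IsCompactOperator (-K) := hK.neg
  rcases hK'.hasEigenvalue_or_mem_resolventSet one_ne_zero with h | h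
  · obtain ⟨w, hw⟩ := h.exists_hasEigenvector
    refine absurd (hinj w ?_) hw.2
    have := hw.apply_eq_smul
    simp only [one_smul] at this
    change -(K w) = w at this
    rw [neg_eq_iff_add_eq_zero.1 this |> fun h => (add_comm w (K w)).trans h]
  · rw [spectrum.mem_resolventSet_iff] at h
    obtain ⟨u, hu⟩ := h
    refine ⟨ContinuousLinearEquiv.unitsEquiv ℝ X u, ?_⟩
    ext x
    change (u : X →L[ℝ] X) x = _
    rw [hu]
    simp

/-- The fields of a parameter of a configuration with `q₃ = 0`. -/
def primPair : MeanZero × MeanZero →L[ℝ] Cb × Cb := primZ.prodMap primZ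

lemma isCompactOperator_primPair : IsCompactOperator primPair := by
  obtain ⟨K, hK, hm⟩ := isCompactOperator_primZ
  refine ⟨K ×ˢ K, hK.prod hK, ?_⟩
  exact prod_mem_nhds (x := (0 : MeanZero)) (y := (0 : MeanZero)) hm hm

/-- The nonlinearity `G` in the equation `v + λ² G(v) = 0`, as a function of the fields. -/
def nonlin (θ : ℝ) (p : Cb × Cb) : MeanZero × MeanZero :=
  ((1 / 6 : ℝ) • riesz (bulkDeriv₁ θ (rep (qPlus θ) 0 + p.1) (rep (3 * qPlus θ) (slope θ) + p.2) 0),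
   (1 / 2 : ℝ) • riesz (bulkDeriv₂ θ (rep (qPlus θ) 0 + p.1) (rep (3 * qPlus θ) (slope θ) + p.2) 0))

lemma contDiff_nonlin (θ : ℝ) : ContDiff ℝ ∞ (nonlin θ) := by
  have h : ContDiff ℝ ∞ fun p : Cb × Cb => (rep (qPlus θ) 0 + p.1,
      rep (3 * qPlus θ) (slope θ) + p.2, (0 : Cb)) :=
    (contDiff_const.add contDiff_fst).prodMk
      ((contDiff_const.add contDiff_snd).prodMk contDiff_const)
  exact ((riesz.contDiff.comp ((contDiff_bulkDeriv₁ θ).comp h)).const_smul (1 / 6 : ℝ)).prodMk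
    ((riesz.contDiff.comp ((contDiff_bulkDeriv₂ θ).comp h)).const_smul (1 / 2 : ℝ))

/-- The planar equations depend on the parameter nonlinearly only through a compact operator. -/
lemma planarEq_eq_nonlin (θ lam : ℝ) (v : MeanZero × MeanZero) :
    planarEq θ (lam, v) = v + lam ^ 2 • nonlin θ (primPair v) := by
  have hs : ∀ (c d : ℝ) (x : MeanZero), c • (d • x) = (c * d) • x :=
    fun c d x => smul_smul c d x
  refine Prod.ext ?_ ?_
  · change v.1 + (lam ^ 2 / 6) • riesz _ = v.1 + lam ^ 2 • ((1 / 6 : ℝ) • riesz _)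
    rw [hs, mul_one_div]
    rfl
  · change v.2 + (lam ^ 2 / 2) • riesz _ = v.2 + lam ^ 2 • ((1 / 2 : ℝ) • riesz _)
    rw [hs, mul_one_div]
    rfl

/-- Solutions with bounded `λ` are precompact. -/
lemma exists_tendsto_of_planarEq (θ : ℝ) (u : ℕ → ℝ) (v : ℕ → MeanZero × MeanZero) (l : ℝ)
    (hu : ∀ n, 0 < u n) (hul : Tendsto u atTop (𝓝 l)) (hv : ∀ n, planarEq θ (u n, v n) = 0) :
    ∃ (s : ℕ → ℕ) (w : MeanZero × MeanZero), StrictMono s ∧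
      Tendsto (fun n => v (s n)) atTop (𝓝 w) := by
  obtain ⟨C, hC, hbd⟩ := exists_norm_sq_le θ
  obtain ⟨M, hM⟩ := hul.bddAbove_range
  have hball : ∀ n, v n ∈ Metric.closedBall (0 : MeanZero × MeanZero) √(M ^ 2 * C) := by
    intro n
    have h1 := hbd (u n) ((v n).1, (v n).2, 0) (hu n).ne' (by
      rw [fullEq_planar, hv n]; rfl)
    have h2 : ‖v n‖ ≤ ‖((v n).1, (v n).2, (0 : MeanZero))‖ :=
      norm_prod_le_iff.2 ⟨norm_fst_le ((v n).1, (v n).2, (0 : MeanZero)),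
        (norm_fst_le ((v n).2, (0 : MeanZero))).trans (norm_snd_le ((v n).1, (v n).2, (0 : MeanZero)))⟩
    rw [mem_closedBall_zero_iff]
    refine h2.trans (Real.le_sqrt_of_sq_le (h1.trans ?_))
    have := hM (mem_range_self n)
    have := (hu n).le
    gcongr
  obtain ⟨K, hK, hK'⟩ := isCompactOperator_primPair.image_closedBall_subset_compact √(M ^ 2 * C)
  obtain ⟨y, -, s, hs, hy⟩ := hK.tendsto_subseq fun n => hK' ⟨v n, hball n, rfl⟩
  refine ⟨s, -(l ^ 2 • nonlin θ y), hs, ?_⟩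
  have h1 : ∀ n, v n = -(u n ^ 2 • nonlin θ (primPair (v n))) := fun n => by
    rw [eq_neg_iff_add_eq_zero, ← planarEq_eq_nonlin, hv n]
  have h2 : Tendsto (fun n => -(u (s n) ^ 2 • nonlin θ (primPair (v (s n))))) atTop
      (𝓝 (-(l ^ 2 • nonlin θ y))) :=
    (((hul.comp hs.tendsto_atTop).pow 2).smul
      (((contDiff_nonlin θ).continuous.tendsto y).comp hy)).neg
  exact h2.congr fun n => (h1 (s n)).symm

/-- The linearization of the planar equations is invertible as soon as its kernel is trivial. -/
lemma isInvertible_fderiv_planarEq (θ lam : ℝ) (v : MeanZero × MeanZero)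
    (hinj : ∀ w, fderiv ℝ (planarEq θ) (lam, v) (0, w) = 0 → w = 0) :
    (fderiv ℝ (planarEq θ) (lam, v) ∘L .inr ℝ ℝ (MeanZero × MeanZero)).IsInvertible := by
  set K : MeanZero × MeanZero →L[ℝ] MeanZero × MeanZero :=
    lam ^ 2 • (fderiv ℝ (nonlin θ) (primPair v) ∘L primPair) with hK
  have hd : HasFDerivAt (fun v => planarEq θ (lam, v))
      (ContinuousLinearMap.id ℝ (MeanZero × MeanZero) + K) v := by
    have h1 : HasFDerivAt (nonlin θ) (fderiv ℝ (nonlin θ) (primPair v)) (primPair v) :=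
      ((contDiff_nonlin θ).differentiable (by simp) _).hasFDerivAt
    have h2 := (h1.comp v primPair.hasFDerivAt).const_smul (lam ^ 2)
    have h3 := (hasFDerivAt_id v).add h2
    exact h3.congr_of_eventuallyEq (Eventually.of_forall fun w => planarEq_eq_nonlin θ lam w)
  have hd' : HasFDerivAt (fun v => planarEq θ (lam, v))
      (fderiv ℝ (planarEq θ) (lam, v) ∘L .inr ℝ ℝ (MeanZero × MeanZero)) v :=
    (((contDiff_planarEq θ).differentiable (by simp) (lam, v)).hasFDerivAt).comp v
      (hasFDerivAt_prodMk_right lam v)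
  have he := hd'.unique hd
  rw [he]
  have hc : IsCompactOperator K :=
    (isCompactOperator_primPair.clm_comp (fderiv ℝ (nonlin θ) (primPair v))).smul (lam ^ 2)
  refine isInvertible_id_add hc fun w hw => hinj w ?_
  exact (congrArg (fun L => L w) he).trans hw

/-- For `λ = 0` the equations reduce to `v = 0`. -/
lemma fderiv_fullEq_zero (θ : ℝ) : (fderiv ℝ (fullEq θ) 0 ∘L
    .inr ℝ ℝ (MeanZero × MeanZero × MeanZero)).IsInvertible := by
  have hd : HasFDerivAt (fun v => fullEq θ (0, v))
      (ContinuousLinearMap.id ℝ (MeanZero × MeanZero × MeanZero)) 0 := by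
    refine (hasFDerivAt_id _).congr_of_eventuallyEq (Eventually.of_forall fun v => ?_)
    simp [fullEq]
  have hd' : HasFDerivAt (fun v => fullEq θ (0, v))
      (fderiv ℝ (fullEq θ) 0 ∘L .inr ℝ ℝ (MeanZero × MeanZero × MeanZero)) 0 :=
    (((contDiff_fullEq θ).differentiable (by simp) (0, 0)).hasFDerivAt).comp 0
      (hasFDerivAt_prodMk_right 0 0)
  rw [hd'.unique hd]
  exact ⟨ContinuousLinearEquiv.refl ℝ _, rfl⟩

lemma fderiv_planarEq_zero (θ : ℝ) : (fderiv ℝ (planarEq θ) 0 ∘L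
    .inr ℝ ℝ (MeanZero × MeanZero)).IsInvertible := by
  have hd : HasFDerivAt (fun v => planarEq θ (0, v))
      (ContinuousLinearMap.id ℝ (MeanZero × MeanZero)) 0 := by
    refine (hasFDerivAt_id _).congr_of_eventuallyEq (Eventually.of_forall fun v => ?_)
    simp [planarEq]
  have hd' : HasFDerivAt (fun v => planarEq θ (0, v))
      (fderiv ℝ (planarEq θ) 0 ∘L .inr ℝ ℝ (MeanZero × MeanZero)) 0 :=
    (((contDiff_planarEq θ).differentiable (by simp) (0, 0)).hasFDerivAt).comp 0
      (hasFDerivAt_prodMk_right 0 0)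
  rw [hd'.unique hd]
  exact ⟨ContinuousLinearEquiv.refl ℝ _, rfl⟩

/-- Solutions are unique for small `λ`: by the a priori bound they are small, and near zero the
implicit function theorem applies. -/
lemma exists_unique_fullEq (θ : ℝ) : ∃ δ : ℝ, 0 < δ ∧ ∀ lam ∈ Ioo 0 δ, ∀ v w,
    fullEq θ (lam, v) = 0 → fullEq θ (lam, w) = 0 → v = w := by
  obtain ⟨C, hC, hbd⟩ := exists_norm_sq_le θ
  obtain ⟨ψ, -, -, hψ⟩ := exists_local_branch (contDiff_fullEq θ).contDiffAt
    (by simp [fullEq] : fullEq θ 0 = 0) (fderiv_fullEq_zero θ)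
  obtain ⟨ε, hε, hball⟩ := Metric.eventually_nhds_iff_ball.1 hψ
  obtain ⟨δ, hδ, hδε, hδC⟩ : ∃ δ > 0, δ ≤ ε ∧ δ ^ 2 * C < ε ^ 2 := by
    have : Tendsto (fun δ : ℝ => δ ^ 2 * C) (𝓝[>] 0) (𝓝 0) := by
      have : Tendsto (fun δ : ℝ => δ ^ 2 * C) (𝓝 0) (𝓝 (0 ^ 2 * C)) :=
        Continuous.tendsto (by fun_prop) 0
      rw [zero_pow two_ne_zero, zero_mul] at this
      exact this.mono_left nhdsWithin_le_nhds
    obtain ⟨δ, h1, h2⟩ := ((this.eventually (gt_mem_nhds (by positivity : (0 : ℝ) < ε ^ 2))).and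
      (Ioo_mem_nhdsGT hε)).exists
    exact ⟨δ, h2.1, h2.2.le, h1⟩
  have hmem : ∀ lam ∈ Ioo 0 δ, ∀ v, fullEq θ (lam, v) = 0 → v = ψ lam := by
    intro lam hlam v hv
    have h1 := hbd lam v hlam.1.ne' hv
    have h2 : ‖v‖ < ε := by
      refine lt_of_pow_lt_pow_left₀ 2 hε.le (h1.trans_lt (lt_of_le_of_lt ?_ hδC))
      have := hlam.1.le
      have := hlam.2.le
      gcongr
    have h3 : (lam, v) ∈ Metric.ball (0 : ℝ × MeanZero × MeanZero × MeanZero) ε := by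
      rw [mem_ball_zero_iff, Prod.norm_def]
      refine max_lt ?_ h2
      rw [Real.norm_eq_abs, abs_of_pos hlam.1]
      exact hlam.2.trans_le hδε
    exact ((hball _ h3).1 hv).symm
  exact ⟨δ, hδ, fun lam hlam v w hv hw => (hmem lam hlam v hv).trans (hmem lam hlam w hw).symm⟩

/-! ### First eigenvalues as functions of the potential -/

/-- The infimum of the Rayleigh quotient `a / j`. It is the expected one if `a` is bounded below by a
multiple of `j`; otherwise `sInf` takes its default value. -/
def rayleigh {X : Type*} [Zero X] (a j : X → ℝ) : ℝ := sInf {r | ∃ w, w ≠ 0 ∧ r = a w / j w}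

section Rayleigh

variable {X : Type*} [Zero X] {a a' j : X → ℝ}

lemma rayleigh_mul_le (hj : ∀ w, w ≠ 0 → 0 < j w) {M : ℝ} (ha : ∀ w, -M * j w ≤ a w) {w : X}
    (hw : w ≠ 0) : rayleigh a j * j w ≤ a w := by
  rw [← le_div_iff₀ (hj w hw)]
  refine csInf_le ⟨-M, ?_⟩ ⟨w, hw, rfl⟩
  rintro _ ⟨w, hw, rfl⟩
  rw [le_div_iff₀ (hj w hw)]
  exact ha w

lemma le_rayleigh [Nontrivial X] (hj : ∀ w, w ≠ 0 → 0 < j w) {c : ℝ}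
    (h : ∀ w, w ≠ 0 → c * j w ≤ a w) : c ≤ rayleigh a j := by
  obtain ⟨w, hw⟩ := exists_ne (0 : X)
  refine le_csInf ⟨_, w, hw, rfl⟩ ?_
  rintro _ ⟨w, hw, rfl⟩
  rw [le_div_iff₀ (hj w hw)]
  exact h w hw

lemma rayleigh_sub_le [Nontrivial X] (hj : ∀ w, w ≠ 0 → 0 < j w) {M ε : ℝ}
    (ha : ∀ w, -M * j w ≤ a w) (h : ∀ w, a w - a' w ≤ ε * j w) :
    rayleigh a j - ε ≤ rayleigh a' j := by
  refine le_rayleigh hj fun w hw => ?_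
  have := rayleigh_mul_le hj ha hw
  linarith [h w]

end Rayleigh

lemma abs_cellInt_mul_le (p : Cb) {q : Cb} (hq : ∀ x, 0 ≤ q x) :
    |cellInt (p * q)| ≤ ‖p‖ * cellInt q := by
  have h : ∀ x, |p x * q x| ≤ ‖p‖ * q x := fun x => by
    rw [abs_mul, abs_of_nonneg (hq x)]
    exact mul_le_mul_of_nonneg_right (p.norm_coe_le_norm x) (hq x)
  have e : ‖p‖ * cellInt q = cellInt (‖p‖ • q) := by rw [map_smul, smul_eq_mul]
  rw [e, abs_le, ← map_neg]
  exact ⟨cellInt_mono fun x => (abs_le.1 (h x)).1, cellInt_mono fun x => (abs_le.1 (h x)).2⟩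

/-- The mass `∫ h²` of the `H¹₀` function with derivative `w`. -/
def mass (w : MeanZero) : ℝ := cellInt (primZ w ^ 2)

lemma mass_eq_norm_sq (w : MeanZero) : mass w = ‖toL2 (primZ w)‖ ^ 2 := by
  rw [← real_inner_self_eq_norm_sq, inner_toL2_eq_cellInt, mass, sq]

lemma mass_nonneg (w : MeanZero) : 0 ≤ mass w := by rw [mass_eq_norm_sq]; positivity

lemma mass_pos {w : MeanZero} (hw : w ≠ 0) : 0 < mass w := by
  rw [mass_eq_norm_sq]
  have : toL2 (primZ w) ≠ 0 := fun h => hw (Subtype.ext (eq_zero_of_toL2_prim_eq_zero h))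
  positivity

/-- The Poincaré inequality, with a constant that is not optimal. -/
lemma mass_le (w : MeanZero) : mass w ≤ 8 * ‖w‖ ^ 2 := by
  have h : cellInt (BoundedContinuousFunction.const ℝ (4 * ‖w‖ ^ 2)) = 8 * ‖w‖ ^ 2 := by
    rw [cellInt_const]; ring
  rw [← h]
  refine cellInt_mono fun x => ?_
  have h1 : ‖primZ w x‖ ≤ 2 * ‖w‖ := ((primZ w).norm_coe_le_norm x).trans (norm_prim_le _)
  have h2 : ‖primZ w x‖ ^ 2 ≤ (2 * ‖w‖) ^ 2 := by gcongr
  rw [Real.norm_eq_abs, sq_abs] at h2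
  calc primZ w x ^ 2 ≤ (2 * ‖w‖) ^ 2 := h2
    _ = 4 * ‖w‖ ^ 2 := by ring

instance : Nontrivial MeanZero := by
  -- The function `x`, written as the difference of the primitive of `1` and the constant `1`.
  set o : Cb := BoundedContinuousFunction.const ℝ 1 with ho
  have h1 : prim (toL2 o) 1 = 2 := by
    rw [prim_congr (coeFn_toL2 o) (by simp)]
    simp [ho]
    norm_num
  have h2 := inner_prim_add_inner_prim (toL2 o) (toL2 o)
  rw [h1, inner_toL2_eq_cellInt] at h2
  have h3 : prim (toL2 o) * o = prim (toL2 o) := by ext x; simp [ho]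
  rw [h3] at h2
  have hm : toL2 (prim (toL2 o) - o) ∈ MeanZero := by
    rw [mem_meanZero, ← one_mul (prim (toL2 (prim (toL2 o) - o)) 1), ← inner_toL2_const, ← ho,
      inner_toL2_eq_cellInt]
    have h4 : o * (prim (toL2 o) - o) = prim (toL2 o) - o := by ext x; simp [ho]
    rw [h4, map_sub, ho, cellInt_const, ← ho]
    linarith
  refine ⟨⟨⟨_, hm⟩, 0, fun h => ?_⟩⟩
  have h4 : toL2 (prim (toL2 o) - o) = 0 := congrArg Subtype.val h
  have h5 := coeFn_toL2 (prim (toL2 o) - o)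
  rw [h4] at h5
  have h6 := eqOn_of_ae_eq (prim (toL2 o) - o).continuous continuous_zero
    (h5.symm.trans (Lp.coeFn_zero ℝ 2 cellMeasure))
  have h7 := h6 (by simp : (-1 : ℝ) ∈ Icc (-1 : ℝ) 1)
  simp [ho] at h7

/-- The quadratic form `∫ h'² + p h²` on `H¹₀`. -/
def scalarQuad (p : Cb) (w : MeanZero) : ℝ := ‖w‖ ^ 2 + cellInt (p * primZ w ^ 2)

/-- The first Dirichlet eigenvalue of `-h'' + p h`. -/
def scalarEig (p : Cb) : ℝ := rayleigh (scalarQuad p) mass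

lemma sq_apply_nonneg (a : Cb) (x : ℝ) : 0 ≤ (a ^ 2) x := by
  simpa using sq_nonneg (a x)

lemma neg_norm_mul_mass_le (p : Cb) (w : MeanZero) : -‖p‖ * mass w ≤ scalarQuad p w := by
  have := (abs_le.1 (abs_cellInt_mul_le p (sq_apply_nonneg (primZ w)))).1
  have := sq_nonneg ‖w‖
  rw [scalarQuad, mass]
  linarith

lemma scalarEig_mul_mass_le (p : Cb) (w : MeanZero) : scalarEig p * mass w ≤ scalarQuad p w := by
  by_cases hw : w = 0
  · subst hw
    simp [mass, scalarQuad]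
  exact rayleigh_mul_le (fun _ => mass_pos) (neg_norm_mul_mass_le p) hw

lemma scalarEig_sub_le (p p' : Cb) : scalarEig p - ‖p - p'‖ ≤ scalarEig p' := by
  refine rayleigh_sub_le (fun _ => mass_pos) (neg_norm_mul_mass_le p) fun w => ?_
  have := (abs_le.1 (abs_cellInt_mul_le (p - p') (sq_apply_nonneg (primZ w)))).2
  rw [sub_mul, map_sub] at this
  rw [scalarQuad, scalarQuad, mass]
  linarith

lemma continuous_scalarEig : Continuous scalarEig := by
  refine LipschitzWith.continuous (K := 1) (LipschitzWith.of_le_add fun p p' => ?_)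
  rw [dist_eq_norm]
  linarith [scalarEig_sub_le p p']

/-- The quadratic form `∫ 3 h₁'² + h₂'² + p₁₁ h₁² + 2 p₁₂ h₁ h₂ + p₂₂ h₂²` on pairs of `H¹₀`
functions. -/
def planarQuad (p : Cb × Cb × Cb) (w : MeanZero × MeanZero) : ℝ :=
  3 * ‖w.1‖ ^ 2 + ‖w.2‖ ^ 2 + cellInt (p.1 * primZ w.1 ^ 2
    + (2 : ℝ) • (p.2.1 * (primZ w.1 * primZ w.2)) + p.2.2 * primZ w.2 ^ 2)

/-- The mass `∫ h₁² + h₂²`. -/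
def planarMass (w : MeanZero × MeanZero) : ℝ := mass w.1 + mass w.2

/-- The first Dirichlet eigenvalue of the system with potential `p`. -/
def planarEig (p : Cb × Cb × Cb) : ℝ := rayleigh (planarQuad p) planarMass

lemma planarMass_pos (w : MeanZero × MeanZero) (hw : w ≠ 0) : 0 < planarMass w := by
  have h1 := mass_nonneg w.1
  have h2 := mass_nonneg w.2
  rw [planarMass]
  by_cases h : w.1 = 0
  · have : w.2 ≠ 0 := fun h' => hw (Prod.ext h h')
    linarith [mass_pos this]
  · linarith [mass_pos h]

lemma abs_potential_le (p : Cb × Cb × Cb) (w : MeanZero × MeanZero) :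
    |cellInt (p.1 * primZ w.1 ^ 2 + (2 : ℝ) • (p.2.1 * (primZ w.1 * primZ w.2))
      + p.2.2 * primZ w.2 ^ 2)| ≤ 2 * ‖p‖ * planarMass w := by
  have e : 2 * ‖p‖ * planarMass w =
      cellInt ((2 * ‖p‖) • (primZ w.1 ^ 2 + primZ w.2 ^ 2)) := by
    rw [map_smul, map_add, planarMass, mass, mass, smul_eq_mul]
  have h : ∀ x, |(p.1 * primZ w.1 ^ 2 + (2 : ℝ) • (p.2.1 * (primZ w.1 * primZ w.2))
      + p.2.2 * primZ w.2 ^ 2) x| ≤ ((2 * ‖p‖) • (primZ w.1 ^ 2 + primZ w.2 ^ 2)) x := by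
    intro x
    have h1 : |p.1 x| ≤ ‖p‖ := (p.1.norm_coe_le_norm x).trans (norm_fst_le p)
    have h2 : |p.2.1 x| ≤ ‖p‖ :=
      (p.2.1.norm_coe_le_norm x).trans ((norm_fst_le p.2).trans (norm_snd_le p))
    have h3 : |p.2.2 x| ≤ ‖p‖ :=
      (p.2.2.norm_coe_le_norm x).trans ((norm_snd_le p.2).trans (norm_snd_le p))
    simp only [BoundedContinuousFunction.coe_add, BoundedContinuousFunction.coe_mul,
      BoundedContinuousFunction.coe_smul, BoundedContinuousFunction.coe_pow, Pi.add_apply,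
      Pi.mul_apply, Pi.pow_apply, smul_eq_mul]
    generalize primZ w.1 x = k at *
    generalize primZ w.2 x = l at *
    have b1 : |p.1 x * k ^ 2| ≤ ‖p‖ * k ^ 2 := by
      rw [abs_mul, abs_of_nonneg (sq_nonneg k)]; gcongr
    have b2 : |2 * (p.2.1 x * (k * l))| ≤ ‖p‖ * (k ^ 2 + l ^ 2) := by
      have : |2 * (k * l)| ≤ k ^ 2 + l ^ 2 :=
        abs_le.2 ⟨by nlinarith [sq_nonneg (k + l)], by nlinarith [sq_nonneg (k - l)]⟩
      rw [mul_left_comm, abs_mul]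
      gcongr
    have b3 : |p.2.2 x * l ^ 2| ≤ ‖p‖ * l ^ 2 := by
      rw [abs_mul, abs_of_nonneg (sq_nonneg l)]; gcongr
    refine (abs_add_three _ _ _).trans ?_
    linarith
  rw [e, abs_le, ← map_neg]
  exact ⟨cellInt_mono fun x => (abs_le.1 (h x)).1, cellInt_mono fun x => (abs_le.1 (h x)).2⟩

lemma neg_norm_mul_planarMass_le (p : Cb × Cb × Cb) (w : MeanZero × MeanZero) :
    -(2 * ‖p‖) * planarMass w ≤ planarQuad p w := by
  have := (abs_le.1 (abs_potential_le p w)).1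
  have := sq_nonneg ‖w.1‖
  have := sq_nonneg ‖w.2‖
  rw [planarQuad]
  linarith

lemma planarEig_mul_le (p : Cb × Cb × Cb) {w : MeanZero × MeanZero} (hw : w ≠ 0) :
    planarEig p * planarMass w ≤ planarQuad p w :=
  rayleigh_mul_le planarMass_pos (neg_norm_mul_planarMass_le p) hw

lemma planarEig_sub_le (p p' : Cb × Cb × Cb) : planarEig p - 2 * ‖p - p'‖ ≤ planarEig p' := by
  refine rayleigh_sub_le planarMass_pos (neg_norm_mul_planarMass_le p) fun w => ?_
  have h := (abs_le.1 (abs_potential_le (p - p') w)).2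
  have e : (p - p').1 * primZ w.1 ^ 2 + (2 : ℝ) • ((p - p').2.1 * (primZ w.1 * primZ w.2))
      + (p - p').2.2 * primZ w.2 ^ 2 =
      (p.1 * primZ w.1 ^ 2 + (2 : ℝ) • (p.2.1 * (primZ w.1 * primZ w.2)) + p.2.2 * primZ w.2 ^ 2)
      - (p'.1 * primZ w.1 ^ 2 + (2 : ℝ) • (p'.2.1 * (primZ w.1 * primZ w.2))
        + p'.2.2 * primZ w.2 ^ 2) := by
    simp only [Prod.fst_sub, Prod.snd_sub, sub_mul, smul_sub]
    abel
  rw [e, map_sub] at h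
  rw [planarQuad, planarQuad]
  linarith

lemma continuous_planarEig : Continuous planarEig := by
  refine LipschitzWith.continuous (K := 2) (LipschitzWith.of_le_add_mul 2 fun p p' => ?_)
  rw [dist_eq_norm]
  have := planarEig_sub_le p p'
  push_cast
  linarith

lemma planarEig_zero_pos : 0 < planarEig 0 := by
  refine lt_of_lt_of_le (by norm_num : (0 : ℝ) < 1 / 8) (le_rayleigh planarMass_pos fun w _ => ?_)
  have h1 := mass_le w.1
  have h2 := mass_le w.2
  have := sq_nonneg ‖w.1‖
  rw [planarQuad, planarMass]
  simp only [Prod.fst_zero, Prod.snd_zero, zero_mul, smul_zero, add_zero, map_zero]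
  linarith

/-! ### The stability functionals in terms of first eigenvalues -/

/-- The second derivatives of the bulk energy density in the directions of `q₁` and `q₂`. -/
def hessPlanar (θ : ℝ) (v : MeanZero × MeanZero) : Cb × Cb × Cb :=
  (BoundedContinuousFunction.const ℝ (2 * θ) + (24 : ℝ) • field₁ θ v.1
      + (54 : ℝ) • field₁ θ v.1 ^ 2 + (6 : ℝ) • field₂ θ v.2 ^ 2,
    (12 : ℝ) • (field₁ θ v.1 * field₂ θ v.2) - (8 : ℝ) • field₂ θ v.2,
    BoundedContinuousFunction.const ℝ (2 * θ / 3) - (8 : ℝ) • field₁ θ v.1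
      + (6 : ℝ) • field₁ θ v.1 ^ 2 + (6 : ℝ) • field₂ θ v.2 ^ 2)

/-- The second derivative of the bulk energy density in the direction of `q₃`. -/
def hessScalar (θ : ℝ) (v : MeanZero × MeanZero) : Cb :=
  BoundedContinuousFunction.const ℝ (2 * θ / 3) - (8 : ℝ) • field₁ θ v.1
    + (6 : ℝ) • field₁ θ v.1 ^ 2 + (2 : ℝ) • field₂ θ v.2 ^ 2

lemma contDiff_hessScalar (θ : ℝ) : ContDiff ℝ ∞ (hessScalar θ) := by
  have h1 : ContDiff ℝ ∞ fun v : MeanZero × MeanZero => field₁ θ v.1 :=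
    (contDiff_field₁ θ).comp contDiff_fst
  have h2 : ContDiff ℝ ∞ fun v : MeanZero × MeanZero => field₂ θ v.2 :=
    (contDiff_field₂ θ).comp contDiff_snd
  exact ((contDiff_const.sub (h1.const_smul (8 : ℝ))).add ((h1.pow 2).const_smul (6 : ℝ))).add
    ((h2.pow 2).const_smul (2 : ℝ))

lemma continuous_hessPlanar (θ : ℝ) : Continuous (hessPlanar θ) := by
  have h1 : Continuous fun v : MeanZero × MeanZero => field₁ θ v.1 :=
    (contDiff_field₁ θ).continuous.comp continuous_fst
  have h2 : Continuous fun v : MeanZero × MeanZero => field₂ θ v.2 :=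
    (contDiff_field₂ θ).continuous.comp continuous_snd
  unfold hessPlanar
  fun_prop

lemma bulkHess_planar (θ : ℝ) (v : MeanZero × MeanZero) (k l : Cb) :
    bulkHess θ (field₁ θ v.1) (field₂ θ v.2) 0 k l 0 = (hessPlanar θ v).1 * k ^ 2
      + (2 : ℝ) • ((hessPlanar θ v).2.1 * (k * l)) + (hessPlanar θ v).2.2 * l ^ 2 := by
  ext x
  simp only [bulkHess, hessPlanar, BoundedContinuousFunction.coe_add,
    BoundedContinuousFunction.coe_sub, BoundedContinuousFunction.coe_mul,
    BoundedContinuousFunction.coe_smul, BoundedContinuousFunction.coe_pow,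
    BoundedContinuousFunction.coe_zero, Pi.zero_apply, Pi.add_apply, Pi.sub_apply, Pi.mul_apply,
    Pi.pow_apply, smul_eq_mul, BoundedContinuousFunction.const_apply]
  ring

lemma bulkHess_scalar (θ : ℝ) (v : MeanZero × MeanZero) (m : Cb) :
    bulkHess θ (field₁ θ v.1) (field₂ θ v.2) 0 0 0 m = hessScalar θ v * m ^ 2 := by
  ext x
  simp only [bulkHess, hessScalar, BoundedContinuousFunction.coe_add,
    BoundedContinuousFunction.coe_sub, BoundedContinuousFunction.coe_mul,
    BoundedContinuousFunction.coe_smul, BoundedContinuousFunction.coe_pow,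
    BoundedContinuousFunction.coe_zero, Pi.zero_apply, Pi.add_apply, Pi.sub_apply, Pi.mul_apply,
    Pi.pow_apply, smul_eq_mul, BoundedContinuousFunction.const_apply]
  ring

lemma secondVariation_planarConf (θ lam : ℝ) (v : MeanZero × MeanZero) (w₁ w₂ w₃ : MeanZero) :
    secondVariation θ lam (planarConf θ v) (H1.mk 0 w₁, H1.mk 0 w₂, H1.mk 0 w₃) =
      2 / lam ^ 2 * (3 * ‖w₁‖ ^ 2 + ‖w₂‖ ^ 2 + ‖w₃‖ ^ 2)
        + cellInt (bulkHess θ (field₁ θ v.1) (field₂ θ v.2) 0 (primZ w₁) (primZ w₂) (primZ w₃)) := by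
  have h := secondVariation_mk θ lam (qPlus θ) (3 * qPlus θ) 0 0 0 0 v.1 (slope θ + v.2) 0 w₁ w₂ w₃
  rw [rep_eq_field₁, rep_eq_field₂, rep_zero, rep_zero, rep_zero, rep_zero, map_zero,
    ← primZ_apply, ← primZ_apply, ← primZ_apply] at h
  exact h

lemma sInf_const_mul {c : ℝ} (hc : 0 ≤ c) {X : Type*} [Zero X] (a j : X → ℝ) :
    sInf {r | ∃ w, w ≠ 0 ∧ r = c * (a w / j w)} = c * rayleigh a j := by
  rw [rayleigh, ← smul_eq_mul, ← Real.sInf_smul_of_nonneg hc]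
  congr 1
  ext r
  simp only [mem_smul_set, Set.mem_ofPred_eq, smul_eq_mul]
  constructor
  · rintro ⟨w, hw, rfl⟩
    exact ⟨_, ⟨w, hw, rfl⟩, rfl⟩
  · rintro ⟨_, ⟨w, hw, rfl⟩, rfl⟩
    exact ⟨w, hw, rfl⟩

lemma integral_fn_sq (w₁ w₂ : MeanZero) :
    ∫ x, (fn (H1.mk 0 w₁) x ^ 2 + fn (H1.mk 0 w₂) x ^ 2) ∂cellMeasure = planarMass (w₁, w₂) := by
  rw [planarMass, mass, mass, ← map_add, cellInt_apply]
  refine integral_congr_ae ?_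
  filter_upwards [fn_mk 0 (w₁ : L2), fn_mk 0 (w₂ : L2)] with x h1 h2
  rw [h1, h2, rep_zero, rep_zero]
  rfl

lemma integral_fn_sq' (w : MeanZero) : ∫ x, fn (H1.mk 0 w) x ^ 2 ∂cellMeasure = mass w := by
  rw [mass, cellInt_apply]
  refine integral_congr_ae ?_
  filter_upwards [fn_mk 0 (w : L2)] with x h1
  rw [h1, rep_zero]
  rfl

/-- The functional `ν` in terms of the first eigenvalue of a system with potential `λ² D²f / 2`. -/
lemma nu_planarConf (θ : ℝ) {lam : ℝ} (hlam : 0 < lam) (v : MeanZero × MeanZero) :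
    nu θ lam (planarConf θ v) =
      2 / lam ^ 2 * planarEig ((lam ^ 2 / 2) • hessPlanar θ v) := by
  rw [planarEig, ← sInf_const_mul (by positivity), nu]
  congr 1
  ext r
  simp only [Set.mem_ofPred_eq]
  have key : ∀ w₁ w₂ : MeanZero, secondVariation θ lam (planarConf θ v) (H1.mk 0 w₁, H1.mk 0 w₂, 0)
      = 2 / lam ^ 2 * planarQuad ((lam ^ 2 / 2) • hessPlanar θ v) (w₁, w₂) := by
    intro w₁ w₂
    have h := secondVariation_planarConf θ lam v w₁ w₂ 0
    rw [Submodule.coe_zero, H1.mk_zero_zero, map_zero, bulkHess_planar] at h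
    rw [h, planarQuad]
    have e : ((lam ^ 2 / 2) • hessPlanar θ v).1 * primZ w₁ ^ 2
        + (2 : ℝ) • (((lam ^ 2 / 2) • hessPlanar θ v).2.1 * (primZ w₁ * primZ w₂))
        + ((lam ^ 2 / 2) • hessPlanar θ v).2.2 * primZ w₂ ^ 2 = (lam ^ 2 / 2) •
        ((hessPlanar θ v).1 * primZ w₁ ^ 2 + (2 : ℝ) • ((hessPlanar θ v).2.1 * (primZ w₁ * primZ w₂))
        + (hessPlanar θ v).2.2 * primZ w₂ ^ 2) := by
      ext x
      simp
      ring
    simp only [e, map_smul, smul_eq_mul, norm_zero]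
    field_simp
    ring
  constructor
  · rintro ⟨h₁, h₂, hh₁, hh₂, hne, rfl⟩
    obtain ⟨w₁, rfl⟩ := isH10_iff.1 hh₁
    obtain ⟨w₂, rfl⟩ := isH10_iff.1 hh₂
    refine ⟨(w₁, w₂), ?_, ?_⟩
    · intro h
      obtain ⟨rfl, rfl⟩ := Prod.mk.inj h
      simp [H1.mk_zero_zero] at hne
    · rw [key, integral_fn_sq, mul_div_assoc]
  · rintro ⟨⟨w₁, w₂⟩, hne, rfl⟩
    refine ⟨H1.mk 0 w₁, H1.mk 0 w₂, isH10_iff.2 ⟨_, rfl⟩, isH10_iff.2 ⟨_, rfl⟩, ?_, ?_⟩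
    · rw [mk_zero_ne_zero, mk_zero_ne_zero]
      by_contra! h
      exact hne (Prod.ext (Subtype.ext h.1) (Subtype.ext h.2))
    · rw [key, integral_fn_sq, mul_div_assoc]

/-- The functional `μ` in terms of the first eigenvalue of a Schrödinger operator. -/
lemma mu_planarConf (θ : ℝ) {lam : ℝ} (hlam : 0 < lam) (v : MeanZero × MeanZero) :
    mu θ lam (planarConf θ v) =
      2 / lam ^ 2 * scalarEig ((lam ^ 2 / 2) • hessScalar θ v) := by
  rw [scalarEig, ← sInf_const_mul (by positivity), mu]
  congr 1
  ext r
  simp only [Set.mem_ofPred_eq]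
  have key : ∀ w : MeanZero, secondVariation θ lam (planarConf θ v) (0, 0, H1.mk 0 w)
      = 2 / lam ^ 2 * scalarQuad ((lam ^ 2 / 2) • hessScalar θ v) w := by
    intro w
    have h := secondVariation_planarConf θ lam v 0 0 w
    rw [Submodule.coe_zero, H1.mk_zero_zero, map_zero, bulkHess_scalar] at h
    rw [h, scalarQuad, smul_mul_assoc, map_smul, smul_eq_mul, norm_zero]
    field_simp
    ring
  constructor
  · rintro ⟨h₁, hh₁, hne, rfl⟩
    obtain ⟨w, rfl⟩ := isH10_iff.1 hh₁
    refine ⟨w, ?_, ?_⟩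
    · rintro rfl
      exact hne H1.mk_zero_zero
    · rw [key, integral_fn_sq', mul_div_assoc]
  · rintro ⟨w, hne, rfl⟩
    refine ⟨H1.mk 0 w, isH10_iff.2 ⟨_, rfl⟩, ?_, ?_⟩
    · rw [mk_zero_ne_zero]
      exact fun h => hne (Subtype.ext h)
    · rw [key, integral_fn_sq', mul_div_assoc]

/-! ### Perturbation of resolvents -/

lemma eventually_isInvertible {X W : Type*} [NormedAddCommGroup X] [NormedSpace ℝ X]
    [CompleteSpace X] [TopologicalSpace W] {A : W → X →L[ℝ] X} {z : W} (hA : ContinuousAt A z)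
    (hinv : (A z).IsInvertible) : ∀ᶠ w in 𝓝 z, (A w).IsInvertible := by
  obtain ⟨M, hM⟩ := hinv
  have hn : range ((↑) : (X ≃L[ℝ] X) → X →L[ℝ] X) ∈ 𝓝 (A z) := hM ▸ M.nhds
  exact hA hn

section Resolvent

variable {X Z : Type*} [NormedAddCommGroup X] [InnerProductSpace ℝ X] [CompleteSpace X]
  [NormedAddCommGroup Z] [NormedSpace ℝ Z]

lemma contDiffAt_inverse_apply {A : Z → X →L[ℝ] X} {z : Z} (hA : ContDiffAt ℝ ∞ A z)
    (hinv : (A z).IsInvertible) (e : X) : ContDiffAt ℝ ∞ (fun w => (A w).inverse e) z := by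
  have h1 : ContDiffAt ℝ ∞ (ContinuousLinearMap.inverse ∘ A) z :=
    ContDiffAt.comp z hinv.contDiffAt_map_inverse hA
  exact h1.clm_apply contDiffAt_const

lemma contDiffAt_inner_inverse {A : Z → X →L[ℝ] X} {z : Z} (hA : ContDiffAt ℝ ∞ A z)
    (hinv : (A z).IsInvertible) (e : X) :
    ContDiffAt ℝ ∞ (fun w => inner ℝ e ((A w).inverse e)) z :=
  contDiffAt_const.inner ℝ (contDiffAt_inverse_apply hA hinv e)

/-- The derivative of a diagonal entry of the resolvent of a symmetric operator. -/
lemma hasDerivAt_inner_inverse {S J : X →L[ℝ] X} (hinv : S.IsInvertible)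
    (hsymm : ∀ x y, inner ℝ (S x) y = inner ℝ x (S y)) (e : X) (m₁ : ℝ) :
    HasDerivAt (fun m : ℝ => inner ℝ e ((S - (m - m₁) • J).inverse e))
      (inner ℝ (J (S.inverse e)) (S.inverse e)) m₁ := by
  set A : ℝ → X →L[ℝ] X := fun m => S - (m - m₁) • J with hA
  have hA₁ : A m₁ = S := by simp [hA]
  have hAs : ContDiff ℝ ∞ A := by fun_prop
  have hAd : HasDerivAt A (-J) m₁ := by
    have h1 := (((hasDerivAt_id m₁).sub_const m₁).smul_const J).const_sub S
    rwa [one_smul] at h1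
  have hinv' : (A m₁).IsInvertible := by rwa [hA₁]
  obtain ⟨γ', hγ'⟩ : ∃ γ', HasDerivAt (fun m => (A m).inverse e) γ' m₁ :=
    ⟨_, ((contDiffAt_inverse_apply hAs.contDiffAt hinv' e).differentiableAt (by simp)).hasDerivAt⟩
  have hev : ∀ᶠ m in 𝓝 m₁, A m ((A m).inverse e) = e := by
    filter_upwards [eventually_isInvertible hAs.continuous.continuousAt hinv'] with m hm
    obtain ⟨N, hN⟩ := hm
    rw [← hN]
    simp
  have hx₁ : S (S.inverse e) = e := by
    have := hev.self_of_nhds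
    rwa [hA₁] at this
  have hprod := (hAd.clm_apply hγ').unique
    ((hasDerivAt_const m₁ e).congr_of_eventuallyEq hev)
  rw [hA₁] at hprod
  have hrel : S γ' = J (S.inverse e) := by
    rw [_root_.neg_apply, neg_add_eq_zero] at hprod
    exact hprod.symm
  have h1 := (innerSL ℝ e).hasFDerivAt.comp_hasDerivAt m₁ hγ'
  have h2 : inner ℝ (J (S.inverse e)) (S.inverse e) = innerSL ℝ e γ' := by
    rw [innerSL_apply_apply, ← hrel, real_inner_comm, ← hsymm, hx₁]
  rw [h2]
  exact h1

end Resolvent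

/-! ### Smooth dependence of the first eigenvalue on the potential -/

/-- The Schrödinger operator `-h'' + p h` on `H¹₀`, in the weak form given by the Dirichlet inner
product. -/
def schrodinger (p : Cb) : MeanZero →L[ℝ] MeanZero :=
  ContinuousLinearMap.id ℝ MeanZero + riesz ∘L (ContinuousLinearMap.mul ℝ Cb p) ∘L primZ

lemma schrodinger_apply (p : Cb) (h : MeanZero) :
    schrodinger p h = h + riesz (p * primZ h) := rfl

lemma inner_schrodinger (p : Cb) (h k : MeanZero) :
    inner ℝ (schrodinger p h) k = inner ℝ h k + cellInt (p * primZ h * primZ k) := by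
  rw [schrodinger_apply, ← inner_riesz]
  exact inner_add_left h (riesz (p * primZ h)) k

lemma inner_schrodinger_comm (p : Cb) (h k : MeanZero) :
    inner ℝ (schrodinger p h) k = inner ℝ h (schrodinger p k) := by
  rw [real_inner_comm (schrodinger p k) h, inner_schrodinger, inner_schrodinger,
    real_inner_comm h k, mul_right_comm]

lemma inner_schrodinger_self (p : Cb) (h : MeanZero) :
    inner ℝ (schrodinger p h) h = scalarQuad p h := by
  rw [inner_schrodinger, scalarQuad, mul_assoc, ← sq]
  congr 1
  exact real_inner_self_eq_norm_sq h

lemma isCompactOperator_riesz_mul_primZ (L : Cb →L[ℝ] MeanZero) :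
    IsCompactOperator (L ∘L primZ) := isCompactOperator_primZ.clm_comp L

/-- A nonnegative symmetric operator controls its values by its quadratic form. -/
lemma exists_norm_sq_apply_le {X : Type*} [NormedAddCommGroup X] [InnerProductSpace ℝ X]
    (T : X →L[ℝ] X) (hs : ∀ h k, inner ℝ (T h) k = inner ℝ h (T k))
    (hT : ∀ h, 0 ≤ inner ℝ (T h) h) :
    ∃ s : ℝ, 0 < s ∧ ∀ h, s * ‖T h‖ ^ 2 ≤ inner ℝ (T h) h := by
  set s : ℝ := (‖T‖ + 1)⁻¹ with hs'
  have hs0 : 0 < s := by positivity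
  have hs1 : s * ‖T‖ ≤ 1 := by
    rw [hs', inv_mul_le_iff₀ (by positivity)]
    linarith
  refine ⟨s, hs0, fun h => ?_⟩
  -- Nonnegativity of the form at `h - s T h`, the Cauchy–Schwarz argument.
  have h1 := hT (h - s • T h)
  have h2 : inner ℝ (T (T h)) (T h) ≤ ‖T‖ * ‖T h‖ ^ 2 := by
    refine (real_inner_le_norm _ _).trans ?_
    rw [sq, ← mul_assoc]
    gcongr
    exact T.le_opNorm _
  have h3 : inner ℝ (T (h - s • T h)) (h - s • T h) = inner ℝ (T h) h - 2 * s * ‖T h‖ ^ 2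
      + s ^ 2 * inner ℝ (T (T h)) (T h) := by
    rw [map_sub, map_smul, inner_sub_left, inner_sub_right, inner_sub_right, real_inner_smul_left,
      real_inner_smul_left, real_inner_smul_right, real_inner_smul_right, hs (T h) h,
      real_inner_self_eq_norm_sq]
    ring
  have h4 : s ^ 2 * inner ℝ (T (T h)) (T h) ≤ s * ‖T h‖ ^ 2 := by
    calc s ^ 2 * inner ℝ (T (T h)) (T h) ≤ s ^ 2 * (‖T‖ * ‖T h‖ ^ 2) := by gcongr
      _ = (s * ‖T‖) * (s * ‖T h‖ ^ 2) := by ring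
      _ ≤ 1 * (s * ‖T h‖ ^ 2) := by gcongr
      _ = s * ‖T h‖ ^ 2 := one_mul _
  rw [h3] at h1
  linarith

/-- Invertible operators are bounded below. -/
lemma exists_norm_le_mul_of_isInvertible {X : Type*} [NormedAddCommGroup X] [NormedSpace ℝ X] {T : X →L[ℝ] X}
    (hT : T.IsInvertible) : ∃ M : ℝ, 0 < M ∧ ∀ h, ‖h‖ ≤ M * ‖T h‖ := by
  obtain ⟨e, rfl⟩ := hT
  refine ⟨‖(e.symm : X →L[ℝ] X)‖ + 1, by positivity, fun h => ?_⟩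
  have := (e.symm : X →L[ℝ] X).le_opNorm (e h)
  simp only [ContinuousLinearEquiv.coe_coe, ContinuousLinearEquiv.symm_apply_apply] at this ⊢
  linarith [norm_nonneg (e h)]

lemma scalarQuad_sub_const (p : Cb) (m : ℝ) (h : MeanZero) :
    scalarQuad (p - BoundedContinuousFunction.const ℝ m) h = scalarQuad p h - m * mass h := by
  have e : BoundedContinuousFunction.const ℝ m * primZ h ^ 2 = m • primZ h ^ 2 := by
    ext x; simp
  rw [scalarQuad, scalarQuad, mass, sub_mul, map_sub, e, map_smul, smul_eq_mul]
  ring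

lemma scalarQuad_sub_scalarEig_nonneg (p : Cb) (h : MeanZero) :
    0 ≤ scalarQuad (p - BoundedContinuousFunction.const ℝ (scalarEig p)) h := by
  rw [scalarQuad_sub_const]
  linarith [scalarEig_mul_mass_le p h]

/-- The infimum of the Rayleigh quotient is attained. -/
lemma exists_eigenfunction (p : Cb) : ∃ h, h ≠ 0 ∧
    schrodinger (p - BoundedContinuousFunction.const ℝ (scalarEig p)) h = 0 := by
  by_contra! hne
  set q := p - BoundedContinuousFunction.const ℝ (scalarEig p) with hq
  have hinv : (schrodinger q).IsInvertible := by
    refine isInvertible_id_add (isCompactOperator_riesz_mul_primZ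
      (riesz ∘L ContinuousLinearMap.mul ℝ Cb q)) fun w hw => ?_
    by_contra h
    exact hne w h hw
  obtain ⟨M, hM, hMb⟩ := exists_norm_le_mul_of_isInvertible hinv
  obtain ⟨s, hs, hsb⟩ := exists_norm_sq_apply_le (schrodinger q) (inner_schrodinger_comm q)
    fun h => by rw [inner_schrodinger_self]; exact scalarQuad_sub_scalarEig_nonneg p h
  -- The quadratic form is coercive, so that the infimum could be increased.
  have hco : ∀ h, s / (8 * M ^ 2) * mass h ≤ scalarQuad q h := by
    intro h
    have h1 := hsb h
    rw [inner_schrodinger_self] at h1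
    have h2 : ‖h‖ ^ 2 ≤ (M * ‖schrodinger q h‖) ^ 2 := pow_le_pow_left₀ (norm_nonneg _) (hMb h) 2
    have h3 := mass_le h
    rw [div_mul_eq_mul_div, div_le_iff₀ (by positivity)]
    calc s * mass h ≤ s * (8 * (M * ‖schrodinger q h‖) ^ 2) := by gcongr; linarith
      _ = (s * ‖schrodinger q h‖ ^ 2) * (8 * M ^ 2) := by ring
      _ ≤ scalarQuad q h * (8 * M ^ 2) := by gcongr
  have : scalarEig p + s / (8 * M ^ 2) ≤ scalarEig p := by
    refine le_rayleigh (fun _ => mass_pos) fun h _ => ?_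
    have := hco h
    rw [hq, scalarQuad_sub_const] at this
    linarith
  have : 0 < s / (8 * M ^ 2) := by positivity
  linarith

/-- The derivative `h` of an element of the kernel is itself a primitive: the weak equation holds
against all functions of mean zero, which leaves an additive constant. -/
lemma exists_eq_rep_of_schrodinger_eq_zero {q : Cb} {h : MeanZero} (hh : schrodinger q h = 0) :
    ∃ c : ℝ, (h : L2) = toL2 (rep c (toL2 (q * primZ h))) := by
  set f : L2 := toL2 (q * primZ h) with hf
  have horth : (h : L2) - toL2 (prim f)
      ∈ (ℝ ∙ toL2 (BoundedContinuousFunction.const ℝ (1 : ℝ)))ᗮᗮ := by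
    rw [Submodule.mem_orthogonal']
    intro k hk
    have h1 := inner_prim_add_inner_prim f k
    have hk1 : prim k 1 = 0 := mem_meanZero.1 hk
    rw [hk1, mul_zero, hf, inner_toL2_eq_cellInt] at h1
    have h2 := inner_schrodinger q h ⟨k, hk⟩
    rw [hh, inner_zero_left, primZ_apply ⟨k, hk⟩, Submodule.coe_inner] at h2
    rw [inner_sub_left, hf]
    rw [mul_comm (prim k)] at h1
    linarith
  rw [Submodule.orthogonal_orthogonal, Submodule.mem_span_singleton] at horth
  obtain ⟨c, hc⟩ := horth
  refine ⟨c, ?_⟩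
  have e : BoundedContinuousFunction.const ℝ c = c • BoundedContinuousFunction.const ℝ (1 : ℝ) := by
    ext x; simp
  rw [rep, map_add, e, map_smul, hc, sub_add_cancel]

/-- Uniqueness for the initial value problem `u'' = q u`, `u(-1) = u'(-1) = 0`. -/
lemma eq_zero_of_eq_rep_zero {q : Cb} {h : MeanZero}
    (hh : (h : L2) = toL2 (rep 0 (toL2 (q * primZ h)))) : h = 0 := by
  set w : Cb := rep 0 (toL2 (q * primZ h)) with hw
  set U : ℝ → ℝ := fun x => ∫ t in (-1)..x, w t with hU
  set W : ℝ → ℝ := fun x => ∫ t in (-1)..x, (q * primZ h) t with hW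
  have hder : ∀ (a : Cb) (x : ℝ), HasDerivAt (fun x => ∫ t in (-1)..x, a t) (a x) x := fun a x =>
    intervalIntegral.integral_hasDerivAt_right (a.continuous.intervalIntegrable _ _)
      (a.continuous.stronglyMeasurableAtFilter _ _) a.continuous.continuousAt
  have hUx : ∀ x ∈ Icc (-1 : ℝ) 1, U x = primZ h x := by
    intro x hx
    rw [primZ_apply, hh]
    exact (prim_congr (coeFn_toL2 w) hx).symm
  have hWx : ∀ x ∈ Icc (-1 : ℝ) 1, W x = w x := by
    intro x hx
    rw [hw, rep_zero]
    exact (prim_congr (coeFn_toL2 _) hx).symm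
  have hzero := norm_le_gronwallBound_of_norm_deriv_right_le (f := fun x => (U x, W x))
    (f' := fun x => (w x, (q * primZ h) x)) (δ := 0) (K := max 1 ‖q‖) (ε := 0) (a := -1) (b := 1)
    (fun x _ => ((hder w x).continuousAt.prodMk (hder (q * primZ h) x).continuousAt).continuousWithinAt)
    (fun x _ => ((hder w x).prodMk (hder (q * primZ h) x)).hasDerivWithinAt)
    (by simp [hU, hW]) (by
      intro x hx
      have hx' := Ico_subset_Icc_self hx
      rw [add_zero, BoundedContinuousFunction.coe_mul, Pi.mul_apply, ← hUx x hx', ← hWx x hx']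
      refine norm_prod_le_iff.2 ⟨?_, ?_⟩
      · calc ‖W x‖ ≤ 1 * ‖(U x, W x)‖ := by
              rw [one_mul]; exact norm_snd_le (U x, W x)
          _ ≤ _ := by gcongr; exact le_max_left _ _
      · rw [norm_mul]
        gcongr
        · exact (q.norm_coe_le_norm x).trans (le_max_right _ _)
        · exact norm_fst_le (U x, W x))
  have hprim : primZ h = 0 := by
    ext x
    rw [primZ_apply, ← prim_projIcc]
    have hx := (projIcc (-1 : ℝ) 1 (by norm_num) x).2
    have h1 := hzero _ hx
    rw [gronwallBound_ε0_δ0] at h1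
    have h2 := congrArg Prod.fst (norm_le_zero_iff.1 h1)
    simp only [Prod.fst_zero] at h2
    rw [← primZ_apply, ← hUx _ hx, h2]
    rfl
  refine Subtype.ext (eq_zero_of_toL2_prim_eq_zero ?_)
  rw [← primZ_apply, hprim, map_zero]

/-- Dirichlet eigenvalues in one dimension are simple. -/
lemma exists_eq_smul_of_schrodinger_eq_zero {q : Cb} {h k : MeanZero} (hh : schrodinger q h = 0)
    (hk : schrodinger q k = 0) (h0 : h ≠ 0) : ∃ c : ℝ, k = c • h := by
  obtain ⟨a, ha⟩ := exists_eq_rep_of_schrodinger_eq_zero hh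
  obtain ⟨b, hb⟩ := exists_eq_rep_of_schrodinger_eq_zero hk
  have ha0 : a ≠ 0 := by
    rintro rfl
    exact h0 (eq_zero_of_eq_rep_zero ha)
  have hz : a • k - b • h = 0 := by
    refine eq_zero_of_eq_rep_zero (q := q) ?_
    have e : rep 0 (toL2 (q * primZ (a • k - b • h))) =
        a • rep b (toL2 (q * primZ k)) - b • rep a (toL2 (q * primZ h)) := by
      ext x
      simp only [map_sub, map_smul, mul_sub, mul_smul_comm, rep_apply,
        BoundedContinuousFunction.coe_sub, BoundedContinuousFunction.coe_smul, Pi.sub_apply,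
        smul_eq_mul]
      ring
    rw [e, map_sub, map_smul, map_smul, ← ha, ← hb]
    rfl
  refine ⟨a⁻¹ * b, ?_⟩
  have h2 : a • k = b • h := sub_eq_zero.1 hz
  have h3 : k = a⁻¹ • (a • k) := (inv_smul_smul₀ ha0 k).symm
  rw [h3, h2]
  exact smul_smul a⁻¹ b h

/-- The Schrödinger operator, augmented by the projection along `h₁` with respect to the mass. If
`h₁` spans the kernel, the augmented operator is invertible. -/
def augmented (h₁ : MeanZero) (q : Cb) : MeanZero →L[ℝ] MeanZero :=
  ContinuousLinearMap.id ℝ MeanZero + (riesz ∘L (ContinuousLinearMap.mul ℝ Cb q)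
    + (cellInt ∘L ContinuousLinearMap.mul ℝ Cb (primZ h₁)).smulRight (riesz (primZ h₁))) ∘L primZ

lemma inner_riesz_primZ (h k : MeanZero) :
    inner ℝ (riesz (primZ h)) k = cellInt (primZ h * primZ k) := inner_riesz _ _

lemma augmented_apply (h₁ : MeanZero) (q : Cb) (x : MeanZero) :
    augmented h₁ q x
      = schrodinger q x + (inner ℝ (riesz (primZ h₁)) x : ℝ) • riesz (primZ h₁) := by
  rw [inner_riesz]
  exact (add_assoc x (riesz (q * primZ x)) (cellInt (primZ h₁ * primZ x) • riesz (primZ h₁))).symm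

lemma contDiff_augmented (h₁ : MeanZero) : ContDiff ℝ ∞ (augmented h₁) := by
  have h1 : ContDiff ℝ ∞ fun q : Cb => ContinuousLinearMap.mul ℝ Cb q := by fun_prop
  exact contDiff_const.add (((contDiff_const.clm_comp h1).add contDiff_const).clm_comp
    contDiff_const)

/-- The characteristic function of the eigenvalue problem near an eigenfunction `h₁`: as long as the
augmented operator is invertible, it vanishes exactly if the Schrödinger operator has a kernel. -/
def charFn (h₁ : MeanZero) (q : Cb) : ℝ :=
  1 - inner ℝ (riesz (primZ h₁)) ((augmented h₁ q).inverse (riesz (primZ h₁)))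

lemma charFn_eq_zero {h₁ : MeanZero} {q : Cb} (hinv : (augmented h₁ q).IsInvertible) {x : MeanZero}
    (hx : x ≠ 0) (hker : schrodinger q x = 0) : charFn h₁ q = 0 := by
  set e := riesz (primZ h₁) with he
  set c : ℝ := inner ℝ e x with hc
  have h1 : augmented h₁ q x = c • e := by rw [augmented_apply, hker, zero_add]
  have h2 : x = c • (augmented h₁ q).inverse e := by
    have h3 : (augmented h₁ q).inverse (augmented h₁ q x) = x := by
      obtain ⟨M, hM⟩ := hinv
      rw [← hM]
      simp
    rw [← h3, h1]
    exact map_smul _ c e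
  have hc0 : c ≠ 0 := by
    intro h
    rw [h] at h2
    exact hx (h2.trans (zero_smul ℝ _))
  have h3 : c = c * inner ℝ e ((augmented h₁ q).inverse e) := by
    conv_lhs => rw [hc, h2]
    exact real_inner_smul_right e _ c
  have h4 : inner ℝ e ((augmented h₁ q).inverse e) = 1 := by
    have := mul_left_cancel₀ hc0 ((mul_one c).trans h3)
    exact this.symm
  rw [charFn, ← he, h4, sub_self]

lemma inner_augmented_comm (h₁ : MeanZero) (q : Cb) (x y : MeanZero) :
    inner ℝ (augmented h₁ q x) y = inner ℝ x (augmented h₁ q y) := by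
  rw [augmented_apply, augmented_apply]
  set e := riesz (primZ h₁)
  have e1 : inner ℝ (schrodinger q x + (inner ℝ e x : ℝ) • e) y
      = inner ℝ (schrodinger q x) y + inner ℝ e x * inner ℝ e y := by
    rw [← real_inner_smul_left e y]
    exact inner_add_left _ _ _
  have e2 : inner ℝ x (schrodinger q y + (inner ℝ e y : ℝ) • e)
      = inner ℝ x (schrodinger q y) + inner ℝ e y * inner ℝ x e := by
    rw [← real_inner_smul_right x e]
    exact inner_add_right _ _ _
  rw [e1, e2, inner_schrodinger_comm, real_inner_comm x e]
  ring

section Eigenfunction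

variable {p : Cb} {h₁ : MeanZero} (h0 : h₁ ≠ 0)
  (hker : schrodinger (p - BoundedContinuousFunction.const ℝ (scalarEig p)) h₁ = 0)
include h0 hker

/-- In the kernel of the augmented operator both the nonnegative Schrödinger form and the projection
along `h₁` vanish, which leaves only zero since the eigenvalue is simple. -/
lemma isInvertible_augmented :
    (augmented h₁ (p - BoundedContinuousFunction.const ℝ (scalarEig p))).IsInvertible := by
  set q := p - BoundedContinuousFunction.const ℝ (scalarEig p) with hq
  set e := riesz (primZ h₁) with he
  refine isInvertible_id_add (isCompactOperator_riesz_mul_primZ _) fun x hx => ?_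
  have hx' : augmented h₁ q x = 0 := hx
  rw [augmented_apply, ← he] at hx'
  have h1 : scalarQuad q x + inner ℝ e x * inner ℝ e x = 0 := by
    rw [← inner_schrodinger_self, ← real_inner_smul_left e x]
    refine (inner_add_left (schrodinger q x) ((inner ℝ e x : ℝ) • e) x).symm.trans ?_
    rw [hx', inner_zero_left]
  have h2 := scalarQuad_sub_scalarEig_nonneg p x
  have h3 := mul_self_nonneg (inner ℝ e x : ℝ)
  have h4 : inner ℝ e x = (0 : ℝ) := mul_self_eq_zero.1 (by linarith)
  rw [h4] at hx'
  have h5 : schrodinger q x = 0 := by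
    have := hx'
    have hz : (0 : ℝ) • e = 0 := zero_smul ℝ e
    rwa [hz, add_zero] at this
  obtain ⟨c, rfl⟩ := exists_eq_smul_of_schrodinger_eq_zero hker h5 h0
  have h6 : c * mass h₁ = 0 := by
    have : inner ℝ e (c • h₁) = c * inner ℝ e h₁ := real_inner_smul_right e h₁ c
    rw [mass, sq, ← inner_riesz, ← he, ← this, h4]
  have hc : c = 0 := (mul_eq_zero.1 h6).resolve_right (mass_pos h0).ne'
  rw [hc]
  exact zero_smul ℝ h₁

/-- The derivative of the characteristic function in the spectral parameter does not vanish: it is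
minus the mass of the eigenfunction that the augmented operator maps to `riesz (primZ h₁)`. -/
lemma hasDerivAt_charFn : ∃ d : ℝ, d ≠ 0 ∧ HasDerivAt
    (fun m => charFn h₁ (p - BoundedContinuousFunction.const ℝ m)) d (scalarEig p) := by
  set m₁ := scalarEig p with hm₁
  set q := p - BoundedContinuousFunction.const ℝ m₁ with hq
  set e := riesz (primZ h₁) with he
  have hinv : (augmented h₁ q).IsInvertible := isInvertible_augmented h0 hker
  set γ := (augmented h₁ q).inverse e with hγ
  have hSm : ∀ m : ℝ, augmented h₁ (p - BoundedContinuousFunction.const ℝ m)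
      = augmented h₁ q - (m - m₁) • (riesz ∘L primZ) := by
    intro m
    ext1 x
    have h1 : (p - BoundedContinuousFunction.const ℝ m) * primZ x
        = q * primZ x - (m - m₁) • primZ x := by
      ext y
      simp [hq]
      ring
    change augmented h₁ _ x = augmented h₁ _ x - (m - m₁) • riesz (primZ x)
    rw [augmented_apply, augmented_apply, schrodinger_apply, schrodinger_apply, h1, map_sub,
      map_smul]
    abel
  have hx₁ : augmented h₁ q γ = e := by
    obtain ⟨M, hM⟩ := hinv
    rw [hγ, ← hM]
    simp
  have hγ0 : γ ≠ 0 := by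
    intro h
    rw [h, map_zero] at hx₁
    have h1 : mass h₁ = 0 := by rw [mass, sq, ← inner_riesz, ← he, ← hx₁, inner_zero_left]
    exact (mass_pos h0).ne' h1
  refine ⟨-mass γ, neg_ne_zero.2 (mass_pos hγ0).ne', ?_⟩
  have h1 := hasDerivAt_inner_inverse (J := riesz ∘L primZ) hinv (inner_augmented_comm h₁ q) e m₁
  have h2 : inner ℝ ((riesz ∘L primZ) γ) γ = mass γ := by
    rw [mass, sq]
    exact inner_riesz_primZ γ γ
  rw [← hγ, h2] at h1
  refine (h1.const_sub 1).congr_of_eventuallyEq (Eventually.of_forall fun m => ?_)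
  change charFn h₁ _ = 1 - inner ℝ e _
  rw [charFn, hSm]

end Eigenfunction

lemma isInvertible_of_apply_one_ne_zero {L : ℝ →L[ℝ] ℝ} (h : L 1 ≠ 0) : L.IsInvertible := by
  refine ⟨ContinuousLinearEquiv.unitsEquivAut ℝ (Units.mk0 _ h), ?_⟩
  ext
  simp

/-- The first Dirichlet eigenvalue depends smoothly on the potential. -/
theorem contDiff_scalarEig : ContDiff ℝ ∞ scalarEig := by
  rw [contDiff_iff_contDiffAt]
  intro p
  obtain ⟨h₁, h0, hker⟩ := exists_eigenfunction p
  have hinv := isInvertible_augmented h0 hker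
  set Γ : Cb × ℝ → ℝ := fun z => charFn h₁ (z.1 - BoundedContinuousFunction.const ℝ z.2) with hΓ
  set A : Cb × ℝ → MeanZero →L[ℝ] MeanZero :=
    fun z => augmented h₁ (z.1 - BoundedContinuousFunction.const ℝ z.2) with hA
  have hAs : ContDiff ℝ ∞ A := by
    have h1 : ContDiff ℝ ∞ fun z : Cb × ℝ => z.1 - BoundedContinuousFunction.const ℝ z.2 := by
      have e : (fun z : Cb × ℝ => z.1 - BoundedContinuousFunction.const ℝ z.2)
          = fun z : Cb × ℝ => z.1 - z.2 • BoundedContinuousFunction.const ℝ (1 : ℝ) := by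
        ext z x; simp
      rw [e]
      exact contDiff_fst.sub (contDiff_snd.smul contDiff_const)
    exact (contDiff_augmented h₁).comp h1
  have hinv₀ : (A (p, scalarEig p)).IsInvertible := hinv
  have hΓs : ContDiffAt ℝ ∞ Γ (p, scalarEig p) :=
    contDiffAt_const.sub (contDiffAt_inner_inverse hAs.contDiffAt hinv₀ (riesz (primZ h₁)))
  have hΓ0 : Γ (p, scalarEig p) = 0 := charFn_eq_zero hinv h0 hker
  have hΓinv : (fderiv ℝ Γ (p, scalarEig p) ∘L .inr ℝ Cb ℝ).IsInvertible := by
    obtain ⟨d, hd, hder⟩ := hasDerivAt_charFn h0 hker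
    refine isInvertible_of_apply_one_ne_zero ?_
    have h1 : HasFDerivAt (fun m => Γ (p, m)) (fderiv ℝ Γ (p, scalarEig p) ∘L .inr ℝ Cb ℝ)
        (scalarEig p) :=
      ((hΓs.differentiableAt (by simp)).hasFDerivAt).comp (scalarEig p)
        (hasFDerivAt_prodMk_right p (scalarEig p))
    rw [h1.hasDerivAt.unique hder]
    exact hd
  obtain ⟨ψ, -, hψ, hev⟩ := exists_local_branch hΓs hΓ0 hΓinv
  refine hψ.congr_of_eventuallyEq ?_
  have hc : Tendsto (fun p' => (p', scalarEig p')) (𝓝 p) (𝓝 (p, scalarEig p)) :=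
    continuousAt_id.prodMk continuous_scalarEig.continuousAt
  have hinv' := eventually_isInvertible hAs.continuous.continuousAt hinv₀
  filter_upwards [hc.eventually hev, hc.eventually hinv'] with p' h1 h2
  obtain ⟨k, hk0, hk⟩ := exists_eigenfunction p'
  exact (h1.1 (charFn_eq_zero h2 hk0 hk)).symm

/-! ### Positivity of `ν` implies nondegeneracy -/

/-- The derivative of the bulk energy density along a line, in the direction of the line, is a
polynomial of degree three whose linear coefficient is the second derivative. -/
lemma bulkDeriv_line (θ : ℝ) (a b k l : Cb) : ∃ B₁ B₃ B₄ : Cb, ∀ t : ℝ,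
    bulkDeriv₁ θ (a + t • k) (b + t • l) 0 * k + bulkDeriv₂ θ (a + t • k) (b + t • l) 0 * l =
      B₁ + t • bulkHess θ a b 0 k l 0 + t ^ 2 • B₃ + t ^ 3 • B₄ := by
  refine ⟨bulkDeriv₁ θ a b 0 * k + bulkDeriv₂ θ a b 0 * l,
    (12 : ℝ) • (k * (k ^ 2 - l ^ 2))
      + (6 : ℝ) • (((3 : ℝ) • (a * k) + b * l) * ((3 : ℝ) • k ^ 2 + l ^ 2)),
    (2 : ℝ) • ((3 : ℝ) • k ^ 2 + l ^ 2) ^ 2, fun t => ?_⟩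
  ext x
  simp only [bulkDeriv₁, bulkDeriv₂, bulkHess, BoundedContinuousFunction.coe_zero, Pi.zero_apply,
    BoundedContinuousFunction.coe_add, BoundedContinuousFunction.coe_sub,
    BoundedContinuousFunction.coe_mul, BoundedContinuousFunction.coe_smul,
    BoundedContinuousFunction.coe_pow, Pi.add_apply, Pi.sub_apply, Pi.mul_apply,
    Pi.pow_apply, smul_eq_mul]
  ring

/-- The form of `D²E` in the planar directions, up to the factor `2 / λ²`, is the form of the
linearized equations. -/
lemma hasDerivAt_planarEq_inner (θ lam : ℝ) (v w : MeanZero × MeanZero) :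
    HasDerivAt (fun t : ℝ => 3 * inner ℝ (planarEq θ (lam, v + t • w)).1 w.1
      + inner ℝ (planarEq θ (lam, v + t • w)).2 w.2)
      (planarQuad ((lam ^ 2 / 2) • hessPlanar θ v) w) 0 := by
  obtain ⟨B₁, B₃, B₄, hB⟩ := bulkDeriv_line θ (field₁ θ v.1) (field₂ θ v.2) (primZ w.1) (primZ w.2)
  have e1 : ∀ t : ℝ, field₁ θ (v.1 + t • w.1) = field₁ θ v.1 + t • primZ w.1 := fun t => by
    rw [field₁, field₁, map_add, map_smul, add_assoc]
  have e2 : ∀ t : ℝ, field₂ θ (v.2 + t • w.2) = field₂ θ v.2 + t • primZ w.2 := fun t => by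
    rw [field₂, field₂, map_add, map_smul, add_assoc]
  have i1 : ∀ (t : ℝ) (a b x : MeanZero),
      inner ℝ (a + t • b + x) b = inner ℝ a b + t * ‖b‖ ^ 2 + inner ℝ x b := fun t a b x => by
    have h1 : inner ℝ (a + t • b + x) b = inner ℝ (a + t • b) b + inner ℝ x b :=
      inner_add_left _ _ _
    have h2 : inner ℝ (a + t • b) b = inner ℝ a b + inner ℝ (t • b) b := inner_add_left _ _ _
    have h3 : inner ℝ (t • b) b = t * inner ℝ b b := real_inner_smul_left b b t
    rw [h1, h2, h3]
    congr 3
    exact real_inner_self_eq_norm_sq b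
  have hquad : planarQuad ((lam ^ 2 / 2) • hessPlanar θ v) w = 3 * ‖w.1‖ ^ 2 + ‖w.2‖ ^ 2
      + lam ^ 2 / 2 * cellInt (bulkHess θ (field₁ θ v.1) (field₂ θ v.2) 0 (primZ w.1) (primZ w.2) 0)
      := by
    rw [planarQuad, bulkHess_planar, ← smul_eq_mul (lam ^ 2 / 2), ← map_smul]
    congr 2
    ext x
    simp
    ring
  have key : (fun t : ℝ => 3 * inner ℝ (planarEq θ (lam, v + t • w)).1 w.1
      + inner ℝ (planarEq θ (lam, v + t • w)).2 w.2) = fun t =>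
      (3 * inner ℝ v.1 w.1 + inner ℝ v.2 w.2 + lam ^ 2 / 2 * cellInt B₁)
        + planarQuad ((lam ^ 2 / 2) • hessPlanar θ v) w * t
        + lam ^ 2 / 2 * cellInt B₃ * t ^ 2 + lam ^ 2 / 2 * cellInt B₄ * t ^ 3 := by
    funext t
    have h := congrArg cellInt (hB t)
    simp only [map_add, map_smul, smul_eq_mul] at h
    simp only [planarEq, Prod.fst_add, Prod.snd_add, Prod.smul_fst, Prod.smul_snd, i1,
      inner_smul_riesz, e1, e2, hquad]
    linear_combination lam ^ 2 / 2 * h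
  rw [key]
  generalize planarQuad _ _ = c
  have hid := hasDerivAt_id (0 : ℝ)
  refine ((((hasDerivAt_const (0 : ℝ) _).add (hid.const_mul c)).add
    ((hid.pow 2).const_mul _)).add ((hid.pow 3).const_mul _)).congr_deriv ?_
  simp

/-- A stable solution is nondegenerate. -/
lemma eq_zero_of_fderiv_planarEq_eq_zero {θ lam : ℝ} {v : MeanZero × MeanZero}
    (hpos : 0 < planarEig ((lam ^ 2 / 2) • hessPlanar θ v)) {w : MeanZero × MeanZero}
    (hw : fderiv ℝ (planarEq θ) (lam, v) (0, w) = 0) : w = 0 := by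
  by_contra hne
  have hline : HasDerivAt (fun t : ℝ => (lam, v + t • w)) ((0 : ℝ), w) 0 := by
    have h1 := ((hasDerivAt_id (0 : ℝ)).smul_const w).const_add v
    rw [one_smul] at h1
    exact (hasDerivAt_const (0 : ℝ) lam).prodMk h1
  have hF : HasFDerivAt (planarEq θ) (fderiv ℝ (planarEq θ) (lam, v)) (lam, v + (0 : ℝ) • w) := by
    rw [zero_smul, add_zero]
    exact ((contDiff_planarEq θ).differentiable (by simp) _).hasFDerivAt
  have hd : HasDerivAt (fun t : ℝ => planarEq θ (lam, v + t • w)) 0 0 := by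
    have := hF.comp_hasDerivAt (0 : ℝ) hline
    rwa [hw] at this
  have hL : HasDerivAt (fun t : ℝ => 3 * inner ℝ (planarEq θ (lam, v + t • w)).1 w.1
      + inner ℝ (planarEq θ (lam, v + t • w)).2 w.2) 0 0 := by
    have h1 : ∀ x : MeanZero × MeanZero, 3 * inner ℝ x.1 w.1 + inner ℝ x.2 w.2
        = ((3 : ℝ) • (innerSL ℝ w.1 ∘L ContinuousLinearMap.fst ℝ MeanZero MeanZero)
          + innerSL ℝ w.2 ∘L ContinuousLinearMap.snd ℝ MeanZero MeanZero) x := fun x => by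
      rw [real_inner_comm, real_inner_comm w.2]
      rfl
    simp only [h1]
    have := (ContinuousLinearMap.hasFDerivAt
      ((3 : ℝ) • (innerSL ℝ w.1 ∘L ContinuousLinearMap.fst ℝ MeanZero MeanZero)
          + innerSL ℝ w.2 ∘L ContinuousLinearMap.snd ℝ MeanZero MeanZero)).comp_hasDerivAt
      (0 : ℝ) hd
    rwa [map_zero] at this
  have h0 := (hasDerivAt_planarEq_inner θ lam v w).unique hL
  have h1 := planarEig_mul_le ((lam ^ 2 / 2) • hessPlanar θ v) hne
  rw [h0] at h1
  exact absurd (mul_pos hpos (planarMass_pos w hne)) (not_lt.2 h1)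

/-! ### The stable branch of eigenvalue exchange solutions -/

/-- The stability functional `ν` in terms of the parameter of the configuration. -/
def planarNu (θ lam : ℝ) (v : MeanZero × MeanZero) : ℝ := nu θ lam (planarConf θ v)

lemma planarNu_pos_iff (θ : ℝ) {lam : ℝ} (hlam : 0 < lam) (v : MeanZero × MeanZero) :
    0 < planarNu θ lam v ↔ 0 < planarEig ((lam ^ 2 / 2) • hessPlanar θ v) := by
  rw [planarNu, nu_planarConf θ hlam]
  exact mul_pos_iff_of_pos_left (by positivity)

lemma continuous_planarEig_hess (θ : ℝ) : Continuous fun z : ℝ × MeanZero × MeanZero =>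
    planarEig ((z.1 ^ 2 / 2) • hessPlanar θ z.2) :=
  continuous_planarEig.comp (((continuous_fst.pow 2).div_const 2).smul
    ((continuous_hessPlanar θ).comp continuous_snd))

lemma continuousAt_planarNu (θ : ℝ) {lam : ℝ} (hlam : 0 < lam) (v : MeanZero × MeanZero) :
    ContinuousAt (fun z : ℝ × MeanZero × MeanZero => planarNu θ z.1 z.2) (lam, v) := by
  have h1 : ContinuousAt (fun z : ℝ × MeanZero × MeanZero =>
      2 / z.1 ^ 2 * planarEig ((z.1 ^ 2 / 2) • hessPlanar θ z.2)) (lam, v) :=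
    (continuousAt_const.div (continuousAt_fst.pow 2) (pow_ne_zero 2 hlam.ne')).mul
      (continuous_planarEig_hess θ).continuousAt
  refine h1.congr ?_
  have h2 : ∀ᶠ z : ℝ × MeanZero × MeanZero in 𝓝 (lam, v), 0 < z.1 :=
    continuousAt_fst.eventually (lt_mem_nhds hlam)
  filter_upwards [h2] with z hz
  exact (nu_planarConf θ hz z.2).symm

/-- For small `λ` the critical point is unique, it has `q₃ = 0`, and it is stable. -/
lemma exists_continuationData (θ : ℝ) : ∃ t₀ : ℝ,
    ContinuationData (planarEq θ) (planarNu θ) t₀ ∧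
    (∀ lam ∈ Ioo 0 t₀, ∀ v w, fullEq θ (lam, v) = 0 → fullEq θ (lam, w) = 0 → v = w) ∧
    ∃ χ, IsStableBranch (planarEq θ) (planarNu θ) t₀ χ := by
  obtain ⟨δ, hδ, huniq⟩ := exists_unique_fullEq θ
  obtain ⟨ψ, hψ0, hψ, hψ'⟩ := exists_local_branch (contDiff_planarEq θ).contDiffAt
    (by simp [planarEq] : planarEq θ 0 = 0) (fderiv_planarEq_zero θ)
  have hψc : ContinuousAt ψ 0 := hψ.continuousAt
  have hpair : Tendsto (fun t => (t, ψ t)) (𝓝 0) (𝓝 (0, 0)) := by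
    have h1 := continuousAt_id.prodMk hψc
    have h2 : ψ 0 = 0 := hψ0
    simpa only [ContinuousAt, h2, id] using h1
  have e1 : ∀ᶠ t in 𝓝 (0 : ℝ), planarEq θ (t, ψ t) = 0 := by
    filter_upwards [hpair.eventually hψ'] with t ht using ht.2 rfl
  have e2 : ∀ᶠ t in 𝓝 (0 : ℝ), 0 < planarEig ((t ^ 2 / 2) • hessPlanar θ (ψ t)) := by
    refine (((continuous_planarEig_hess θ).tendsto (0, 0)).comp hpair).eventually_const_lt ?_
    simpa using planarEig_zero_pos
  have e3 : ∀ᶠ t in 𝓝 (0 : ℝ), ContinuousAt ψ t := by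
    have h1 : ∀ᶠ t in 𝓝 (0 : ℝ), ContDiffAt ℝ 1 ψ t :=
      (hψ.of_le (by exact_mod_cast le_top)).eventually (by simp)
    filter_upwards [h1] with t ht using ht.continuousAt
  obtain ⟨ε, hε, hball⟩ := Metric.eventually_nhds_iff_ball.1 (e1.and (e2.and e3))
  have hsub : ∀ t ∈ Ioo 0 (min δ ε), t ∈ Metric.ball (0 : ℝ) ε := fun t ht => by
    rw [mem_ball_zero_iff, Real.norm_of_nonneg ht.1.le]
    exact ht.2.trans_le (min_le_right _ _)
  have huniq' : ∀ lam ∈ Ioo 0 (min δ ε), ∀ v w, fullEq θ (lam, v) = 0 → fullEq θ (lam, w) = 0 →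
      v = w := fun lam hlam => huniq lam ⟨hlam.1, hlam.2.trans_le (min_le_left _ _)⟩
  refine ⟨min δ ε, ⟨contDiff_planarEq θ, fun t v ht => continuousAt_planarNu θ ht v, ?_,
    fun u v l hu hul hv => exists_tendsto_of_planarEq θ u v l hu hul hv, lt_min hδ hε, ?_⟩,
    huniq', ψ, ?_, ?_⟩
  · intro t v ht _ hpos
    exact isInvertible_fderiv_planarEq θ t v fun w hw =>
      eq_zero_of_fderiv_planarEq_eq_zero ((planarNu_pos_iff θ ht v).1 hpos) hw
  · intro t ht v w hv hw
    have h := huniq' t ht (v.1, v.2, 0) (w.1, w.2, 0) (by rw [fullEq_planar, hv]; rfl)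
      (by rw [fullEq_planar, hw]; rfl)
    exact Prod.ext (congrArg (fun x => x.1) h) (congrArg (fun x => x.2.1) h)
  · rw [interval_coe]
    exact fun t ht => (hball t (hsub t ht)).2.2.continuousWithinAt
  · rw [interval_coe]
    intro t ht
    have := hball t (hsub t ht)
    exact ⟨this.1, (planarNu_pos_iff θ ht.1 _).2 this.2.1⟩

/-- The parameters of a smooth branch of eigenvalue exchange solutions. -/
lemma IsSmoothEEBranch.planarParam {θ : ℝ} {Λ : EReal} {χ : ℝ → Config}
    (h : IsSmoothEEBranch θ Λ χ) :
    ContinuousOn (fun t => planarParam (χ t)) (interval Λ) ∧ ∀ t ∈ interval Λ,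
      planarEq θ (t, NematicCell.planarParam (χ t)) = 0 ∧
      planarConf θ (NematicCell.planarParam (χ t)) = χ t := by
  refine ⟨NematicCell.planarParam.continuous.comp_continuousOn h.1.continuousOn, fun t ht => ?_⟩
  obtain ⟨v, hv, hv0⟩ := (isEESolution_iff ht.1.ne').1 (h.2 t ht)
  rw [hv, planarParam_planarConf]
  exact ⟨hv0, rfl⟩

/-- The endpoint condition of a branch, in terms of the parameters of its configurations. -/
lemma isStabilityEndpoint_iff {θ : ℝ} {Λ : EReal} (hΛ : 0 < Λ) {χ : ℝ → Config}
    {v : ℝ → MeanZero × MeanZero} (h : ∀ t ∈ interval Λ, planarConf θ (v t) = χ t) :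
    IsStabilityEndpoint θ Λ χ ↔
      (∀ t ∈ interval Λ, 0 < planarNu θ t (v t)) ∧ IsDegenerateEnd (planarNu θ) Λ v := by
  have hν : ∀ t ∈ interval Λ, planarNu θ t (v t) = nu θ t (χ t) := fun t ht => by
    rw [planarNu, h t ht]
  refine and_congr (forall₂_congr fun t ht => by rw [hν t ht]) (or_congr Iff.rfl
    (exists_congr fun l => and_congr_right fun hl => ?_))
  subst hl
  have hl0 : 0 < l := by exact_mod_cast hΛ
  refine tendsto_congr' ?_
  filter_upwards [Ioo_mem_nhdsLT hl0] with t ht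
  exact (hν t (by rwa [interval_coe])).symm

lemma contDiffOn_mu {θ : ℝ} {Λ : EReal} {v : ℝ → MeanZero × MeanZero}
    (hv : ContDiffOn ℝ ∞ v (interval Λ)) :
    ContDiffOn ℝ ∞ (fun lam => mu θ lam (planarConf θ (v lam))) (interval Λ) := by
  have h1 : ContDiffOn ℝ ∞ (fun lam : ℝ => (lam ^ 2 / 2) • hessScalar θ (v lam)) (interval Λ) :=
    ((contDiff_id.pow 2).div_const 2).contDiffOn.smul
      ((contDiff_hessScalar θ).comp_contDiffOn hv)
  have h2 : ContDiffOn ℝ ∞ (fun lam : ℝ => 2 / lam ^ 2) (interval Λ) :=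
    contDiffOn_const.div (contDiff_id.pow 2).contDiffOn fun t ht => pow_ne_zero 2 ht.1.ne'
  exact (h2.mul (contDiff_scalarEig.comp_contDiffOn h1)).congr fun t ht => mu_planarConf θ ht.1 _

end NematicCell

end

open NematicCell

theorem mainTheorem8 (θ : ℝ) (hθ : θ < 1) :
    ∃ lam₀ : ℝ, 0 < lam₀ ∧
    ∃ (Λ : EReal) (χ : ℝ → NematicCell.Config),
      (lam₀ : EReal) ≤ Λ ∧
      (∀ lam ∈ Ioo 0 lam₀, ∀ Q : NematicCell.Config,
        NematicCell.IsCriticalPoint θ lam Q ↔ Q = χ lam) ∧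
      NematicCell.IsSmoothEEBranch θ Λ χ ∧
      (∀ χ' : ℝ → NematicCell.Config, NematicCell.IsSmoothEEBranch θ Λ χ' →
        EqOn χ' χ (NematicCell.interval Λ)) ∧
      NematicCell.IsStabilityEndpoint θ Λ χ ∧
      (∀ (Λ' : EReal) (χ' : ℝ → NematicCell.Config), 0 < Λ' →
        NematicCell.IsSmoothEEBranch θ Λ' χ' → NematicCell.IsStabilityEndpoint θ Λ' χ' →
        Λ' = Λ) ∧
      (∀ l : ℝ, Λ = (l : EReal) → ∀ u : ℕ → ℝ, (∀ n, u n ∈ NematicCell.interval Λ) →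
        Tendsto u atTop (𝓝 l) →
        ∃ (s : ℕ → ℕ) (Q : NematicCell.Config), StrictMono s ∧
          Tendsto (fun n => χ (u (s n))) atTop (𝓝 Q) ∧
          NematicCell.IsEESolution θ l Q ∧ NematicCell.nu θ l Q = 0) ∧
      ContDiffOn ℝ ∞ (fun lam => NematicCell.mu θ lam (χ lam)) (NematicCell.interval Λ) := by
  obtain ⟨t₀, D, huniq, hex⟩ := exists_continuationData θ
  obtain ⟨Λ, v, hle, hv, hend, hlim⟩ := D.exists_maximal_branch hex
  have hΛ : 0 < Λ := lt_of_lt_of_le (by exact_mod_cast D.pos) hle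
  have hee : ∀ t ∈ interval Λ, IsEESolution θ t (planarConf θ (v t)) := fun t ht =>
    (isEESolution_iff ht.1.ne').2 ⟨v t, rfl, (hv.2 t ht).1⟩
  refine ⟨t₀, D.pos, Λ, fun t => planarConf θ (v t), hle, ?_,
    ⟨(contDiff_planarConf θ).comp_contDiffOn (D.contDiffOn hv), hee⟩, ?_,
    (isStabilityEndpoint_iff hΛ fun _ _ => rfl).2 ⟨fun t ht => (hv.2 t ht).2, hend⟩, ?_, ?_,
    contDiffOn_mu (D.contDiffOn hv)⟩
  · intro lam hlam Q
    have hm : lam ∈ interval Λ := ⟨hlam.1, (EReal.coe_lt_coe_iff.2 hlam.2).trans_le hle⟩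
    refine ⟨fun hQ => ?_, ?_⟩
    · obtain ⟨x, rfl, hx⟩ := (isCriticalPoint_iff hlam.1.ne').1 hQ
      obtain ⟨y, hy, hy0⟩ := (isCriticalPoint_iff hlam.1.ne').1 (hee lam hm).1
      rw [huniq lam hlam x y hx hy0]
      exact hy.symm
    · rintro rfl
      exact (hee lam hm).1
  · intro χ' hχ' t ht
    obtain ⟨hc, h0⟩ := hχ'.planarParam
    have h1 := D.eqOn hv hc (fun t ht => (h0 t ht).1) ht
    rw [← (h0 t ht).2]
    exact congrArg (planarConf θ) h1
  · intro Λ' χ' hΛ' hχ' hst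
    obtain ⟨hc, h0⟩ := hχ'.planarParam
    obtain ⟨hpos, hend'⟩ := (isStabilityEndpoint_iff hΛ' fun t ht => (h0 t ht).2).1 hst
    have hv' : IsStableBranch (planarEq θ) (planarNu θ) Λ' fun t => planarParam (χ' t) :=
      ⟨hc, fun t ht => ⟨(h0 t ht).1, hpos t ht⟩⟩
    exact le_antisymm (D.le_of_isDegenerateEnd hΛ hv hend hv')
      (D.le_of_isDegenerateEnd hΛ' hv' hend' hv)
  · intro l hl u hu hul
    obtain ⟨s, w, hs, hw, hw0, hν⟩ := hlim l hl u hu hul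
    have hl0 : 0 < l := by
      rw [hl] at hΛ
      exact_mod_cast hΛ
    exact ⟨s, planarConf θ w, hs, ((contDiff_planarConf θ).continuous.tendsto w).comp hw,
      (isEESolution_iff hl0.ne').2 ⟨w, rfl, hw0⟩, hν⟩
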